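/- Let $m,n\ge 1$ be integers, let $\alpha>\tfrac12(2m-1)$ and put $\nu=\alpha-\tfrac12(m+1)$. Write $\operatorname{etr}(X)=\exp(\operatorname{tr}X)$, write $R>0$ when $R$ is a real symmetric positive definite $m\times m$ matrix, let $dR=\prod_{i\le j}dr_{ij}$, and let $\Gamma_m(a)=\int_{R>0}(\det R)^{a-(m+1)/2}\operatorname{etr}(-R)\,dR$. For a partition $\kappa=(k_1\ge\dots\ge k_m\ge 0)$ with weight $|\kappa|=\sum_j k_j$ and number of nonzero parts $\ell$, put $[a]_\kappa=\prod_{j=1}^m\big(a-\tfrac12(j-1)\big)_{k_j}$, where $(b)_k=b(b+1)\cdots(b+k-1)$. The zonal polynomial is $$C_\kappa(Y)=C_\kappa(I_m)(\det Y)^{k_m}\int_{O(m)}\prod_{j=1}^{m-1}\big({\det}_j(HYH^{-1})\big)^{k_j-k_{j+1}}\,dH,$$ $$C_\kappa(I_m)=2^{2|\kappa|}\,|\kappa|!\,[m/2]_\kappa\,\frac{\prod_{1\le i<j\le \ell}(2k_i-2k_j-i+j)}{\prod_{i=1}^{\ell}(2k_i+\ell-i)!},$$ where $\det_j$ is the leading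 principal minor of order $j$ and $dH$ is the normalized Haar measure on $O(m)$. For symmetric $X,Y$ let $$A_\nu(X,Y)=\frac1{\Gamma_m(\nu+\frac12(m+1))}\sum_{k=0}^\infty\frac{(-1)^k}{k!}\sum_{|\kappa|=k}\frac{C_\kappa(X)\,C_\kappa(Y)}{[\nu+\frac12(m+1)]_\kappa\,C_\kappa(I_m)}.$$ Let $P_0$ be the Wishart distribution $W_m(\alpha,I_m)$, that is, the measure with density $\Gamma_m(\alpha)^{-1}(\det T)^{\alpha-(m+1)/2}\operatorname{etr}(-T)$ on $\{T>0\}$ with respect to $dT$. For positive definite $X_1,\dots,X_n$ (every realization of a sample of positive definite random matrices), put $\bar X_n=n^{-1}\sum_j X_j$, $Y_j=\bar X_n^{-1/2}X_j\bar X_n^{-1/2}$, and $$\widetilde{\mathcal H}_n(T)=\Gamma_m\big(\nu+\tfrac12(m+1)\big)\,\frac1n\sum_{j=1}^nA_\nu(T,Y_j),\qquad \boldsymbol T_n^2=n\int_{T>0}\big[\widetilde{\mathcal H}_n(T)-\operatorname{etr}(-T/\alpha)\big]^2\,dP_0(T).$$ Then the series defining $A_\nu(X,Y)$ converges for all symmetric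 $X,Y$, the integrand of $\boldsymbol T_n^2$ is $P_0$-integrable, and $\boldsymbol T_n^2$ is a $V$-statistic of order 2 in the $Y_j$: $$\boldsymbol T_n^2=\frac1n\sum_{i=1}^n\sum_{j=1}^nh(Y_i,Y_j),$$ where the kernel $h$ is symmetric, $h(X,Y)=h(Y,X)$ for $X,Y>0$, and is given by $$h(X,Y)=\Gamma_m(\alpha)\operatorname{etr}(-X-Y)\,A_\nu(-X,Y)-\Big(\frac{\alpha}{\alpha+1}\Big)^{m\alpha}\Big[\operatorname{etr}\Big(-\frac{\alpha}{\alpha+1}X\Big)+\operatorname{etr}\Big(-\frac{\alpha}{\alpha+1}Y\Big)\Big]+\Big(\frac2\alpha+1\Big)^{-m\alpha}.$$ -/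

import Mathlib

open MeasureTheory Matrix
open scoped BigOperators

noncomputable section

namespace WishartGOF

/-- The space of real `m × m` matrices. -/
abbrev Mat (m : ℕ) : Type := Matrix (Fin m) (Fin m) ℝ

/-- The product (equivalently Borel) `σ`-algebra on real `m × m` matrices. -/
instance instMeasurableSpaceMat (m : ℕ) : MeasurableSpace (Mat m) :=
  inferInstanceAs (MeasurableSpace (Fin m → Fin m → ℝ))

instance instBorelSpaceMat (m : ℕ) : BorelSpace (Mat m) :=
  inferInstanceAs (BorelSpace (Fin m → Fin m → ℝ))

/-- `etr X = exp (tr X)`. -/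
def etr {m : ℕ} (X : Mat m) : ℝ := Real.exp X.trace

/-! ### Integration over the symmetric and the positive definite matrices -/

/-- Positions on or above the diagonal: the coordinates on the space of symmetric matrices. -/
abbrev UpperIdx (m : ℕ) : Type := {p : Fin m × Fin m // p.1 ≤ p.2}

/-- The symmetric matrix whose entries on and above the diagonal are given by `x`. -/
def symOfCoords {m : ℕ} (x : UpperIdx m → ℝ) : Mat m :=
  Matrix.of fun i j =>
    if h : i ≤ j then x ⟨(i, j), h⟩ else x ⟨(j, i), le_of_not_ge h⟩

/-- The Lebesgue measure `dR = ∏_{i ≤ j} dr_{ij}` on the symmetric matrices, as a measure on all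
matrices. -/
def symLebesgue (m : ℕ) : Measure (Mat m) :=
  Measure.map symOfCoords (volume : Measure (UpperIdx m → ℝ))

/-- The cone of positive definite matrices. -/
def posDefCone (m : ℕ) : Set (Mat m) := {R | R.PosDef}

/-- The multivariate gamma function
`Γ_m(a) = ∫_{R > 0} (det R)^{a - (m+1)/2} etr(-R) dR` (for real `a > (m-1)/2`). -/
def multiGamma (m : ℕ) (a : ℝ) : ℝ :=
  ∫ R in posDefCone m, R.det ^ (a - ((m : ℝ) + 1) / 2) * etr (-R) ∂(symLebesgue m)

/-- The density of the Wishart distribution `W_m(α, S)`, `S > 0`, at a positive definite `X`. -/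
def wishartDensity {m : ℕ} (α : ℝ) (S X : Mat m) : ℝ :=
  (multiGamma m α)⁻¹ * S.det ^ α * X.det ^ (α - ((m : ℝ) + 1) / 2) * etr (-(S * X))

/-- The Wishart distribution `W_m(α, S)`. -/
def wishart {m : ℕ} (α : ℝ) (S : Mat m) : Measure (Mat m) :=
  ((symLebesgue m).restrict (posDefCone m)).withDensity
    fun X => ENNReal.ofReal (wishartDensity α S X)

/-! ### Haar measure on the orthogonal group -/

/-- The group `O(m)`. -/
abbrev Orth (m : ℕ) : Type := Matrix.orthogonalGroup (Fin m) ℝ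

instance instCompactSpaceOrth (m : ℕ) : CompactSpace (Orth m) := by
  refine isCompact_iff_compactSpace.mp ?_
  have hK : IsCompact
      (Set.pi Set.univ fun _ : Fin m => Set.pi Set.univ fun _ : Fin m => Set.Icc (-1 : ℝ) 1) :=
    isCompact_univ_pi fun _ => isCompact_univ_pi fun _ => isCompact_Icc
  refine IsCompact.of_isClosed_subset (X := Mat m) hK isClosed_unitary ?_
  intro U hU i _ j _
  have h := entry_norm_bound_of_unitary (𝕜 := ℝ) hU i j
  exact abs_le.mp h

/-- The Haar measure `dH` on `O(m)`, normalized to have total mass one. -/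
def orthHaar (m : ℕ) : Measure (Orth m) :=
  Measure.haarMeasure (⊤ : TopologicalSpace.PositiveCompacts (Orth m))

/-! ### Zonal polynomials -/

/-- The partitions `κ = (k_1 ≥ ⋯ ≥ k_m ≥ 0)` of weight `k`; the part `k_{i+1}` is `κ i`. -/
def partitions (m k : ℕ) : Finset (Fin m → ℕ) :=
  open Classical in (Finset.piAntidiag Finset.univ k).filter fun κ => Antitone κ

/-- The parts of `κ`, counted from zero and continued by `0` beyond the last one. -/
def part {m : ℕ} (κ : Fin m → ℕ) (i : ℕ) : ℕ := if h : i < m then κ ⟨i, h⟩ else 0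

/-- The weight `|κ|`. -/
def weight {m : ℕ} (κ : Fin m → ℕ) : ℕ := ∑ i, κ i

/-- The length `ℓ(κ)`, the number of nonzero parts. -/
def len {m : ℕ} (κ : Fin m → ℕ) : ℕ := (Finset.univ.filter fun i => κ i ≠ 0).card

/-- The partitional shifted factorial `[a]_κ = ∏_{j=1}^m (a - (j-1)/2)_{k_j}`. -/
def shiftedFactorial {m : ℕ} (a : ℝ) (κ : Fin m → ℕ) : ℝ :=
  ∏ j : Fin m, (ascPochhammer ℝ (κ j)).eval (a - (j : ℝ) / 2)

/-- The leading principal minor of `Y` of order `j + 1`. -/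
def leadingMinor {m : ℕ} (Y : Mat m) (j : Fin m) : ℝ :=
  (Y.submatrix (Fin.castLE (Nat.succ_le_of_lt j.isLt))
    (Fin.castLE (Nat.succ_le_of_lt j.isLt))).det

/-- The value `C_κ(I_m)` of the zonal polynomial at the identity,
`2^{2|κ|} |κ|! [m/2]_κ ∏_{i<j≤ℓ} (2k_i - 2k_j - i + j) / ∏_{i≤ℓ} (2k_i + ℓ - i)!`
(indices from one in this formula, from zero in the code). -/
def zonalOne {m : ℕ} (κ : Fin m → ℕ) : ℝ :=
  2 ^ (2 * weight κ) * (Nat.factorial (weight κ) : ℝ) * shiftedFactorial ((m : ℝ) / 2) κ *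
    (∏ j ∈ Finset.range (len κ), ∏ i ∈ Finset.range j,
      (2 * (part κ i : ℝ) - 2 * (part κ j : ℝ) - (i : ℝ) + (j : ℝ))) /
    ∏ i ∈ Finset.range (len κ), (Nat.factorial (2 * part κ i + len κ - (i + 1)) : ℝ)

/-- The zonal polynomial
`C_κ(Y) = C_κ(I_m) (det Y)^{k_m} ∫_{O(m)} ∏_{j<m} det_j(H Y H⁻¹)^{k_j - k_{j+1}} dH`.
As `det_m(H Y H⁻¹) = det Y`, the factor `(det Y)^{k_m}` is the one with index `j = m` in the
product below, where `k_{m+1} = 0`. -/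
def zonal {m : ℕ} (κ : Fin m → ℕ) (Y : Mat m) : ℝ :=
  zonalOne κ *
    ∫ H : Orth m,
      ∏ j : Fin m, leadingMinor ((H : Mat m) * Y * (H : Mat m)ᵀ) j ^ (κ j - part κ (j + 1))
      ∂(orthHaar m)

/-! ### The Bessel function of two matrix arguments -/

/-- The part of degree `k` of the series of `Γ_m(ν + (m+1)/2) A_ν(X, Y)`. -/
def besselTerm {m : ℕ} (ν : ℝ) (X Y : Mat m) (k : ℕ) : ℝ :=
  (-1) ^ k / (Nat.factorial k : ℝ) *
    ∑ κ ∈ partitions m k,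
      zonal κ X * zonal κ Y /
        (shiftedFactorial (ν + ((m : ℝ) + 1) / 2) κ * zonal κ (1 : Mat m))

/-- The Bessel function `A_ν(X, Y)` of order `ν` with two matrix arguments. -/
def besselA {m : ℕ} (ν : ℝ) (X Y : Mat m) : ℝ :=
  (multiGamma m (ν + ((m : ℝ) + 1) / 2))⁻¹ * ∑' k, besselTerm ν X Y k

/-! ### The test statistic -/

/-- The sample mean. -/
def sampleMean {m n : ℕ} (X : Fin n → Mat m) : Mat m := (n : ℝ)⁻¹ • ∑ j, X j

open scoped MatrixOrder in
/-- The inverse `M^{-1/2}` of the positive definite square root of a positive definite matrix. -/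
def invSqrt {m : ℕ} (M : Mat m) : Mat m := (CFC.sqrt M)⁻¹

/-- The scaled observations `Y_j = X̄^{-1/2} X_j X̄^{-1/2}`. -/
def scaled {m n : ℕ} (X : Fin n → Mat m) (j : Fin n) : Mat m :=
  invSqrt (sampleMean X) * X j * invSqrt (sampleMean X)

/-- The empirical orthogonally invariant Hankel transform of order `ν` of `Y_1, …, Y_n`. -/
def empiricalHankel {m n : ℕ} (ν : ℝ) (Y : Fin n → Mat m) (T : Mat m) : ℝ :=
  multiGamma m (ν + ((m : ℝ) + 1) / 2) * ((n : ℝ)⁻¹ * ∑ j, besselA ν T (Y j))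

/-- The order `ν = α - (m+1)/2` that belongs to the shape parameter `α`. -/
def order (m : ℕ) (α : ℝ) : ℝ := α - ((m : ℝ) + 1) / 2

/-- The integrand of the test statistic. -/
def statIntegrand {m n : ℕ} (α : ℝ) (X : Fin n → Mat m) (T : Mat m) : ℝ :=
  (empiricalHankel (order m α) (scaled X) T - etr (-(α⁻¹ • T))) ^ 2

/-- The test statistic `T_n² = n ∫_{T > 0} [H̃_n(T) - etr(-T/α)]² dP_0(T)`, with `P_0` the
Wishart distribution `W_m(α, I_m)`. -/
def testStatistic {m n : ℕ} (α : ℝ) (X : Fin n → Mat m) : ℝ :=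
  (n : ℝ) * ∫ T, statIntegrand α X T ∂(wishart α (1 : Mat m))

/-- The kernel `h`. -/
def kernelH {m : ℕ} (α : ℝ) (X Y : Mat m) : ℝ :=
  multiGamma m α * etr (-X - Y) * besselA (order m α) (-X) Y
    - (α / (α + 1)) ^ ((m : ℝ) * α) *
        (etr (-((α / (α + 1)) • X)) + etr (-((α / (α + 1)) • Y)))
    + (2 / α + 1) ^ (-((m : ℝ) * α))

end WishartGOF

end

namespace WishartGOF

/-! ### Topology and measure on matrices and on the orthogonal group -/

/-! Write B(T,X) for `bessel`, which equals Γ_m(α) A_ν(T,X) for ν = α - (m+1)/2. Expanding the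
square turns the statistic into a double sum over pairs of sample points, so everything reduces to
three integrals against the Wishart law P_0: those of etr(-cT), of etr(-cT) B(T,X), and of B(T,X)
B(T,Y). The last one is a matrix form of Weber's second exponential integral; its value etr(-X-Y)
B(-X,Y) is the heart of the matter (`integral_bessel_mul_bessel`).

Three properties of the normalized zonal polynomials φ_κ (`spherical`) carry the proof. (1) The
product formula ∫ φ_κ(A H S Hᵀ Aᵀ) dH = φ_κ(A Aᵀ) φ_κ(S) (`integral_spherical_conj`). It follows
from the factorization of a matrix into a lower triangular and an orthogonal one, since leading
minors are multiplicative under triangular congruence. (2) Wishart averaging of shape a sends φ_κ(A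
T Aᵀ) to [a]_κ φ_κ(A Aᵀ) (`integral_spherical_conj_wishart`), by (1) and the multivariate gamma
integral. (3) (tr Y)^k = ∑ C_κ(Y), summed over |κ| = k, with exactly the stated constants C_κ(I_m)
(`trace_pow_eq_sum_zonal`).

For (3), the φ_κ of degree k are linearly independent and, by a dimension count, span the symmetric
forms of degree k in the eigenvalues, so an expansion with some coefficients exists. These
coefficients obey two recursions. Appending a zero part corresponds to restriction to singular
matrices, where the value of φ_κ at diag(1,…,1,0) is found from a Gaussian integral. Raising all
parts by one corresponds to the symmetry of the coefficients of det(1+tY)^N under Y ↦ Y⁻¹. The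
explicit constants obey the same recursions.

For the Weber integral, the factors [α]_κ in the denominators of the Bessel series cancel under
Wishart averaging, so the Laplace transform of B(·,X) at Z is (det Z)^(-α) ∫ etr(-Z⁻¹ H X Hᵀ) dH.
Take Z = 1+tD with D diagonal. Expansion in t produces the moments of B(·,X) against the φ_κ. On the
other hand Z⁻¹ = 1 - tDZ⁻¹ splits off etr(-X), and what remains is the Wishart average of etr(-Y)
B(-X,Y) along Y = tD^(1/2) T D^(1/2). Comparing powers of t and cancelling [α]_κ by linear
independence (`dampedCoeff_eq_moments`) expresses the homogeneous parts of etr(-X-Y) B(-X,Y) by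
these moments. Summation over the degrees is integration of the series of B(T,Y) against B(T,X).

All exchanges of sum and integral are dominated: 1/[α]_κ contributes a second factorial to the
Bessel series, whence |B(T,X)| ≤ C_ε exp(ε tr T) for every ε > 0. -/

instance instSecondCountableMat (m : ℕ) : SecondCountableTopology (Mat m) :=
  inferInstanceAs (SecondCountableTopology (Fin m → Fin m → ℝ))

instance instSecondCountableOrth (m : ℕ) : SecondCountableTopology (Orth m) :=
  TopologicalSpace.Subtype.secondCountableTopology _

instance instFirstCountableMat (m : ℕ) : FirstCountableTopology (Mat m) :=
  inferInstanceAs (FirstCountableTopology (Fin m → Fin m → ℝ))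

instance instLocallyCompactMat (m : ℕ) : LocallyCompactSpace (Mat m) :=
  inferInstanceAs (LocallyCompactSpace (Fin m → Fin m → ℝ))

instance instT2Mat (m : ℕ) : T2Space (Mat m) :=
  inferInstanceAs (T2Space (Fin m → Fin m → ℝ))

instance instIsHaarMeasureOrthHaar (m : ℕ) : (orthHaar m).IsHaarMeasure := by
  unfold orthHaar; infer_instance

theorem orthHaar_univ (m : ℕ) : orthHaar m Set.univ = 1 := by
  have := Measure.haarMeasure_self (K₀ := (⊤ : TopologicalSpace.PositiveCompacts (Orth m)))
  simpa [orthHaar] using this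

instance instIsProbabilityMeasureOrthHaar (m : ℕ) : IsProbabilityMeasure (orthHaar m) :=
  ⟨orthHaar_univ m⟩

/-- A right translate of a left invariant measure is left invariant, hence a multiple of the
original by uniqueness. Total mass one on the compact group forces the factor one. -/
instance instIsMulRightInvariantOrthHaar (m : ℕ) : (orthHaar m).IsMulRightInvariant := by
  refine ⟨fun g => ?_⟩
  have hh : (Measure.map (· * g) (orthHaar m)).IsMulLeftInvariant := by infer_instance
  have h := Measure.isMulInvariant_eq_smul_of_compactSpace
    (Measure.map (· * g) (orthHaar m)) (orthHaar m)
  have h1 : Measure.map (· * g) (orthHaar m) Set.univ = 1 := by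
    rw [Measure.map_apply (by fun_prop) MeasurableSet.univ]; simp
  rw [h] at h1
  rw [h]
  simp only [Measure.smul_apply, orthHaar_univ] at h1
  have h2 : (Measure.map (· * g) (orthHaar m)).haarScalarFactor (orthHaar m) = 1 := by
    simpa [ENNReal.smul_def] using h1
  rw [h2, one_smul]

theorem Orth.mul_transpose {m : ℕ} (H : Orth m) : (H : Mat m) * (H : Mat m)ᵀ = 1 :=
  (mem_orthogonalGroup_iff _ _).mp H.2

theorem Orth.transpose_mul {m : ℕ} (H : Orth m) : (H : Mat m)ᵀ * (H : Mat m) = 1 :=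
  (mem_orthogonalGroup_iff' _ _).mp H.2

theorem Orth.continuous_coe {m : ℕ} : Continuous (fun H : Orth m => (H : Mat m)) :=
  continuous_subtype_val

theorem Orth.abs_le_one {m : ℕ} (H : Orth m) (i j : Fin m) : |(H : Mat m) i j| ≤ 1 :=
  entry_norm_bound_of_unitary (𝕜 := ℝ) H.2 i j

/-- A continuous function on the orthogonal group is integrable. -/
theorem integrable_orth {m : ℕ} {f : Orth m → ℝ} (hf : Continuous f) :
    Integrable f (orthHaar m) := by
  rw [← integrableOn_univ]
  exact hf.continuousOn.integrableOn_compact isCompact_univ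

theorem continuous_integral_orth {m : ℕ} {X : Type*} [TopologicalSpace X]
    [FirstCountableTopology X] [LocallyCompactSpace X] {f : X → Orth m → ℝ}
    (hf : Continuous (Function.uncurry f)) : Continuous fun x => ∫ H, f x H ∂(orthHaar m) := by
  have := continuous_parametric_integral_of_continuous (μ := orthHaar m) hf
    (s := Set.univ) isCompact_univ
  simpa using this

/-! ### Power functions -/

/-- The generalized power function `∏_j det_j(Y)^{κ_j - κ_{j+1}}`. -/
noncomputable def powerFn {m : ℕ} (κ : Fin m → ℕ) (Y : Mat m) : ℝ :=
  ∏ j : Fin m, leadingMinor Y j ^ (κ j - part κ (j + 1))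

/-- The spherical polynomial: the orthogonal average of the power function. -/
noncomputable def spherical {m : ℕ} (κ : Fin m → ℕ) (Y : Mat m) : ℝ :=
  ∫ H : Orth m, powerFn κ ((H : Mat m) * Y * (H : Mat m)ᵀ) ∂(orthHaar m)

theorem zonal_eq {m : ℕ} (κ : Fin m → ℕ) (Y : Mat m) :
    zonal κ Y = zonalOne κ * spherical κ Y := rfl

theorem continuous_leadingMinor {m : ℕ} (j : Fin m) :
    Continuous fun Y : Mat m => leadingMinor Y j := by
  unfold leadingMinor
  fun_prop

theorem continuous_powerFn {m : ℕ} (κ : Fin m → ℕ) : Continuous (powerFn κ) := by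
  unfold powerFn
  exact continuous_finsetProd _ fun j _ => (continuous_leadingMinor j).pow _

theorem continuous_spherical {m : ℕ} (κ : Fin m → ℕ) : Continuous (spherical κ) := by
  unfold spherical
  refine continuous_integral_orth (f := fun Y (H : Orth m) =>
    powerFn κ ((H : Mat m) * Y * (H : Mat m)ᵀ)) ?_
  refine (continuous_powerFn κ).comp ?_
  have := Orth.continuous_coe (m := m)
  fun_prop

/-- The first k rows of a lower triangular matrix vanish beyond column k, so the upper left corner
of the product sees only the two corners. -/
theorem submatrix_castLE_lower_mul {m : ℕ} {L : Mat m} (hL : ∀ i j, i < j → L i j = 0) (S : Mat m)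
    {k : ℕ} (hk : k ≤ m) :
    (L * S).submatrix (Fin.castLE hk) (Fin.castLE hk) =
      L.submatrix (Fin.castLE hk) (Fin.castLE hk) *
        S.submatrix (Fin.castLE hk) (Fin.castLE hk) := by
  ext i j
  simp only [submatrix_apply, mul_apply]
  have hinj : Function.Injective (Fin.castLE hk) := Fin.castLE_injective hk
  rw [← Finset.sum_image (f := fun x => L (Fin.castLE hk i) x * S x (Fin.castLE hk j))
    (g := Fin.castLE hk) (s := Finset.univ) (fun a _ b _ h => hinj h)]
  refine (Finset.sum_subset (Finset.subset_univ _) fun x _ hx => ?_).symm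
  rw [hL, zero_mul]
  by_contra hlt
  apply hx
  have hxk : (x : ℕ) < k := lt_of_le_of_lt (not_lt.mp hlt) i.isLt
  exact Finset.mem_image.mpr ⟨⟨x, hxk⟩, Finset.mem_univ _, rfl⟩

theorem submatrix_castLE_mul_upper {m : ℕ} {L : Mat m} (hL : ∀ i j, i < j → L i j = 0) (S : Mat m)
    {k : ℕ} (hk : k ≤ m) :
    (S * Lᵀ).submatrix (Fin.castLE hk) (Fin.castLE hk) =
      S.submatrix (Fin.castLE hk) (Fin.castLE hk) *
        (L.submatrix (Fin.castLE hk) (Fin.castLE hk))ᵀ := by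
  have h := congrArg Matrix.transpose (submatrix_castLE_lower_mul hL Sᵀ hk)
  simpa [transpose_submatrix, transpose_mul] using h

theorem leadingMinor_lower {m : ℕ} {L : Mat m} (hL : ∀ i j, i < j → L i j = 0) (S : Mat m)
    (j : Fin m) :
    leadingMinor (L * S * Lᵀ) j = leadingMinor (L * Lᵀ) j * leadingMinor S j := by
  unfold leadingMinor
  have h1 := submatrix_castLE_mul_upper hL L (Nat.succ_le_of_lt j.isLt)
  rw [h1, submatrix_castLE_mul_upper hL (L * S), submatrix_castLE_lower_mul hL S]
  simp only [det_mul, det_transpose]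
  ring

/-- Leading minors are multiplicative under lower triangular congruence, so the power function
behaves like a character of the triangular group. All averaging formulas below rest on this. -/
theorem powerFn_lower {m : ℕ} (κ : Fin m → ℕ) {L : Mat m} (hL : ∀ i j, i < j → L i j = 0)
    (S : Mat m) : powerFn κ (L * S * Lᵀ) = powerFn κ (L * Lᵀ) * powerFn κ S := by
  simp only [powerFn, leadingMinor_lower hL, mul_pow, Finset.prod_mul_distrib]

theorem powerFn_one {m : ℕ} (κ : Fin m → ℕ) : powerFn κ (1 : Mat m) = 1 := by
  refine Finset.prod_eq_one fun j _ => ?_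
  unfold leadingMinor
  rw [submatrix_one _ (Fin.castLE_injective _)]
  simp

/-! ### Factorization into a lower triangular and an orthogonal matrix -/

/-- The LDL decomposition of A Aᵀ provides a lower triangular N with N A Aᵀ Nᵀ = diag(d) and d > 0.
Rescaling the rows to M = diag(d)^(-1/2) N makes M A orthogonal, and A = M⁻¹ (M A). -/
theorem exists_lower_mul_orth {m : ℕ} (A : Mat m) (hA : IsUnit A.det) :
    ∃ (L : Mat m) (O : Orth m), (∀ i j, i < j → L i j = 0) ∧ A = L * (O : Mat m) := by
  have hAu : IsUnit A := (Matrix.isUnit_iff_isUnit_det A).mpr hA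
  have hS : (A * Aᴴ).PosDef := by
    refine PosDef.mul_conjTranspose_self A ?_
    intro x y hxy
    exact Matrix.vecMul_injective_of_isUnit hAu hxy
  set N := LDL.lowerInv hS with hN
  have hNt : ∀ i j, i < j → N i j = 0 := fun i j hij => LDL.lowerInv_triangular hS hij
  have hD : LDL.diag hS = N * (A * Aᴴ) * Nᴴ := LDL.diag_eq_lowerInv_conj hS
  have hNu : IsUnit N := by
    have := (LDL.invertibleLowerInv hS)
    exact isUnit_of_invertible N
  have hDp : (LDL.diag hS).PosDef := by
    rw [hD]
    exact (Matrix.IsUnit.posDef_star_right_conjugate_iff hNu).mpr hS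
  have hd : ∀ i, 0 < LDL.diagEntries hS i := by
    rw [LDL.diag, posDef_diagonal_iff] at hDp
    exact hDp
  set d := LDL.diagEntries hS
  set E : Mat m := diagonal fun i => (Real.sqrt (d i))⁻¹
  have hE : E * diagonal d * Eᵀ = 1 := by
    simp only [E, diagonal_transpose, diagonal_mul_diagonal]
    rw [← diagonal_one]
    congr 1
    ext i
    have := Real.sqrt_pos.mpr (hd i)
    have h2 := Real.mul_self_sqrt (hd i).le
    field_simp
    nlinarith
  set M : Mat m := E * N
  have hMt : ∀ i j, i < j → M i j = 0 := by
    intro i j hij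
    simp [M, E, diagonal_mul, hNt i j hij]
  have hO : (M * A) * (M * A)ᵀ = 1 := by
    rw [← hE]
    have : diagonal d = N * (A * Aᴴ) * Nᴴ := hD
    rw [this]
    simp only [M, transpose_mul, conjTranspose_eq_transpose_of_trivial, Matrix.mul_assoc]
  have hMA : M * (A * (M * A)ᵀ) = 1 := by rw [← Matrix.mul_assoc]; exact hO
  -- The lower triangular factor is M⁻¹, written as A (M A)ᵀ because M times this matrix is 1.
  refine ⟨A * (M * A)ᵀ, ⟨M * A, (mem_orthogonalGroup_iff _ _).mpr hO⟩, ?_, ?_⟩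
  · have hinv : A * (M * A)ᵀ = M⁻¹ := (Matrix.inv_eq_right_inv hMA).symm
    rw [hinv]
    have hMI : Invertible M := invertibleOfRightInverse _ _ hMA
    have hb : BlockTriangular M OrderDual.toDual := by
      intro i j hij
      exact hMt i j hij
    have := blockTriangular_inv_of_blockTriangular hb
    intro i j hij
    exact this hij
  · have hO' := (mem_orthogonalGroup_iff' _ _).mp ((mem_orthogonalGroup_iff (Fin m) ℝ).mpr hO)
    change A = A * (M * A)ᵀ * (M * A)
    rw [Matrix.mul_assoc, hO', Matrix.mul_one]

/-! ### Invariance and the splitting property -/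

theorem spherical_orth_left {m : ℕ} (κ : Fin m → ℕ) (K : Orth m) (Y : Mat m) :
    spherical κ ((K : Mat m) * Y * (K : Mat m)ᵀ) = spherical κ Y := by
  unfold spherical
  rw [← integral_mul_right_eq_self (μ := orthHaar m)
    (fun H : Orth m => powerFn κ ((H : Mat m) * Y * (H : Mat m)ᵀ)) K]
  congr 1
  ext H
  congr 1
  simp [transpose_mul, Matrix.mul_assoc]

theorem spherical_one {m : ℕ} (κ : Fin m → ℕ) : spherical κ (1 : Mat m) = 1 := by
  unfold spherical
  simp [Orth.mul_transpose, powerFn_one]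

/-- In B = L O the orthogonal factor is absorbed by the left invariance of Haar measure, and the
triangular factor comes out by `powerFn_lower`. -/
theorem integral_powerFn_conj_of_isUnit {m : ℕ} (κ : Fin m → ℕ) (B Y : Mat m)
    (hB : IsUnit B.det) :
    ∫ K : Orth m, powerFn κ (B * ((K : Mat m) * Y * (K : Mat m)ᵀ) * Bᵀ) ∂(orthHaar m) =
      powerFn κ (B * Bᵀ) * spherical κ Y := by
  obtain ⟨L, O, hL, rfl⟩ := exists_lower_mul_orth B hB
  have h1 : (L * (O : Mat m)) * (L * (O : Mat m))ᵀ = L * Lᵀ := by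
    rw [transpose_mul, Matrix.mul_assoc, ← Matrix.mul_assoc (O : Mat m), Orth.mul_transpose,
      Matrix.one_mul]
  rw [h1]
  have h2 : ∀ K : Orth m, powerFn κ ((L * (O : Mat m)) * ((K : Mat m) * Y * (K : Mat m)ᵀ) *
      (L * (O : Mat m))ᵀ) = powerFn κ (L * Lᵀ) *
        powerFn κ (((O * K : Orth m) : Mat m) * Y * ((O * K : Orth m) : Mat m)ᵀ) := by
    intro K
    rw [← powerFn_lower κ hL]
    congr 1
    simp [transpose_mul, Matrix.mul_assoc]
  simp_rw [h2]
  rw [integral_const_mul, integral_mul_left_eq_self (μ := orthHaar m)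
    (fun H : Orth m => powerFn κ ((H : Mat m) * Y * (H : Mat m)ᵀ)) O]
  rfl

/-- B - c is invertible unless c is one of the finitely many roots of the characteristic polynomial,
so c can tend to zero through admissible values. -/
theorem dense_isUnit_det (m : ℕ) : Dense {B : Mat m | IsUnit B.det} := by
  intro B
  have hfin : {c : ℝ | (B.charpoly).IsRoot c}.Finite :=
    Polynomial.finite_setOfPred_isRoot B.charpoly_monic.ne_zero
  have hseq : ∃ u : ℕ → ℝ, (∀ n, u n ∉ {c : ℝ | (B.charpoly).IsRoot c}) ∧
      Filter.Tendsto u Filter.atTop (nhds 0) := by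
    have hd : Dense ({c : ℝ | (B.charpoly).IsRoot c}ᶜ) := (Set.Finite.countable hfin).dense_compl ℝ
    obtain ⟨u, hu, hu'⟩ := mem_closure_iff_seq_limit.mp (hd 0)
    exact ⟨u, hu, hu'⟩
  obtain ⟨u, hu, hu0⟩ := hseq
  have hcont : Continuous fun c : ℝ => B - c • (1 : Mat m) := by fun_prop
  have hlim := (hcont.tendsto 0).comp hu0
  simp only [zero_smul, sub_zero] at hlim
  refine mem_closure_of_tendsto hlim (Filter.Eventually.of_forall fun n => ?_)
  have h := hu n
  simp only [Set.mem_ofPred_eq, Polynomial.IsRoot, Matrix.eval_charpoly] at h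
  simp only [Function.comp, Set.mem_ofPred_eq, isUnit_iff_ne_zero]
  intro h0
  apply h
  rw [← neg_sub, det_neg]
  rw [show B - scalar (Fin m) (u n) = B - u n • (1 : Mat m) by
    rw [smul_one_eq_diagonal]; rfl, h0, mul_zero]

/-- Both sides are continuous in B, so invertibility can be dropped by density. Singular B do occur
later, as corners of orthogonal matrices. -/
theorem integral_powerFn_conj {m : ℕ} (κ : Fin m → ℕ) (B Y : Mat m) :
    ∫ K : Orth m, powerFn κ (B * ((K : Mat m) * Y * (K : Mat m)ᵀ) * Bᵀ) ∂(orthHaar m) =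
      powerFn κ (B * Bᵀ) * spherical κ Y := by
  have hc := Orth.continuous_coe (m := m)
  have hl : Continuous fun B : Mat m =>
      ∫ K : Orth m, powerFn κ (B * ((K : Mat m) * Y * (K : Mat m)ᵀ) * Bᵀ) ∂(orthHaar m) := by
    refine continuous_integral_orth (f := fun B (K : Orth m) =>
      powerFn κ (B * ((K : Mat m) * Y * (K : Mat m)ᵀ) * Bᵀ)) ?_
    refine (continuous_powerFn κ).comp ?_
    fun_prop
  have hr : Continuous fun B : Mat m => powerFn κ (B * Bᵀ) * spherical κ Y :=
    ((continuous_powerFn κ).comp (by fun_prop)).mul continuous_const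
  exact congrFun (Continuous.ext_on (dense_isUnit_det m) hl hr
    fun B hB => integral_powerFn_conj_of_isUnit κ B Y hB) B

/-- The product formula for spherical polynomials. -/
theorem integral_spherical_conj {m : ℕ} (κ : Fin m → ℕ) (A S : Mat m) :
    ∫ H : Orth m, spherical κ (A * ((H : Mat m) * S * (H : Mat m)ᵀ) * Aᵀ) ∂(orthHaar m) =
      spherical κ (A * Aᵀ) * spherical κ S := by
  have hc := Orth.continuous_coe (m := m)
  unfold spherical
  -- With the average over H inside, the previous formula applies to B = K A; the remaining average
  -- over K is the spherical polynomial at A Aᵀ.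
  rw [integral_integral_swap]
  · have h : ∀ K : Orth m,
        ∫ H : Orth m, powerFn κ ((K : Mat m) * (A * ((H : Mat m) * S * (H : Mat m)ᵀ) * Aᵀ) *
          (K : Mat m)ᵀ) ∂(orthHaar m) =
        powerFn κ ((K : Mat m) * (A * Aᵀ) * (K : Mat m)ᵀ) * spherical κ S := by
      intro K
      have := integral_powerFn_conj κ ((K : Mat m) * A) S
      simp only [transpose_mul, Matrix.mul_assoc] at this ⊢
      exact this
    simp_rw [h]
    rw [integral_mul_const]
    rfl
  · have hcont : Continuous (Function.uncurry fun (H K : Orth m) =>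
        powerFn κ ((K : Mat m) * (A * ((H : Mat m) * S * (H : Mat m)ᵀ) * Aᵀ) * (K : Mat m)ᵀ)) := by
      refine (continuous_powerFn κ).comp ?_
      fun_prop
    rw [← integrableOn_univ]
    exact hcont.continuousOn.integrableOn_compact isCompact_univ

/-! ### Exponents of power functions -/

theorem part_antitone {m : ℕ} {κ : Fin m → ℕ} (hκ : Antitone κ) : Antitone (part κ) := by
  intro i j hij
  unfold part
  split_ifs with hj hi hi
  · exact hκ hij
  · omega
  · exact Nat.zero_le _
  · exact le_rfl

@[simp] theorem part_coe {m : ℕ} (κ : Fin m → ℕ) (i : Fin m) : part κ i = κ i := by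
  simp [part]

/-- The exponents of the minors of index at least i telescope to κ i, since `part` continues κ by
zero beyond the last index. -/
theorem sum_part_sub {m : ℕ} {κ : Fin m → ℕ} (hκ : Antitone κ) (i : Fin m) :
    ∑ j, (if i ≤ j then κ j - part κ (j + 1) else 0) = κ i := by
  have h1 : ∀ n, (i : ℕ) ≤ n →
      ∑ j ∈ Finset.range n, (if (i : ℕ) ≤ j then part κ j - part κ (j + 1) else 0) + part κ n =
        part κ i := by
    intro n hn
    induction n, hn using Nat.le_induction with
    | base =>
      rw [Finset.sum_eq_zero, zero_add]
      intro j hj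
      rw [if_neg (by simpa using hj)]
    | succ n hn ih =>
      rw [Finset.sum_range_succ, if_pos hn, ← ih]
      have := part_antitone hκ (Nat.le_succ n)
      simp only [Nat.succ_eq_add_one] at this
      omega
  have h2 := h1 m i.isLt.le
  have h3 : part κ m = 0 := by simp [part]
  rw [h3, add_zero, part_coe] at h2
  rw [← h2, ← Fin.sum_univ_eq_sum_range
    (fun j => if (i : ℕ) ≤ j then part κ j - part κ (j + 1) else 0)]
  simp

/-- After exchanging the products, a i carries the exponents of all minors with index j ≥ i, and
these telescope to κ i. -/
theorem prod_prod_pow {m : ℕ} {κ : Fin m → ℕ} (hκ : Antitone κ) (a : Fin m → ℝ) :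
    ∏ j, (∏ i ∈ Finset.univ.filter (· ≤ j), a i) ^ (κ j - part κ (j + 1)) = ∏ i, a i ^ κ i := by
  simp_rw [Finset.prod_filter, ← Finset.prod_pow]
  rw [Finset.prod_comm]
  refine Finset.prod_congr rfl fun i _ => ?_
  conv_rhs => rw [← sum_part_sub hκ i, ← Finset.prod_pow_eq_pow_sum]
  refine Finset.prod_congr rfl fun j _ => ?_
  split_ifs <;> simp

theorem prod_range_castLE {m : ℕ} (a : Fin m → ℝ) (j : Fin m) :
    ∏ i, a (Fin.castLE (Nat.succ_le_of_lt j.isLt) i) = ∏ i ∈ Finset.univ.filter (· ≤ j), a i := by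
  have hinj : Function.Injective (Fin.castLE (Nat.succ_le_of_lt j.isLt)) := Fin.castLE_injective _
  rw [← Finset.prod_image (f := a) (s := Finset.univ) (fun a _ b _ h => hinj h)]
  congr 1
  ext i
  simp only [Finset.mem_image, Finset.mem_univ, true_and, Finset.mem_filter]
  constructor
  · rintro ⟨x, rfl⟩
    have := x.isLt
    rw [Fin.le_def]; simp; omega
  · intro h
    refine ⟨⟨i, Nat.lt_succ_of_le h⟩, rfl⟩

theorem leadingMinor_mul_transpose {m : ℕ} {L : Mat m} (hL : ∀ i j, i < j → L i j = 0)
    (j : Fin m) : leadingMinor (L * Lᵀ) j = ∏ i ∈ Finset.univ.filter (· ≤ j), L i i ^ 2 := by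
  unfold leadingMinor
  rw [submatrix_castLE_mul_upper hL L, det_mul, det_transpose, det_of_isLowerTriangular,
    ← prod_range_castLE, ← sq, ← Finset.prod_pow]
  · rfl
  · intro a b hab
    exact hL _ _ hab

theorem powerFn_mul_transpose {m : ℕ} {κ : Fin m → ℕ} (hκ : Antitone κ) {L : Mat m}
    (hL : ∀ i j, i < j → L i j = 0) : powerFn κ (L * Lᵀ) = ∏ i, (L i i ^ 2) ^ κ i := by
  simp only [powerFn, leadingMinor_mul_transpose hL, prod_prod_pow hκ (fun i => L i i ^ 2)]

theorem prod_pow_weight {m : ℕ} {κ : Fin m → ℕ} (hκ : Antitone κ) (c : ℝ) :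
    ∏ j : Fin m, (c ^ ((j : ℕ) + 1)) ^ (κ j - part κ (j + 1)) = c ^ weight κ := by
  have h := prod_prod_pow hκ (fun _ => c)
  simp only [Finset.prod_const] at h
  have hc : ∀ j : Fin m, (Finset.univ.filter (· ≤ j)).card = (j : ℕ) + 1 := by
    intro j
    have : (Finset.univ.filter (· ≤ j)) = Finset.Iic j := by ext; simp
    rw [this, Fin.card_Iic]
  simp only [hc] at h
  rw [h, weight, Finset.prod_pow_eq_pow_sum]

theorem leadingMinor_smul {m : ℕ} (c : ℝ) (Y : Mat m) (j : Fin m) :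
    leadingMinor (c • Y) j = c ^ ((j : ℕ) + 1) * leadingMinor Y j := by
  unfold leadingMinor
  rw [submatrix_smul]
  simp

theorem powerFn_smul {m : ℕ} {κ : Fin m → ℕ} (hκ : Antitone κ) (c : ℝ) (Y : Mat m) :
    powerFn κ (c • Y) = c ^ weight κ * powerFn κ Y := by
  simp only [powerFn, leadingMinor_smul, mul_pow, Finset.prod_mul_distrib, prod_pow_weight hκ]

theorem spherical_smul {m : ℕ} {κ : Fin m → ℕ} (hκ : Antitone κ) (c : ℝ) (Y : Mat m) :
    spherical κ (c • Y) = c ^ weight κ * spherical κ Y := by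
  unfold spherical
  rw [← integral_const_mul]
  congr 1
  ext H
  rw [← powerFn_smul hκ]
  simp

theorem spherical_neg {m : ℕ} {κ : Fin m → ℕ} (hκ : Antitone κ) (Y : Mat m) :
    spherical κ (-Y) = (-1) ^ weight κ * spherical κ Y := by
  rw [← spherical_smul hκ, neg_one_smul]

/-- The Leibniz expansion bounds a minor of order j by j! M^j ≤ (m! M)^j, and the exponents weighted
by the orders add up to the weight of κ. -/
theorem abs_powerFn_le {m : ℕ} {κ : Fin m → ℕ} (hκ : Antitone κ) {Y : Mat m} {M : ℝ}
    (hM : ∀ i j, |Y i j| ≤ M) (hM0 : 0 ≤ M) :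
    |powerFn κ Y| ≤ ((Nat.factorial m : ℝ) * M) ^ weight κ := by
  rw [← prod_pow_weight hκ]
  unfold powerFn
  rw [Finset.abs_prod]
  refine Finset.prod_le_prod (fun _ _ => abs_nonneg _) fun j _ => ?_
  rw [abs_pow]
  refine pow_le_pow_left₀ (abs_nonneg _) ?_ _
  have h := det_le (A := Y.submatrix (Fin.castLE (Nat.succ_le_of_lt j.isLt))
    (Fin.castLE (Nat.succ_le_of_lt j.isLt))) (abv := IsAbsoluteValue.toAbsoluteValue (abs : ℝ → ℝ))
    (x := M) (fun a b => hM _ _)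
  simp only [Fintype.card_fin, nsmul_eq_mul] at h
  refine le_trans h ?_
  rw [mul_pow]
  refine mul_le_mul_of_nonneg_right ?_ (by positivity)
  have h1 : Nat.factorial ((j : ℕ) + 1) ≤ Nat.factorial m :=
    Nat.factorial_le (Nat.succ_le_of_lt j.isLt)
  have h2 : (1 : ℝ) ≤ (Nat.factorial m : ℝ) := by
    exact_mod_cast Nat.one_le_iff_ne_zero.mpr (Nat.factorial_ne_zero m)
  calc ((Nat.factorial ((j : ℕ) + 1) : ℕ) : ℝ) ≤ (Nat.factorial m : ℝ) := by exact_mod_cast h1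
    _ = (Nat.factorial m : ℝ) ^ 1 := (pow_one _).symm
    _ ≤ _ := pow_le_pow_right₀ h2 (by omega)

theorem abs_conj_le {m : ℕ} (H : Orth m) (Y : Mat m) (i j : Fin m) :
    |((H : Mat m) * Y * (H : Mat m)ᵀ) i j| ≤ ∑ k, ∑ l, |Y k l| := by
  simp only [mul_apply, transpose_apply, Finset.sum_mul]
  rw [Finset.sum_comm]
  refine (Finset.abs_sum_le_sum_abs _ _).trans (Finset.sum_le_sum fun k _ => ?_)
  refine (Finset.abs_sum_le_sum_abs _ _).trans (Finset.sum_le_sum fun l _ => ?_)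
  rw [abs_mul, abs_mul]
  have h1 := H.abs_le_one i k
  have h2 := H.abs_le_one j l
  have h3 := abs_nonneg (Y k l)
  have h4 : |(H : Mat m) i k| * |Y k l| ≤ |Y k l| := by nlinarith
  calc _ ≤ |(H : Mat m) i k| * |Y k l| * 1 :=
        mul_le_mul_of_nonneg_left h2 (by positivity)
    _ ≤ _ := by simpa using h4

theorem abs_integral_orth_le {m : ℕ} {f : Orth m → ℝ} {C : ℝ} (h : ∀ H, |f H| ≤ C) :
    |∫ H, f H ∂(orthHaar m)| ≤ C := by
  have := norm_integral_le_of_norm_le_const (μ := orthHaar m) (f := f) (C := C)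
    (Filter.Eventually.of_forall h)
  simpa using this

theorem abs_spherical_le {m : ℕ} {κ : Fin m → ℕ} (hκ : Antitone κ) (Y : Mat m) :
    |spherical κ Y| ≤ ((Nat.factorial m : ℝ) * ∑ k, ∑ l, |Y k l|) ^ weight κ :=
  abs_integral_orth_le fun H => abs_powerFn_le hκ (abs_conj_le H Y) (by positivity)

/-! ### Positive matrices -/

theorem leadingMinor_nonneg {m : ℕ} {Y : Mat m} (hY : Y.PosSemidef) (j : Fin m) :
    0 ≤ leadingMinor Y j := (hY.submatrix _).det_nonneg

theorem powerFn_nonneg {m : ℕ} (κ : Fin m → ℕ) {Y : Mat m} (hY : Y.PosSemidef) :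
    0 ≤ powerFn κ Y :=
  Finset.prod_nonneg fun j _ => pow_nonneg (leadingMinor_nonneg hY j) _

theorem posSemidef_conj {m : ℕ} {Y : Mat m} (hY : Y.PosSemidef) (A : Mat m) :
    (A * Y * Aᵀ).PosSemidef := hY.mul_mul_conjTranspose_same A

theorem posDef_conj {m : ℕ} {Y : Mat m} (hY : Y.PosDef) {A : Mat m} (hA : IsUnit A.det) :
    (A * Y * Aᵀ).PosDef :=
  (Matrix.IsUnit.posDef_star_right_conjugate_iff
    ((Matrix.isUnit_iff_isUnit_det A).mpr hA)).mpr hY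

theorem posDef_conj_iff {m : ℕ} {Y : Mat m} {A : Mat m} (hA : IsUnit A.det) :
    (A * Y * Aᵀ).PosDef ↔ Y.PosDef :=
  (Matrix.IsUnit.posDef_star_right_conjugate_iff
    ((Matrix.isUnit_iff_isUnit_det A).mpr hA))

theorem Orth.isUnit_det {m : ℕ} (H : Orth m) : IsUnit (H : Mat m).det := by
  have h := congrArg det H.mul_transpose
  rw [det_mul, det_one] at h
  exact IsUnit.of_mul_eq_one _ h

theorem spherical_nonneg {m : ℕ} (κ : Fin m → ℕ) {Y : Mat m} (hY : Y.PosSemidef) :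
    0 ≤ spherical κ Y :=
  integral_nonneg fun _ => powerFn_nonneg κ (posSemidef_conj hY _)

/-- The quadratic form is nonnegative at e_i ± e_j, which bounds |Y i j| by the mean of two diagonal
entries. -/
theorem abs_apply_le_trace {m : ℕ} {Y : Mat m} (hY : Y.PosSemidef) (i j : Fin m) :
    |Y i j| ≤ Y.trace := by
  have hd : ∀ i, 0 ≤ Y i i := fun i => hY.diag_nonneg
  have hs : ∀ i j, Y i j = Y j i := fun i j => by
    have := hY.1.apply j i
    simpa using this
  have h2 : |Y i j| * 2 ≤ Y i i + Y j j := by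
    have hq : ∀ c : ℝ, 0 ≤ Y i i + 2 * c * Y i j + c ^ 2 * Y j j := by
      intro c
      have := hY.dotProduct_mulVec_nonneg (Pi.single i 1 + c • Pi.single j 1)
      simp [mulVec_add, mulVec_smul, add_dotProduct, dotProduct_add] at this
      rw [hs j i] at this
      nlinarith
    have h1 := hq 1
    have h3 := hq (-1)
    rcases abs_cases (Y i j) with ⟨h, _⟩ | ⟨h, _⟩ <;> rw [h] <;> linarith
  have h4 : ∀ i, Y i i ≤ Y.trace := fun i =>
    Finset.single_le_sum (f := fun i => Y i i) (fun i _ => hd i) (Finset.mem_univ i)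
  have := h4 i
  have := h4 j
  linarith

theorem trace_conj_orth {m : ℕ} (H : Orth m) (Y : Mat m) :
    ((H : Mat m) * Y * (H : Mat m)ᵀ).trace = Y.trace := by
  rw [trace_mul_comm, ← Matrix.mul_assoc, H.transpose_mul, Matrix.one_mul]

theorem powerFn_conj_le {m : ℕ} {κ : Fin m → ℕ} (hκ : Antitone κ) {Y : Mat m}
    (hY : Y.PosSemidef) (H : Orth m) :
    |powerFn κ ((H : Mat m) * Y * (H : Mat m)ᵀ)| ≤
      ((Nat.factorial m : ℝ) * Y.trace) ^ weight κ := by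
  have h := posSemidef_conj hY (H : Mat m)
  refine abs_powerFn_le hκ (fun i j => ?_) hY.trace_nonneg
  rw [← trace_conj_orth H Y]
  exact abs_apply_le_trace h i j

theorem spherical_le {m : ℕ} {κ : Fin m → ℕ} (hκ : Antitone κ) {Y : Mat m}
    (hY : Y.PosSemidef) : spherical κ Y ≤ ((Nat.factorial m : ℝ) * Y.trace) ^ weight κ :=
  (le_abs_self _).trans (abs_integral_orth_le fun H => powerFn_conj_le hκ hY H)

/-! ### Spectral decomposition -/

theorem exists_orth_diagonal {m : ℕ} {Y : Mat m} (hY : Y.IsSymm) :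
    ∃ (H : Orth m) (y : Fin m → ℝ), Y = (H : Mat m) * diagonal y * (H : Mat m)ᵀ := by
  have hh : Y.IsHermitian := by
    rw [IsHermitian, conjTranspose_eq_transpose_of_trivial]; exact hY
  refine ⟨hh.eigenvectorUnitary, hh.eigenvalues, ?_⟩
  have := hh.spectral_theorem
  rw [Unitary.conjStarAlgAut_apply] at this
  exact this

theorem IsSymm.conj {m : ℕ} {Y : Mat m} (hY : Y.IsSymm) (A : Mat m) : (A * Y * Aᵀ).IsSymm := by
  rw [IsSymm, transpose_mul, transpose_mul, transpose_transpose, hY.eq, Matrix.mul_assoc]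

theorem PosDef.isSymm {m : ℕ} {Y : Mat m} (hY : Y.PosDef) : Y.IsSymm := by
  have := hY.1
  rwa [IsHermitian, conjTranspose_eq_transpose_of_trivial] at this

theorem exists_orth_diagonal_pos {m : ℕ} {Y : Mat m} (hY : Y.PosDef) :
    ∃ (H : Orth m) (y : Fin m → ℝ), (∀ i, 0 < y i) ∧
      Y = (H : Mat m) * diagonal y * (H : Mat m)ᵀ := by
  obtain ⟨H, y, h⟩ := exists_orth_diagonal (PosDef.isSymm hY)
  refine ⟨H, y, ?_, h⟩
  rw [h, posDef_conj_iff H.isUnit_det, posDef_diagonal_iff] at hY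
  exact hY

theorem exists_mul_transpose {m : ℕ} {Y : Mat m} (hY : Y.PosDef) :
    ∃ A : Mat m, IsUnit A.det ∧ Y = A * Aᵀ := by
  obtain ⟨H, y, hy, h⟩ := exists_orth_diagonal_pos hY
  refine ⟨(H : Mat m) * diagonal fun i => Real.sqrt (y i), ?_, ?_⟩
  · rw [det_mul, det_diagonal]
    refine H.isUnit_det.mul (isUnit_iff_ne_zero.mpr (Finset.prod_ne_zero_iff.mpr fun i _ => ?_))
    exact (Real.sqrt_pos.mpr (hy i)).ne'
  · rw [h, transpose_mul, diagonal_transpose, Matrix.mul_assoc, Matrix.mul_assoc,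
      ← Matrix.mul_assoc (diagonal _) (diagonal _), diagonal_mul_diagonal]
    simp_rw [Real.mul_self_sqrt (hy _).le]

/-! ### Permutations, inversion and shifts of the exponents -/

/-- The permutation matrix of `σ` as an orthogonal matrix. -/
noncomputable def permOrth {m : ℕ} (σ : Equiv.Perm (Fin m)) : Orth m :=
  ⟨(1 : Mat m).submatrix σ id, by
    rw [mem_orthogonalGroup_iff, transpose_submatrix, transpose_one,
      ← submatrix_mul _ _ _ _ _ Function.bijective_id, Matrix.one_mul, submatrix_one_equiv]⟩

theorem permOrth_conj {m : ℕ} (σ : Equiv.Perm (Fin m)) (A : Mat m) :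
    (permOrth σ : Mat m) * A * (permOrth σ : Mat m)ᵀ = A.submatrix σ σ := by
  change (1 : Mat m).submatrix σ id * A * ((1 : Mat m).submatrix σ id)ᵀ = _
  rw [transpose_submatrix, transpose_one]
  ext i j
  simp [mul_apply, one_apply]

theorem spherical_diagonal_perm {m : ℕ} (κ : Fin m → ℕ) (σ : Equiv.Perm (Fin m))
    (y : Fin m → ℝ) : spherical κ (diagonal (y ∘ σ)) = spherical κ (diagonal y) := by
  rw [← spherical_orth_left κ (permOrth σ) (diagonal y), permOrth_conj,
    submatrix_diagonal_equiv]

/-- Raising every part by one preserves all differences except the last, because the continuation by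
zero is not raised. -/
theorem part_add_one {m : ℕ} (κ : Fin (m + 1) → ℕ) (j : Fin (m + 1)) :
    κ j + 1 - part (fun i => κ i + 1) (j + 1) =
      κ j - part κ (j + 1) + if j = Fin.last m then 1 else 0 := by
  unfold part
  by_cases h : j = Fin.last m
  · subst h; simp
  · have : (j : ℕ) + 1 < m + 1 := by
      have := j.isLt
      have h' : (j : ℕ) ≠ m := fun h'' => h (Fin.ext h'')
      omega
    simp only [this, dif_pos, if_neg h]
    omega

theorem leadingMinor_last {m : ℕ} (Y : Mat (m + 1)) : leadingMinor Y (Fin.last m) = Y.det := rfl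

theorem powerFn_add_one {m : ℕ} (κ : Fin (m + 1) → ℕ) (Y : Mat (m + 1)) :
    powerFn (fun i => κ i + 1) Y = Y.det * powerFn κ Y := by
  unfold powerFn
  simp_rw [part_add_one, pow_add, Finset.prod_mul_distrib, pow_ite, pow_one, pow_zero,
    Finset.prod_ite_eq' Finset.univ (Fin.last m), Finset.mem_univ, if_true, leadingMinor_last]
  ring

theorem det_conj_orth {m : ℕ} (H : Orth m) (Y : Mat m) :
    ((H : Mat m) * Y * (H : Mat m)ᵀ).det = Y.det := by
  rw [det_mul_comm, ← Matrix.mul_assoc, H.transpose_mul, Matrix.one_mul]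

theorem spherical_add_one {m : ℕ} (κ : Fin (m + 1) → ℕ) (Y : Mat (m + 1)) :
    spherical (fun i => κ i + 1) Y = Y.det * spherical κ Y := by
  unfold spherical
  simp_rw [powerFn_add_one, det_conj_orth]
  rw [integral_const_mul]

/-- The complement of `κ` in the rectangle with `m` rows of length `N`. -/
def complement {m : ℕ} (N : ℕ) (κ : Fin m → ℕ) : Fin m → ℕ := fun i => N - κ i.rev

theorem complement_antitone {m : ℕ} (N : ℕ) {κ : Fin m → ℕ} (hκ : Antitone κ) :
    Antitone (complement N κ) := by
  intro i j hij
  unfold complement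
  have := hκ (Fin.rev_le_rev.mpr hij)
  omega

/-- For Y = L Lᵀ both sides are monomials in the squared diagonal entries of L. Reversing the
coordinates makes the upper triangular matrix (L⁻¹)ᵀ lower triangular, with the inverse diagonal
entries in reverse order, and the power of the determinant changes the exponents -κ into N - κ. -/
theorem powerFn_complement {m : ℕ} {N : ℕ} {κ : Fin m → ℕ} (hκ : Antitone κ) (hN : ∀ i, κ i ≤ N)
    {Y : Mat m} (hY : Y.PosDef) :
    powerFn (complement N κ) Y = Y.det ^ N *
      powerFn κ (((permOrth Fin.revPerm : Orth m) : Mat m) * Y⁻¹ * ((permOrth Fin.revPerm : Orth m) : Mat m)ᵀ) := by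
  obtain ⟨A, hA, rfl⟩ := exists_mul_transpose hY
  obtain ⟨L, O, hL, rfl⟩ := exists_lower_mul_orth A hA
  have h1 : (L * (O : Mat m)) * (L * (O : Mat m))ᵀ = L * Lᵀ := by
    rw [transpose_mul, Matrix.mul_assoc, ← Matrix.mul_assoc (O : Mat m), Orth.mul_transpose,
      Matrix.one_mul]
  rw [h1]
  have hLu : IsUnit L.det := by
    rw [det_mul] at hA
    exact isUnit_of_mul_isUnit_left hA
  let _ := L.invertibleOfIsUnitDet hLu
  have hb : BlockTriangular L OrderDual.toDual := fun i j hij => hL i j hij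
  have hI : ∀ i j, i < j → L⁻¹ i j = 0 := fun i j hij =>
    blockTriangular_inv_of_blockTriangular hb hij
  have hdiag : ∀ i, L⁻¹ i i * L i i = 1 := by
    intro i
    have h2 : (L⁻¹ * L) i i = 1 := by rw [nonsing_inv_mul _ hLu]; simp
    rw [mul_apply, Finset.sum_eq_single i] at h2
    · exact h2
    · intro j _ hj
      rcases lt_or_gt_of_ne hj with h | h
      · rw [hL j i h, mul_zero]
      · rw [hI i j h, zero_mul]
    · simp
  rw [permOrth_conj, Matrix.mul_inv_rev]
  have h3 : ((Lᵀ)⁻¹ * L⁻¹).submatrix (Fin.revPerm : Equiv.Perm (Fin m)) Fin.revPerm =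
      ((L⁻¹)ᵀ.submatrix Fin.rev Fin.rev) * ((L⁻¹)ᵀ.submatrix Fin.rev Fin.rev)ᵀ := by
    rw [transpose_nonsing_inv]
    ext i j
    simp only [submatrix_apply, mul_apply, transpose_apply, ← transpose_nonsing_inv]
    exact (Equiv.sum_comp (Fin.revPerm : Equiv.Perm (Fin m))
      (fun k => L⁻¹ k (Fin.rev i) * L⁻¹ k (Fin.rev j))).symm
  rw [h3, powerFn_mul_transpose hκ, powerFn_mul_transpose (complement_antitone N hκ) hL, det_mul,
    det_transpose, det_of_isLowerTriangular _ hb, ← Finset.prod_mul_distrib, ← Finset.prod_pow]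
  · rw [← Equiv.prod_comp (Fin.revPerm : Equiv.Perm (Fin m))
      (fun i => (((L⁻¹)ᵀ.submatrix Fin.rev Fin.rev) i i ^ 2) ^ κ i), ← Finset.prod_mul_distrib]
    refine Finset.prod_congr rfl fun i _ => ?_
    simp only [submatrix_apply, transpose_apply, Fin.revPerm_apply, Fin.rev_rev, complement]
    have h4 := hdiag i
    have hk : L i i ^ 2 = L i i * L i i := sq _
    rw [← hk]
    conv_rhs => rw [← Nat.sub_add_cancel (hN i.rev), pow_add]
    rw [mul_assoc, ← mul_pow, ← mul_pow, mul_comm (L i i), h4]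
    simp
  · intro i j hij
    exact hI _ _ (Fin.rev_lt_rev.mpr hij)

theorem spherical_complement {m : ℕ} {N : ℕ} {κ : Fin m → ℕ} (hκ : Antitone κ)
    (hN : ∀ i, κ i ≤ N) {Y : Mat m} (hY : Y.PosDef) :
    spherical (complement N κ) Y = Y.det ^ N * spherical κ Y⁻¹ := by
  have h : ∀ H : Orth m, powerFn (complement N κ) ((H : Mat m) * Y * (H : Mat m)ᵀ) =
      Y.det ^ N * powerFn κ (((permOrth Fin.revPerm * H : Orth m) : Mat m) * Y⁻¹ *
        ((permOrth Fin.revPerm * H : Orth m) : Mat m)ᵀ) := by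
    intro H
    rw [powerFn_complement hκ hN (posDef_conj hY H.isUnit_det), det_conj_orth]
    congr 2
    have hH : (H : Mat m)⁻¹ = (H : Mat m)ᵀ := Matrix.inv_eq_right_inv H.mul_transpose
    have hH' : ((H : Mat m)ᵀ)⁻¹ = (H : Mat m) := Matrix.inv_eq_right_inv H.transpose_mul
    rw [Matrix.mul_inv_rev, Matrix.mul_inv_rev, hH, hH']
    simp [transpose_mul, Matrix.mul_assoc]
  unfold spherical
  simp_rw [h]
  rw [integral_const_mul, integral_mul_left_eq_self (μ := orthHaar m)
    (fun H : Orth m => powerFn κ ((H : Mat m) * Y⁻¹ * (H : Mat m)ᵀ))]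

/-! ### The Jacobian of a congruence on the symmetric matrices -/

theorem symOfCoords_apply {m : ℕ} (x : UpperIdx m → ℝ) (p : UpperIdx m) :
    symOfCoords x p.1.1 p.1.2 = x p := by
  simp [symOfCoords, p.2]

theorem symOfCoords_isSymm {m : ℕ} (x : UpperIdx m → ℝ) : (symOfCoords x).IsSymm := by
  ext i j
  simp only [transpose_apply, symOfCoords, of_apply]
  by_cases h : i ≤ j
  · by_cases h' : j ≤ i
    · obtain rfl := le_antisymm h h'
      rfl
    · simp [h, h']
  · have h' : j ≤ i := le_of_not_ge h
    simp [h, h']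

/-- The coordinates of a symmetric matrix. -/
def coordsOfSym {m : ℕ} (S : Mat m) : UpperIdx m → ℝ := fun p => S p.1.1 p.1.2

theorem symOfCoords_coordsOfSym {m : ℕ} {S : Mat m} (hS : S.IsSymm) :
    symOfCoords (coordsOfSym S) = S := by
  ext i j
  simp only [symOfCoords, coordsOfSym, of_apply]
  split_ifs with h
  · rfl
  · exact hS.apply i j

theorem coordsOfSym_symOfCoords {m : ℕ} (x : UpperIdx m → ℝ) :
    coordsOfSym (symOfCoords x) = x := by
  ext p
  exact symOfCoords_apply x p

theorem continuous_symOfCoords (m : ℕ) :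
    Continuous (symOfCoords : (UpperIdx m → ℝ) → Mat m) := by
  refine continuous_matrix fun i j => ?_
  simp only [symOfCoords, of_apply]
  split_ifs <;> fun_prop

theorem measurable_symOfCoords (m : ℕ) :
    Measurable (symOfCoords : (UpperIdx m → ℝ) → Mat m) := (continuous_symOfCoords m).measurable

theorem symOfCoords_add {m : ℕ} (x y : UpperIdx m → ℝ) :
    symOfCoords (x + y) = symOfCoords x + symOfCoords y := by
  ext i j
  simp only [symOfCoords, of_apply, Matrix.add_apply, Pi.add_apply]
  split_ifs <;> rfl

theorem symOfCoords_smul {m : ℕ} (c : ℝ) (x : UpperIdx m → ℝ) :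
    symOfCoords (c • x) = c • symOfCoords x := by
  ext i j
  simp only [symOfCoords, of_apply, Matrix.smul_apply, Pi.smul_apply]
  split_ifs <;> rfl

/-- The congruence `S ↦ A S Aᵀ` in coordinates. -/
def congrCoords {m : ℕ} (A : Mat m) : (UpperIdx m → ℝ) →ₗ[ℝ] (UpperIdx m → ℝ) where
  toFun x := coordsOfSym (A * symOfCoords x * Aᵀ)
  map_add' x y := by
    ext p
    simp [coordsOfSym, symOfCoords_add, Matrix.mul_add, Matrix.add_mul]
  map_smul' c x := by
    ext p
    simp [coordsOfSym, symOfCoords_smul]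

theorem congrCoords_apply {m : ℕ} (A : Mat m) (x : UpperIdx m → ℝ) :
    congrCoords A x = coordsOfSym (A * symOfCoords x * Aᵀ) := rfl

theorem symOfCoords_congrCoords {m : ℕ} (A : Mat m) (x : UpperIdx m → ℝ) :
    symOfCoords (congrCoords A x) = A * symOfCoords x * Aᵀ :=
  symOfCoords_coordsOfSym (IsSymm.conj (symOfCoords_isSymm x) A)

theorem congrCoords_mul {m : ℕ} (A B : Mat m) :
    congrCoords (A * B) = congrCoords A ∘ₗ congrCoords B := by
  refine LinearMap.ext fun x => ?_
  rw [LinearMap.comp_apply, congrCoords_apply, congrCoords_apply A, symOfCoords_congrCoords]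
  simp [transpose_mul, Matrix.mul_assoc]

theorem congrCoords_one {m : ℕ} : congrCoords (1 : Mat m) = LinearMap.id := by
  refine LinearMap.ext fun x => ?_
  simp [congrCoords_apply, coordsOfSym_symOfCoords]

theorem det_congrCoords_mul {m : ℕ} (A B : Mat m) :
    LinearMap.det (congrCoords (A * B)) =
      LinearMap.det (congrCoords A) * LinearMap.det (congrCoords B) := by
  rw [congrCoords_mul, LinearMap.det_comp]

/-- The index i occurs as a row with columns j ≥ i and as a column with rows j ≤ i: altogether m + 1
times, the diagonal position counting twice. -/
theorem prod_upperIdx {m : ℕ} (d : Fin m → ℝ) :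
    ∏ p : UpperIdx m, d p.1.1 * d p.1.2 = (∏ i, d i) ^ (m + 1) := by
  have h1 : ∏ p : UpperIdx m, d p.1.1 * d p.1.2 =
      ∏ p : Fin m × Fin m, if p.1 ≤ p.2 then d p.1 * d p.2 else 1 := by
    rw [← Finset.prod_filter]
    exact (Finset.prod_subtype (Finset.univ.filter fun p : Fin m × Fin m => p.1 ≤ p.2)
      (by simp) (fun p => d p.1 * d p.2)).symm
  have h2 : ∏ p : Fin m × Fin m, (if p.1 ≤ p.2 then d p.1 * d p.2 else 1) =
      (∏ p : Fin m × Fin m, if p.1 ≤ p.2 then d p.1 else 1) *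
        ∏ p : Fin m × Fin m, if p.2 ≤ p.1 then d p.1 else 1 := by
    rw [← (Equiv.prodComm (Fin m) (Fin m)).prod_comp
      (fun p => if p.2 ≤ p.1 then d p.1 else 1), ← Finset.prod_mul_distrib]
    refine Finset.prod_congr rfl fun p _ => ?_
    simp only [Equiv.prodComm_apply, Prod.fst_swap, Prod.snd_swap]
    by_cases h : p.1 ≤ p.2 <;> simp [h]
  rw [h1, h2, ← Finset.prod_mul_distrib, Fintype.prod_prod_type]
  have h3 : ∀ i j : Fin m, ((if i ≤ j then d i else 1) * if j ≤ i then d i else 1) =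
      d i * if i = j then d i else 1 := by
    intro i j
    rcases lt_trichotomy i j with h | h | h
    · simp [h.le, h.not_ge, h.ne]
    · simp [h]
    · simp [h.le, h.not_ge, h.ne']
  simp_rw [h3, Finset.prod_mul_distrib, Finset.prod_ite_eq, Finset.mem_univ, if_true,
    Finset.prod_const, Finset.card_univ, Fintype.card_fin]
  rw [Finset.prod_pow, pow_succ]

theorem det_congrCoords_diagonal {m : ℕ} (d : Fin m → ℝ) :
    LinearMap.det (congrCoords (diagonal d)) = (∏ i, d i) ^ (m + 1) := by
  rw [← prod_upperIdx, ← LinearMap.det_toMatrix', ← det_diagonal]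
  congr 1
  ext p q
  rw [LinearMap.toMatrix'_apply]
  rw [congrCoords_apply]
  simp only [coordsOfSym, diagonal_transpose, mul_diagonal, diagonal_mul]
  rw [symOfCoords_apply, diagonal_apply, Pi.single_apply]
  split_ifs <;> ring

/-- Let D double the i-th coordinate. Conjugation by D doubles the parameter of the transvection, so
D τ = τ² D. Hence the determinant x of the congruence by τ satisfies x = x², and x ≠ 0 because τ has
an inverse. -/
theorem abs_det_congrCoords_transvection {m : ℕ} (t : TransvectionStruct (Fin m) ℝ) :
    |LinearMap.det (congrCoords t.toMatrix)| = |t.toMatrix.det| ^ (m + 1) := by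
  obtain ⟨i, j, hij, c⟩ := t
  have htd : (TransvectionStruct.mk i j hij c).toMatrix.det = 1 := det_transvection_of_ne i j hij c
  rw [htd]
  simp only [TransvectionStruct.toMatrix_mk, abs_one, one_pow]
  set d : Fin m → ℝ := fun k => if k = i then 2 else 1
  have hd : ∏ k, d k = 2 := by simp [d]
  have h1 : diagonal d * transvection i j c = transvection i j c * transvection i j c *
      diagonal d := by
    rw [transvection_mul_transvection_same i j hij]
    ext a b
    simp only [diagonal_mul, mul_diagonal, transvection, Matrix.add_apply, one_apply, single_apply, d]
    by_cases h1 : a = i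
    · by_cases h2 : b = j
      · subst h1 h2; simp [hij, hij.symm]; ring
      · by_cases h3 : a = b
        · subst h1; subst h3; simp [hij.symm]
        · simp [h3, Ne.symm h2]
    · by_cases h3 : a = b
      · subst h3; simp [h1, Ne.symm h1]
      · simp [h1, Ne.symm h1, h3]
  have h2 := congrArg (fun M => LinearMap.det (congrCoords M)) h1
  simp only [det_congrCoords_mul, det_congrCoords_diagonal, hd] at h2
  have h3 : LinearMap.det (congrCoords (transvection i j c)) ≠ 0 := by
    intro h0
    have h4 : transvection i j c * transvection i j (-c) = 1 := by
      rw [transvection_mul_transvection_same i j hij]; simp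
    have h5 := congrArg (fun M => LinearMap.det (congrCoords M)) h4
    simp [det_congrCoords_mul, h0, congrCoords_one] at h5
  set x := LinearMap.det (congrCoords (transvection i j c))
  have h6 : (2 : ℝ) ^ (m + 1) ≠ 0 := by positivity
  have h7 : x = 1 := by
    have : x * 2 ^ (m + 1) * (x - 1) = 0 := by linear_combination -h2
    rcases mul_eq_zero.mp this with h | h
    · exact absurd h (mul_ne_zero h3 h6)
    · linarith
  rw [h7, abs_one]

theorem abs_det_congrCoords {m : ℕ} (A : Mat m) (hA : IsUnit A.det) :
    |LinearMap.det (congrCoords A)| = |A.det| ^ (m + 1) := by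
  refine diagonal_transvection_induction_of_det_ne_zero
    (fun A => |LinearMap.det (congrCoords A)| = |A.det| ^ (m + 1)) A hA.ne_zero ?_ ?_ ?_
  · intro D _
    rw [det_congrCoords_diagonal, det_diagonal, abs_pow]
  · exact abs_det_congrCoords_transvection
  · intro A B _ _ h1 h2
    rw [det_congrCoords_mul, abs_mul, h1, h2, det_mul, abs_mul, mul_pow]

/-- The congruence `S ↦ A S Aᵀ` as a measurable equivalence. -/
noncomputable def congrEquiv {m : ℕ} (A : Mat m) (hA : IsUnit A.det) : Mat m ≃ᵐ Mat m where
  toFun S := A * S * Aᵀ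
  invFun S := A⁻¹ * S * (A⁻¹)ᵀ
  left_inv S := by
    have h : A⁻¹ * (A * S * Aᵀ) * (A⁻¹)ᵀ = (A⁻¹ * A) * S * (A⁻¹ * A)ᵀ := by
      simp only [transpose_mul, Matrix.mul_assoc]
    simp only [h, nonsing_inv_mul _ hA]; simp
  right_inv S := by
    have h : A * (A⁻¹ * S * (A⁻¹)ᵀ) * Aᵀ = (A * A⁻¹) * S * (A * A⁻¹)ᵀ := by
      simp only [transpose_mul, Matrix.mul_assoc]
    simp only [h, mul_nonsing_inv _ hA]; simp
  measurable_toFun := by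
    have : Continuous fun S : Mat m => A * S * Aᵀ := by fun_prop
    exact this.measurable
  measurable_invFun := by
    have : Continuous fun S : Mat m => A⁻¹ * S * (A⁻¹)ᵀ := by fun_prop
    exact this.measurable

theorem map_congr_symLebesgue {m : ℕ} (A : Mat m) (hA : IsUnit A.det) :
    symLebesgue m = ENNReal.ofReal (|A.det| ^ (m + 1)) •
      Measure.map (congrEquiv A hA) (symLebesgue m) := by
  have h0 : LinearMap.det (congrCoords A) ≠ 0 := by
    have h := abs_det_congrCoords A hA
    intro h1
    rw [h1, abs_zero] at h
    have : |A.det| ≠ 0 := abs_ne_zero.mpr hA.ne_zero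
    exact pow_ne_zero _ this h.symm
  have h1 := Real.map_linearMap_volume_pi_eq_smul_volume_pi h0
  have hm : Measurable (congrCoords A) :=
    (LinearMap.continuous_of_finiteDimensional _).measurable
  have h2 : Measure.map (congrEquiv A hA) (symLebesgue m) =
      Measure.map symOfCoords (Measure.map (congrCoords A) volume) := by
    rw [symLebesgue, Measure.map_map (congrEquiv A hA).measurable (measurable_symOfCoords m),
      Measure.map_map (measurable_symOfCoords m) hm]
    congr 1
    ext1 x
    exact (symOfCoords_congrCoords A x).symm
  rw [h2, h1, Measure.map_smul, smul_smul, ← abs_det_congrCoords A hA,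
    ← ENNReal.ofReal_mul (abs_nonneg _), abs_inv, mul_inv_cancel₀ (abs_ne_zero.mpr h0),
    ENNReal.ofReal_one, one_smul]
  rfl

theorem measurableSet_posDefCone (m : ℕ) : MeasurableSet (posDefCone m) := by
  have h1 : IsClosed {R : Mat m | R.PosSemidef} := by
    have : {R : Mat m | R.PosSemidef} = {R : Mat m | Rᵀ = R} ∩
        ⋂ x : Fin m → ℝ, {R : Mat m | 0 ≤ x ⬝ᵥ (R *ᵥ x)} := by
      ext R
      simp [posSemidef_iff_dotProduct_mulVec, IsHermitian, conjTranspose_eq_transpose_of_trivial]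
    rw [this]
    refine (isClosed_eq (by fun_prop) (by fun_prop)).inter (isClosed_iInter fun x => ?_)
    exact isClosed_le continuous_const (by fun_prop)
  have h2 : posDefCone m = {R : Mat m | R.PosSemidef} ∩ {R : Mat m | R.det ≠ 0} := by
    ext R
    constructor
    · intro h
      have h : R.PosDef := h
      exact ⟨h.posSemidef, h.det_pos.ne'⟩
    · rintro ⟨h, h'⟩
      exact h.posDef_iff_det_ne_zero.mpr h'
  rw [h2]
  refine h1.measurableSet.inter ?_
  have hc : Continuous fun R : Mat m => R.det := by fun_prop
  exact (isOpen_compl_singleton.preimage hc).measurableSet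

theorem preimage_congrEquiv_posDefCone {m : ℕ} (A : Mat m) (hA : IsUnit A.det) :
    congrEquiv A hA ⁻¹' posDefCone m = posDefCone m := by
  ext S
  exact posDef_conj_iff hA

theorem restrict_symLebesgue_congr {m : ℕ} (A : Mat m) (hA : IsUnit A.det) :
    (symLebesgue m).restrict (posDefCone m) = ENNReal.ofReal (|A.det| ^ (m + 1)) •
      Measure.map (congrEquiv A hA) ((symLebesgue m).restrict (posDefCone m)) := by
  conv_lhs => rw [map_congr_symLebesgue A hA]
  rw [Measure.restrict_smul, (congrEquiv A hA).restrict_map, preimage_congrEquiv_posDefCone]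

/-- Change of variables `R = A S Aᵀ` on the positive definite cone. -/
theorem setIntegral_congr_posDefCone {m : ℕ} (A : Mat m) (hA : IsUnit A.det) (f : Mat m → ℝ) :
    ∫ R in posDefCone m, f R ∂(symLebesgue m) =
      |A.det| ^ (m + 1) * ∫ S in posDefCone m, f (A * S * Aᵀ) ∂(symLebesgue m) := by
  conv_lhs => rw [restrict_symLebesgue_congr A hA]
  rw [integral_smul_measure, (congrEquiv A hA).measurableEmbedding.integral_map,
    ENNReal.toReal_ofReal (by positivity)]
  rfl

theorem integrableOn_congr_posDefCone {m : ℕ} (A : Mat m) (hA : IsUnit A.det) (f : Mat m → ℝ) :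
    IntegrableOn f (posDefCone m) (symLebesgue m) ↔
      IntegrableOn (fun S => f (A * S * Aᵀ)) (posDefCone m) (symLebesgue m) := by
  have hc : ENNReal.ofReal (|A.det| ^ (m + 1)) ≠ 0 := by
    rw [Ne, ENNReal.ofReal_eq_zero, not_le]
    have : 0 < |A.det| := abs_pos.mpr hA.ne_zero
    positivity
  unfold IntegrableOn
  conv_lhs => rw [restrict_symLebesgue_congr A hA]
  rw [integrable_smul_measure hc ENNReal.ofReal_ne_top,
    (congrEquiv A hA).measurableEmbedding.integrable_map_iff]
  rfl

/-! ### Bordered matrices -/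

/-- The symmetric matrix `[[t, vᵀ], [v, S]]`. -/
def bordered {m : ℕ} (t : ℝ) (v : Fin m → ℝ) (S : Mat m) : Mat (m + 1) :=
  Matrix.of (Fin.cons (Fin.cons t v) fun i => Fin.cons (v i) (S i))

/-- The unipotent lower triangular matrix `[[1, 0], [v, 1]]`. -/
def unipotent {m : ℕ} (v : Fin m → ℝ) : Mat (m + 1) :=
  Matrix.of (Fin.cons (Fin.cons 1 0) fun i => Fin.cons (v i) ((1 : Mat m) i))

section
variable {m : ℕ} (t : ℝ) (v : Fin m → ℝ) (S : Mat m)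

@[simp] theorem bordered_zero_zero : bordered t v S 0 0 = t := rfl
@[simp] theorem bordered_zero_succ (j : Fin m) : bordered t v S 0 j.succ = v j := rfl
@[simp] theorem bordered_succ_zero (i : Fin m) : bordered t v S i.succ 0 = v i := rfl
@[simp] theorem bordered_succ_succ (i j : Fin m) : bordered t v S i.succ j.succ = S i j := rfl
@[simp] theorem unipotent_zero_zero : unipotent v 0 0 = 1 := rfl
@[simp] theorem unipotent_zero_succ (j : Fin m) : unipotent v 0 j.succ = 0 := rfl
@[simp] theorem unipotent_succ_zero (i : Fin m) : unipotent v i.succ 0 = v i := rfl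
@[simp] theorem unipotent_succ_succ (i j : Fin m) :
    unipotent v i.succ j.succ = (1 : Mat m) i j := rfl

end

theorem unipotent_lower {m : ℕ} (v : Fin m → ℝ) (i j : Fin (m + 1)) (h : i < j) :
    unipotent v i j = 0 := by
  refine Fin.cases ?_ (fun i => ?_) i (motive := fun i => i < j → unipotent v i j = 0) h
  · refine Fin.cases ?_ (fun j => ?_) j
    · intro h; exact absurd h (lt_irrefl _)
    · intro _; rfl
  · refine Fin.cases ?_ (fun j => ?_) j
    · intro h; exact absurd h (Fin.not_lt_zero _)
    · intro h
      rw [unipotent_succ_succ, one_apply_ne]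
      exact (Fin.succ_lt_succ_iff.mp h).ne

theorem unipotent_diag {m : ℕ} (v : Fin m → ℝ) (i : Fin (m + 1)) : unipotent v i i = 1 := by
  refine Fin.cases ?_ (fun i => ?_) i <;> simp

theorem det_unipotent {m : ℕ} (v : Fin m → ℝ) : (unipotent v).det = 1 := by
  rw [det_of_isLowerTriangular _ (fun i j h => unipotent_lower v i j h)]
  simp [unipotent_diag]

/-- This is the Schur complement: a unipotent congruence clears the border, and the summand v vᵀ / t
in the lower block compensates exactly, so that S remains. -/
theorem bordered_eq_conj {m : ℕ} {t : ℝ} (ht : t ≠ 0) (v : Fin m → ℝ) (S : Mat m) :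
    bordered t v (S + t⁻¹ • vecMulVec v v) =
      unipotent (t⁻¹ • v) * bordered t 0 S * (unipotent (t⁻¹ • v))ᵀ := by
  ext i j
  refine Fin.cases ?_ (fun i => ?_) i <;> refine Fin.cases ?_ (fun j => ?_) j <;>
    simp [mul_apply, Fin.sum_univ_succ, one_apply, vecMulVec_apply]
  · field_simp
  · field_simp
  · field_simp
    ring

theorem leadingMinor_bordered_zero {m : ℕ} (t : ℝ) (S : Mat m) :
    leadingMinor (bordered t 0 S) 0 = t := by
  change (submatrix (l := Fin 1) (o := Fin 1) (bordered t 0 S) _ _).det = _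
  rw [det_unique]
  rfl

theorem leadingMinor_bordered_succ {m : ℕ} (t : ℝ) (S : Mat m) (j : Fin m) :
    leadingMinor (bordered t 0 S) j.succ = t * leadingMinor S j := by
  change (submatrix (l := Fin ((j : ℕ) + 1 + 1)) (o := Fin ((j : ℕ) + 1 + 1))
    (bordered t 0 S) _ _).det = _
  rw [det_succ_row_zero, Fin.sum_univ_succ]
  rw [Finset.sum_eq_zero]
  · simp only [Fin.val_zero, pow_zero, one_mul, add_zero]
    congr 1
  · intro i _
    have : (submatrix (l := Fin ((j : ℕ) + 1 + 1)) (o := Fin ((j : ℕ) + 1 + 1))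
      (bordered t 0 S) (Fin.castLE (Nat.succ_le_of_lt j.succ.isLt))
        (Fin.castLE (Nat.succ_le_of_lt j.succ.isLt))) 0 i.succ = 0 := rfl
    rw [this]; simp

theorem det_bordered {m : ℕ} (t : ℝ) (S : Mat m) : (bordered t 0 S).det = t * S.det := by
  rw [det_succ_row_zero, Fin.sum_univ_succ, Finset.sum_eq_zero]
  · simp only [Fin.val_zero, pow_zero, one_mul, add_zero]
    congr 1
  · intro i _
    simp

theorem part_succ {m : ℕ} (κ : Fin (m + 1) → ℕ) (i : ℕ) :
    part κ (i + 1) = part (fun j => κ j.succ) i := by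
  unfold part
  by_cases h : i < m
  · rw [dif_pos h, dif_pos (by omega)]
    rfl
  · rw [dif_neg h, dif_neg (by omega)]

/-- Each leading minor of diag(t, S) is t times a minor of S, or t itself, so t collects the sum of
all exponents, which is κ 0. -/
theorem powerFn_bordered {m : ℕ} {κ : Fin (m + 1) → ℕ} (hκ : Antitone κ) (t : ℝ) (S : Mat m) :
    powerFn κ (bordered t 0 S) = t ^ κ 0 * powerFn (fun j => κ j.succ) S := by
  unfold powerFn
  rw [Fin.prod_univ_succ]
  simp_rw [leadingMinor_bordered_zero, leadingMinor_bordered_succ, mul_pow,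
    Finset.prod_mul_distrib]
  rw [Finset.prod_pow_eq_pow_sum, ← mul_assoc, ← pow_add]
  congr 1
  · congr 1
    have h := sum_part_sub hκ 0
    rw [Fin.sum_univ_succ] at h
    simpa using h
  · refine Finset.prod_congr rfl fun j _ => ?_
    rw [Fin.val_succ, part_succ κ]

theorem posDef_bordered_zero {m : ℕ} (t : ℝ) (S : Mat m) :
    (bordered t 0 S).PosDef ↔ 0 < t ∧ S.PosDef := by
  constructor
  · intro h
    refine ⟨?_, ?_⟩
    · have := h.diag_pos (i := 0)
      simpa using this
    · exact h.submatrix (e := Fin.succ) (Fin.succ_injective _)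
  · rintro ⟨ht, hS⟩
    refine PosDef.of_dotProduct_mulVec_pos ?_ ?_
    · have hs := hS.1
      ext i j
      refine Fin.cases ?_ (fun i => ?_) i <;> refine Fin.cases ?_ (fun j => ?_) j <;>
        simp
      simpa using hs.apply i j
    · intro x hx
      have hsum : star x ⬝ᵥ (bordered t 0 S *ᵥ x) =
          t * x 0 ^ 2 + (fun i => x i.succ) ⬝ᵥ (S *ᵥ fun i => x i.succ) := by
        simp [dotProduct, mulVec, Fin.sum_univ_succ]
        ring
      rw [hsum]
      by_cases h0 : (fun i => x (Fin.succ i)) = 0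
      · have hx0 : x 0 ≠ 0 := by
          intro h
          apply hx
          ext i
          refine Fin.cases h (fun i => ?_) i
          exact congrFun h0 i
        rw [h0]
        simp only [zero_dotProduct, add_zero]
        positivity
      · have := hS.dotProduct_mulVec_pos h0
        simp only [star_trivial] at this
        have h2 : 0 ≤ t * x 0 ^ 2 := by positivity
        linarith

/-! ### Integration over bordered matrices -/

/-- The positions of the first row and of the remaining rows. -/
def upperIdxEquiv (m : ℕ) : Fin (m + 1) ⊕ UpperIdx m ≃ UpperIdx (m + 1) where
  toFun := Sum.elim (fun j => ⟨(0, j), Fin.zero_le j⟩)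
    fun p => ⟨(p.1.1.succ, p.1.2.succ), Fin.succ_le_succ_iff.mpr p.2⟩
  invFun p := if h : p.1.1 = 0 then Sum.inl p.1.2 else
    Sum.inr ⟨(p.1.1.pred h, p.1.2.pred fun h' => h (by
      have := p.2; rw [h'] at this; exact Fin.le_zero_iff.mp this)), by
      have := p.2; simpa using this⟩
  left_inv x := by
    rcases x with j | p
    · simp
    · simp [Fin.succ_ne_zero]
  right_inv p := by
    obtain ⟨⟨i, j⟩, hij⟩ := p
    by_cases h : i = 0
    · subst h; simp
    · simp [h]

theorem symOfCoords_upperIdxEquiv {m : ℕ} (x : UpperIdx (m + 1) → ℝ) :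
    symOfCoords x = bordered (x (upperIdxEquiv m (Sum.inl 0)))
      (fun j => x (upperIdxEquiv m (Sum.inl j.succ)))
      (symOfCoords fun p => x (upperIdxEquiv m (Sum.inr p))) := by
  ext i j
  refine Fin.cases ?_ (fun i => ?_) i <;> refine Fin.cases ?_ (fun j => ?_) j
  · simp [symOfCoords, upperIdxEquiv]
  · simp [symOfCoords, upperIdxEquiv]
  · simp [symOfCoords, upperIdxEquiv]
  · simp [symOfCoords, upperIdxEquiv]

theorem continuous_bordered {m : ℕ} :
    Continuous fun p : ℝ × (Fin m → ℝ) × Mat m => bordered p.1 p.2.1 p.2.2 := by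
  refine continuous_matrix fun i j => ?_
  refine Fin.cases ?_ (fun i => ?_) i <;> refine Fin.cases ?_ (fun j => ?_) j
  · exact continuous_fst
  · change Continuous fun p : ℝ × (Fin m → ℝ) × Mat m => p.2.1 j
    fun_prop
  · change Continuous fun p : ℝ × (Fin m → ℝ) × Mat m => p.2.1 i
    fun_prop
  · change Continuous fun p : ℝ × (Fin m → ℝ) × Mat m => p.2.2 i j
    fun_prop

theorem lintegral_symOfCoords_succ {m : ℕ} {g : Mat (m + 1) → ENNReal} (hg : Measurable g) :
    ∫⁻ x, g (symOfCoords x) = ∫⁻ t : ℝ, ∫⁻ v : Fin m → ℝ, ∫⁻ z : UpperIdx m → ℝ,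
      g (bordered t v (symOfCoords z)) := by
  have h1 := volume_measurePreserving_piCongrLeft (fun _ => ℝ) (upperIdxEquiv m)
  have h2 := volume_measurePreserving_sumPiEquivProdPi_symm
    (fun _ : Fin (m + 1) ⊕ UpperIdx m => ℝ)
  have h3 := h1.comp h2
  have hgs : Measurable fun x => g (symOfCoords x) := hg.comp (measurable_symOfCoords _)
  rw [← h3.lintegral_comp hgs]
  have h4 : ∀ y : (Fin (m + 1) → ℝ) × (UpperIdx m → ℝ),
      symOfCoords ((MeasurableEquiv.piCongrLeft (fun _ => ℝ) (upperIdxEquiv m) ∘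
        (MeasurableEquiv.sumPiEquivProdPi fun _ => ℝ).symm) y) =
      bordered (y.1 0) (fun j => y.1 j.succ) (symOfCoords y.2) := by
    intro y
    have h5 : ∀ s, (MeasurableEquiv.piCongrLeft (fun _ => ℝ) (upperIdxEquiv m) ∘
        (MeasurableEquiv.sumPiEquivProdPi fun _ => ℝ).symm) y (upperIdxEquiv m s) =
        (MeasurableEquiv.sumPiEquivProdPi fun _ => ℝ).symm y s := by
      intro s
      exact Equiv.piCongrLeft_apply_apply (fun _ => ℝ) (upperIdxEquiv m) _ s
    rw [symOfCoords_upperIdxEquiv]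
    simp only [h5]
    rfl
  simp_rw [h4]
  have hm4 : Measurable fun y : (Fin (m + 1) → ℝ) × (UpperIdx m → ℝ) =>
      g (bordered (y.1 0) (fun j => y.1 j.succ) (symOfCoords y.2)) := by
    have hc := continuous_symOfCoords m
    have hf : Continuous fun y : (Fin (m + 1) → ℝ) × (UpperIdx m → ℝ) =>
        ((y.1 0, (fun j : Fin m => y.1 j.succ), symOfCoords y.2) : ℝ × (Fin m → ℝ) × Mat m) := by
      fun_prop
    have : Continuous fun y : (Fin (m + 1) → ℝ) × (UpperIdx m → ℝ) =>
        bordered (y.1 0) (fun j => y.1 j.succ) (symOfCoords y.2) :=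
      continuous_bordered.comp hf
    exact hg.comp this.measurable
  rw [Measure.volume_eq_prod, lintegral_prod _ hm4.aemeasurable]
  have h6 := (volume_preserving_piFinSuccAbove (fun _ : Fin (m + 1) => ℝ) 0).symm
  rw [← h6.lintegral_comp hm4.lintegral_prod_right', Measure.volume_eq_prod, lintegral_prod]
  · rfl
  · exact (hm4.lintegral_prod_right'.comp (MeasurableEquiv.measurable _)).aemeasurable

/-! ### The multivariate gamma integral -/

/-- The closed form of `∫ powerFn κ R (det R)^{a - (m+1)/2} etr(-R) dR`. -/
noncomputable def gammaProd (m : ℕ) (a : ℝ) (κ : Fin m → ℕ) : ℝ :=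
  Real.pi ^ ((m : ℝ) * (m - 1) / 4) * ∏ j : Fin m, Real.Gamma (a - (j : ℝ) / 2 + κ j)

theorem lintegral_gaussian_pi (m : ℕ) {t : ℝ} (ht : 0 < t) :
    ∫⁻ v : Fin m → ℝ, ENNReal.ofReal (Real.exp (-(t⁻¹ * ∑ i, v i ^ 2))) =
      ENNReal.ofReal (Real.pi ^ ((m : ℝ) / 2) * t ^ ((m : ℝ) / 2)) := by
  have h1 : ∀ v : Fin m → ℝ, Real.exp (-(t⁻¹ * ∑ i, v i ^ 2)) =
      ∏ i, Real.exp (-t⁻¹ * v i ^ 2) := by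
    intro v
    rw [← Real.exp_sum, Finset.mul_sum, ← Finset.sum_neg_distrib]
    simp
  have hint : Integrable fun v : Fin m → ℝ => ∏ i, Real.exp (-t⁻¹ * v i ^ 2) :=
    Integrable.fintype_prod fun _ => integrable_exp_neg_mul_sq (inv_pos.mpr ht)
  simp_rw [h1]
  rw [← ofReal_integral_eq_lintegral_ofReal hint
    (Filter.Eventually.of_forall fun v => Finset.prod_nonneg fun i _ => (Real.exp_pos _).le)]
  congr 1
  have := integral_fintype_prod_volume_eq_pow (ι := Fin m) (fun x : ℝ => Real.exp (-t⁻¹ * x ^ 2))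
  rw [this, integral_gaussian, ← Real.mul_rpow Real.pi_pos.le ht.le, Fintype.card_fin,
    div_inv_eq_mul, Real.sqrt_eq_rpow, ← Real.rpow_natCast, ← Real.rpow_mul (by positivity)]
  congr 1
  ring

theorem lintegral_gamma {s : ℝ} (hs : 0 < s) :
    ∫⁻ t in Set.Ioi (0 : ℝ), ENNReal.ofReal (t ^ (s - 1) * Real.exp (-t)) =
      ENNReal.ofReal (Real.Gamma s) := by
  rw [Real.Gamma_eq_integral hs]
  have hint := Real.GammaIntegral_convergent hs
  simp_rw [mul_comm (Real.exp _)] at hint ⊢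
  rw [ofReal_integral_eq_lintegral_ofReal hint]
  refine (ae_restrict_iff' measurableSet_Ioi).mpr (Filter.Eventually.of_forall fun t ht => ?_)
  have : (0 : ℝ) < t := ht
  positivity

/-- The integrand of the multivariate gamma integral. -/
noncomputable def gammaIntegrand {m : ℕ} (a : ℝ) (κ : Fin m → ℕ) (R : Mat m) : ℝ :=
  powerFn κ R * (R.det ^ (a - ((m : ℝ) + 1) / 2) * etr (-R))

theorem measurable_gammaIntegrand {m : ℕ} (a : ℝ) (κ : Fin m → ℕ) :
    Measurable (gammaIntegrand a κ) := by
  unfold gammaIntegrand etr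
  refine (continuous_powerFn κ).measurable.mul (Measurable.mul ?_ ?_)
  · have : Continuous fun R : Mat m => R.det := by fun_prop
    exact this.measurable.pow_const _
  · have : Continuous fun R : Mat m => (-R).trace := by fun_prop
    exact this.measurable.exp

theorem gammaIntegrand_nonneg {m : ℕ} (a : ℝ) (κ : Fin m → ℕ) {R : Mat m} (hR : R.PosDef) :
    0 ≤ gammaIntegrand a κ R :=
  mul_nonneg (powerFn_nonneg κ hR.posSemidef)
    (mul_nonneg (Real.rpow_nonneg hR.det_pos.le _) (Real.exp_pos _).le)

/-- In Schur coordinates the integrand separates into a function of t, a Gaussian in v, and the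
integrand of order m. Passing from order m + 1 to m lowers a by one half, since a - (m+2)/2 = (a -
1/2) - (m+1)/2. -/
theorem gammaIntegrand_bordered {m : ℕ} (a : ℝ) {κ : Fin (m + 1) → ℕ} (hκ : Antitone κ)
    {t : ℝ} (ht : 0 < t) (v : Fin m → ℝ) {S : Mat m} (hS : S.PosDef) :
    gammaIntegrand a κ (bordered t v (S + t⁻¹ • vecMulVec v v)) =
      (t ^ (κ 0 + a - ((m : ℝ) + 2) / 2) * Real.exp (-t)) *
        (Real.exp (-(t⁻¹ * ∑ i, v i ^ 2)) *
          gammaIntegrand (a - 1 / 2) (fun j => κ j.succ) S) := by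
  have htr : (bordered t v (S + t⁻¹ • vecMulVec v v)).trace =
      t + (S.trace + t⁻¹ * ∑ i, v i ^ 2) := by
    simp [trace, Fin.sum_univ_succ, Finset.sum_add_distrib, Finset.mul_sum, vecMulVec_apply, sq]
  have hL : powerFn κ (unipotent (t⁻¹ • v) * (unipotent (t⁻¹ • v))ᵀ) = 1 := by
    rw [powerFn_mul_transpose hκ (unipotent_lower _)]
    simp [unipotent_diag]
  unfold gammaIntegrand etr
  rw [trace_neg, htr, bordered_eq_conj ht.ne', powerFn_lower κ (unipotent_lower _), hL,
    powerFn_bordered hκ, det_mul, det_mul, det_transpose, det_unipotent, det_bordered, one_mul,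
    one_mul, mul_one, Real.mul_rpow ht.le hS.det_pos.le, trace_neg]
  have e1 : (κ 0 : ℝ) + a - ((m : ℝ) + 2) / 2 = κ 0 + (a - (((m + 1 : ℕ) : ℝ) + 1) / 2) := by
    push_cast; ring
  have e2 : a - (((m + 1 : ℕ) : ℝ) + 1) / 2 = a - 1 / 2 - ((m : ℝ) + 1) / 2 := by
    push_cast; ring
  have e3 : -(t + (S.trace + t⁻¹ * ∑ i, v i ^ 2)) =
      -t + (-(t⁻¹ * ∑ i, v i ^ 2) + -S.trace) := by ring
  rw [e1, Real.rpow_add ht, Real.rpow_natCast, e3, Real.exp_add, Real.exp_add, ← e2]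
  ring

/-- Induction on the order in Schur coordinates. The block S contributes the integral of order m
with parameter a - 1/2, the Gaussian in v contributes (πt)^(m/2), and a scalar gamma integral with
parameter a + κ 0 remains. Lower integrals allow the iterated integration before integrability is
known. -/
theorem lintegral_gammaIntegrand (m : ℕ) : ∀ (a : ℝ) (κ : Fin m → ℕ), Antitone κ →
    ((m : ℝ) - 1) / 2 < a →
    ∫⁻ x : UpperIdx m → ℝ, (posDefCone m).indicator
      (fun R => ENNReal.ofReal (gammaIntegrand a κ R)) (symOfCoords x) =
      ENNReal.ofReal (gammaProd m a κ) := by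
  induction m with
  | zero =>
    intro a κ _ _
    have h1 : ∀ R : Mat 0, R ∈ posDefCone 0 := fun R =>
      PosDef.of_dotProduct_mulVec_pos (Subsingleton.elim _ _)
        fun x hx => absurd (Subsingleton.elim x 0) hx
    have h2 : ∀ R : Mat 0, gammaIntegrand a κ R = 1 := by
      intro R
      simp [gammaIntegrand, powerFn, etr, trace]
    have h3 : gammaProd 0 a κ = 1 := by simp [gammaProd]
    simp_rw [Set.indicator_of_mem (h1 _), h2, h3]
    simp [volume_pi]
  | succ m ih =>
    intro a κ hκ ha
    have hmeas : Measurable ((posDefCone (m + 1)).indicator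
        fun R => ENNReal.ofReal (gammaIntegrand a κ R)) :=
      (measurable_gammaIntegrand a κ).ennreal_ofReal.indicator (measurableSet_posDefCone _)
    rw [lintegral_symOfCoords_succ hmeas]
    have hκ' : Antitone fun j : Fin m => κ j.succ := fun i j hij =>
      hκ (Fin.succ_le_succ_iff.mpr hij)
    have ha' : ((m : ℝ) - 1) / 2 < a - 1 / 2 := by push_cast at ha; linarith
    set I := gammaProd m (a - 1 / 2) fun j => κ j.succ with hI
    have hinner : ∀ t : ℝ, 0 < t → ∀ v : Fin m → ℝ,
        ∫⁻ z : UpperIdx m → ℝ, (posDefCone (m + 1)).indicator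
          (fun R => ENNReal.ofReal (gammaIntegrand a κ R)) (bordered t v (symOfCoords z)) =
        ENNReal.ofReal (t ^ (κ 0 + a - ((m : ℝ) + 2) / 2) * Real.exp (-t)) *
          (ENNReal.ofReal (Real.exp (-(t⁻¹ * ∑ i, v i ^ 2))) * ENNReal.ofReal I) := by
      intro t ht v
      have hsymm : (t⁻¹ • vecMulVec v v : Mat m).IsSymm := by
        rw [IsSymm, transpose_smul, transpose_vecMulVec]
      -- Translation invariance in the coordinates of the lower block replaces S by S + v vᵀ / t.
      rw [← lintegral_add_right_eq_self _ (coordsOfSym (t⁻¹ • vecMulVec v v)), hI,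
        ← ih (a - 1 / 2) _ hκ' ha', ← lintegral_const_mul' _ _ ENNReal.ofReal_ne_top,
        ← lintegral_const_mul' _ _ ENNReal.ofReal_ne_top]
      refine lintegral_congr fun z => ?_
      rw [symOfCoords_add, symOfCoords_coordsOfSym hsymm]
      by_cases hS : (symOfCoords z).PosDef
      · have h1 : bordered t v (symOfCoords z + t⁻¹ • vecMulVec v v) ∈ posDefCone (m + 1) := by
          rw [bordered_eq_conj ht.ne']
          exact posDef_conj ((posDef_bordered_zero _ _).mpr ⟨ht, hS⟩) (by simp [det_unipotent])
        have h2 : symOfCoords z ∈ posDefCone m := hS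
        rw [Set.indicator_of_mem h1, Set.indicator_of_mem h2, gammaIntegrand_bordered a hκ ht v hS,
          ENNReal.ofReal_mul (p := t ^ (κ 0 + a - ((m : ℝ) + 2) / 2) * Real.exp (-t))
            (by positivity),
          ENNReal.ofReal_mul (p := Real.exp (-(t⁻¹ * ∑ i, v i ^ 2))) (by positivity)]
      · have h1 : bordered t v (symOfCoords z + t⁻¹ • vecMulVec v v) ∉ posDefCone (m + 1) := by
          intro h
          have h : (bordered t v (symOfCoords z + t⁻¹ • vecMulVec v v)).PosDef := h
          rw [bordered_eq_conj ht.ne', posDef_conj_iff (by simp [det_unipotent]),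
            posDef_bordered_zero] at h
          exact hS h.2
        have h2 : symOfCoords z ∉ posDefCone m := hS
        rw [Set.indicator_of_notMem h1, Set.indicator_of_notMem h2]
        simp
    have hneg : ∀ t : ℝ, ¬ 0 < t → ∫⁻ v : Fin m → ℝ, ∫⁻ z : UpperIdx m → ℝ,
        (posDefCone (m + 1)).indicator (fun R => ENNReal.ofReal (gammaIntegrand a κ R))
          (bordered t v (symOfCoords z)) = 0 := by
      intro t ht
      have : ∀ (v : Fin m → ℝ) (z : UpperIdx m → ℝ),
          bordered t v (symOfCoords z) ∉ posDefCone (m + 1) := by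
        intro v z h
        have h : (bordered t v (symOfCoords z)).PosDef := h
        exact ht (by simpa using h.diag_pos (i := 0))
      simp [Set.indicator_of_notMem (this _ _)]
    have hs : 0 < a + κ 0 := by
      have : (0 : ℝ) ≤ κ 0 := Nat.cast_nonneg _
      have : (0 : ℝ) ≤ m := Nat.cast_nonneg _
      push_cast at ha; linarith
    have hIoi : ∀ t : ℝ, ∫⁻ v : Fin m → ℝ, ∫⁻ z : UpperIdx m → ℝ,
        (posDefCone (m + 1)).indicator (fun R => ENNReal.ofReal (gammaIntegrand a κ R))
          (bordered t v (symOfCoords z)) =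
        (Set.Ioi (0 : ℝ)).indicator (fun t => ENNReal.ofReal (Real.pi ^ ((m : ℝ) / 2)) *
          ENNReal.ofReal I * ENNReal.ofReal (t ^ (a + κ 0 - 1) * Real.exp (-t))) t := by
      intro t
      by_cases ht : 0 < t
      · rw [Set.indicator_of_mem (show t ∈ Set.Ioi (0 : ℝ) from ht)]
        simp_rw [hinner t ht]
        rw [lintegral_const_mul' _ _ ENNReal.ofReal_ne_top,
          lintegral_mul_const' _ _ ENNReal.ofReal_ne_top, lintegral_gaussian_pi m ht,
          ENNReal.ofReal_mul (p := Real.pi ^ ((m : ℝ) / 2)) (by positivity)]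
        have e1 : a + κ 0 - 1 = (κ 0 + a - ((m : ℝ) + 2) / 2) + (m : ℝ) / 2 := by ring
        rw [e1, Real.rpow_add ht, mul_right_comm (t ^ _), ENNReal.ofReal_mul
          (p := t ^ (κ 0 + a - ((m : ℝ) + 2) / 2) * Real.exp (-t)) (by positivity)]
        ring
      · rw [Set.indicator_of_notMem (show t ∉ Set.Ioi (0 : ℝ) from ht), hneg t ht]
    simp_rw [hIoi]
    rw [lintegral_indicator measurableSet_Ioi, lintegral_const_mul' _ _ (by finiteness),
      lintegral_gamma hs, ← ENNReal.ofReal_mul (by positivity), ← ENNReal.ofReal_mul']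
    · congr 1
      rw [hI]
      unfold gammaProd
      rw [Fin.prod_univ_succ]
      have e2 : ((m + 1 : ℕ) : ℝ) * (((m + 1 : ℕ) : ℝ) - 1) / 4 =
          (m : ℝ) / 2 + (m : ℝ) * (m - 1) / 4 := by push_cast; ring
      rw [e2, Real.rpow_add Real.pi_pos]
      have e3 : ∀ j : Fin m, a - ((j.succ : Fin (m + 1)) : ℕ) / 2 + (κ j.succ : ℝ) =
          a - 1 / 2 - (j : ℝ) / 2 + κ j.succ := by
        intro j; push_cast [Fin.val_succ]; ring
      simp_rw [e3]
      simp only [Fin.val_zero, Nat.cast_zero, zero_div, sub_zero]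
      ring
    · exact (Real.Gamma_pos_of_pos hs).le

/-! ### The Wishart distribution -/

theorem gammaProd_pos {m : ℕ} {a : ℝ} (ha : ((m : ℝ) - 1) / 2 < a) (κ : Fin m → ℕ) :
    0 < gammaProd m a κ := by
  refine mul_pos (Real.rpow_pos_of_pos Real.pi_pos _) (Finset.prod_pos fun j _ => ?_)
  refine Real.Gamma_pos_of_pos ?_
  have h1 : ((j : ℕ) : ℝ) + 1 ≤ m := by exact_mod_cast j.isLt
  have h2 : (0 : ℝ) ≤ κ j := Nat.cast_nonneg _
  linarith

theorem lintegral_symLebesgue {m : ℕ} {g : Mat m → ENNReal} (hg : Measurable g) :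
    ∫⁻ R in posDefCone m, g R ∂(symLebesgue m) =
      ∫⁻ x, (posDefCone m).indicator g (symOfCoords x) := by
  rw [← lintegral_indicator (measurableSet_posDefCone m), symLebesgue,
    lintegral_map (hg.indicator (measurableSet_posDefCone m)) (measurable_symOfCoords m)]

theorem gammaIntegrand_nonneg_ae {m : ℕ} (a : ℝ) (κ : Fin m → ℕ) :
    0 ≤ᵐ[(symLebesgue m).restrict (posDefCone m)] gammaIntegrand a κ :=
  (ae_restrict_iff' (measurableSet_posDefCone m)).mpr
    (Filter.Eventually.of_forall fun _ hR => gammaIntegrand_nonneg a κ hR)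

theorem lintegral_gammaIntegrand_cone {m : ℕ} {a : ℝ} (ha : ((m : ℝ) - 1) / 2 < a)
    {κ : Fin m → ℕ} (hκ : Antitone κ) :
    ∫⁻ R in posDefCone m, ENNReal.ofReal (gammaIntegrand a κ R) ∂(symLebesgue m) =
      ENNReal.ofReal (gammaProd m a κ) := by
  rw [lintegral_symLebesgue (measurable_gammaIntegrand a κ).ennreal_ofReal]
  exact lintegral_gammaIntegrand m a κ hκ ha

theorem integrableOn_gammaIntegrand {m : ℕ} {a : ℝ} (ha : ((m : ℝ) - 1) / 2 < a)
    {κ : Fin m → ℕ} (hκ : Antitone κ) :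
    IntegrableOn (gammaIntegrand a κ) (posDefCone m) (symLebesgue m) := by
  refine ⟨(measurable_gammaIntegrand a κ).aestronglyMeasurable, ?_⟩
  rw [hasFiniteIntegral_iff_ofReal (gammaIntegrand_nonneg_ae a κ),
    lintegral_gammaIntegrand_cone ha hκ]
  exact ENNReal.ofReal_lt_top

theorem integral_gammaIntegrand {m : ℕ} {a : ℝ} (ha : ((m : ℝ) - 1) / 2 < a)
    {κ : Fin m → ℕ} (hκ : Antitone κ) :
    ∫ R in posDefCone m, gammaIntegrand a κ R ∂(symLebesgue m) = gammaProd m a κ := by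
  rw [integral_eq_lintegral_of_nonneg_ae (gammaIntegrand_nonneg_ae a κ)
    (measurable_gammaIntegrand a κ).aestronglyMeasurable, lintegral_gammaIntegrand_cone ha hκ,
    ENNReal.toReal_ofReal (gammaProd_pos ha κ).le]

theorem antitone_zero {m : ℕ} : Antitone (0 : Fin m → ℕ) := fun _ _ _ => le_rfl

theorem powerFn_zero {m : ℕ} (Y : Mat m) : powerFn (0 : Fin m → ℕ) Y = 1 := by
  simp [powerFn]

theorem multiGamma_eq {m : ℕ} {a : ℝ} (ha : ((m : ℝ) - 1) / 2 < a) :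
    multiGamma m a = gammaProd m a 0 := by
  rw [← integral_gammaIntegrand ha antitone_zero]
  simp [multiGamma, gammaIntegrand, powerFn_zero]

theorem multiGamma_pos {m : ℕ} {a : ℝ} (ha : ((m : ℝ) - 1) / 2 < a) : 0 < multiGamma m a := by
  rw [multiGamma_eq ha]; exact gammaProd_pos ha 0

theorem Gamma_add_natCast {b : ℝ} (hb : 0 < b) (k : ℕ) :
    Real.Gamma (b + k) = (ascPochhammer ℝ k).eval b * Real.Gamma b := by
  induction k with
  | zero => simp
  | succ k ih =>
    rw [Nat.cast_succ, ← add_assoc, Real.Gamma_add_one (by positivity), ih,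
      ascPochhammer_succ_eval]
    ring

theorem gammaProd_eq {m : ℕ} {a : ℝ} (ha : ((m : ℝ) - 1) / 2 < a) (κ : Fin m → ℕ) :
    gammaProd m a κ = multiGamma m a * shiftedFactorial a κ := by
  rw [multiGamma_eq ha]
  unfold gammaProd shiftedFactorial
  rw [mul_assoc, ← Finset.prod_mul_distrib]
  congr 1
  refine Finset.prod_congr rfl fun j _ => ?_
  have h1 : ((j : ℕ) : ℝ) + 1 ≤ m := by exact_mod_cast j.isLt
  rw [Gamma_add_natCast (by linarith)]
  simp [mul_comm]

/-- The unnormalized density of the standard Wishart distribution. -/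
noncomputable def wishartWeight {m : ℕ} (a : ℝ) (R : Mat m) : ℝ :=
  R.det ^ (a - ((m : ℝ) + 1) / 2) * etr (-R)

theorem gammaIntegrand_zero {m : ℕ} (a : ℝ) :
    gammaIntegrand a (0 : Fin m → ℕ) = wishartWeight a := by
  ext R; simp [gammaIntegrand, powerFn_zero, wishartWeight]

theorem wishartDensity_one {m : ℕ} (a : ℝ) (R : Mat m) :
    wishartDensity a 1 R = (multiGamma m a)⁻¹ * wishartWeight a R := by
  simp [wishartDensity, wishartWeight, mul_assoc]

theorem measurable_wishartDensity {m : ℕ} (a : ℝ) :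
    Measurable fun R : Mat m => wishartDensity a 1 R := by
  simp_rw [wishartDensity_one, ← gammaIntegrand_zero]
  exact (measurable_gammaIntegrand a 0).const_mul _

theorem wishartDensity_nonneg {m : ℕ} {a : ℝ} (ha : ((m : ℝ) - 1) / 2 < a) {R : Mat m}
    (hR : R.PosDef) : 0 ≤ wishartDensity a 1 R := by
  rw [wishartDensity_one, ← gammaIntegrand_zero]
  exact mul_nonneg (inv_nonneg.mpr (multiGamma_pos ha).le) (gammaIntegrand_nonneg a 0 hR)

theorem ae_posDef_wishart {m : ℕ} (a : ℝ) : ∀ᵐ T ∂(wishart a (1 : Mat m)), T.PosDef :=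
  (withDensity_absolutelyContinuous _ _).ae_le (ae_restrict_mem (measurableSet_posDefCone m))

theorem integrable_wishart_iff {m : ℕ} {a : ℝ} (ha : ((m : ℝ) - 1) / 2 < a) (f : Mat m → ℝ) :
    Integrable f (wishart a (1 : Mat m)) ↔
      IntegrableOn (fun R => wishartWeight a R * f R) (posDefCone m) (symLebesgue m) := by
  have hne : (multiGamma m a)⁻¹ ≠ 0 := inv_ne_zero (multiGamma_pos ha).ne'
  unfold wishart IntegrableOn
  rw [integrable_withDensity_iff_integrable_smul' (measurable_wishartDensity a).ennreal_ofReal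
    (Filter.Eventually.of_forall fun _ => ENNReal.ofReal_lt_top),
    ← integrable_const_mul_iff hne.isUnit (fun R => wishartWeight a R * f R)]
  refine integrable_congr ((ae_restrict_iff' (measurableSet_posDefCone m)).mpr
    (Filter.Eventually.of_forall fun R hR => ?_))
  simp only
  rw [ENNReal.toReal_ofReal (wishartDensity_nonneg ha hR), wishartDensity_one, smul_eq_mul,
    mul_assoc]

theorem integral_wishart {m : ℕ} {a : ℝ} (ha : ((m : ℝ) - 1) / 2 < a) (f : Mat m → ℝ) :
    ∫ T, f T ∂(wishart a (1 : Mat m)) =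
      (multiGamma m a)⁻¹ * ∫ R in posDefCone m, wishartWeight a R * f R ∂(symLebesgue m) := by
  unfold wishart
  rw [integral_withDensity_eq_integral_toReal_smul (measurable_wishartDensity a).ennreal_ofReal
    (Filter.Eventually.of_forall fun _ => ENNReal.ofReal_lt_top), ← integral_const_mul]
  refine integral_congr_ae ((ae_restrict_iff' (measurableSet_posDefCone m)).mpr
    (Filter.Eventually.of_forall fun R hR => ?_))
  simp only
  rw [ENNReal.toReal_ofReal (wishartDensity_nonneg ha hR), wishartDensity_one, smul_eq_mul,
    mul_assoc]

theorem isProbabilityMeasure_wishart {m : ℕ} {a : ℝ} (ha : ((m : ℝ) - 1) / 2 < a) :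
    IsProbabilityMeasure (wishart a (1 : Mat m)) := by
  have h1 : Integrable (fun _ : Mat m => (1 : ℝ)) (wishart a (1 : Mat m)) := by
    rw [integrable_wishart_iff ha]
    simp only [mul_one]
    have := integrableOn_gammaIntegrand ha (antitone_zero (m := m))
    rwa [gammaIntegrand_zero] at this
  have h2 := integral_wishart ha (fun _ : Mat m => (1 : ℝ))
  simp only [mul_one] at h2
  have h3 := integral_gammaIntegrand ha (antitone_zero (m := m))
  rw [gammaIntegrand_zero] at h3
  rw [h3, ← multiGamma_eq ha, inv_mul_cancel₀ (multiGamma_pos ha).ne'] at h2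
  have h4 : IsFiniteMeasure (wishart a (1 : Mat m)) :=
    (integrable_const_iff.mp h1).resolve_left one_ne_zero
  constructor
  rw [integral_const, smul_eq_mul, mul_one, measureReal_def] at h2
  rw [← ENNReal.ofReal_toReal (measure_ne_top _ _), h2, ENNReal.ofReal_one]

theorem integral_powerFn_wishart {m : ℕ} {a : ℝ} (ha : ((m : ℝ) - 1) / 2 < a) {κ : Fin m → ℕ}
    (hκ : Antitone κ) : ∫ T, powerFn κ T ∂(wishart a (1 : Mat m)) = shiftedFactorial a κ := by
  rw [integral_wishart ha]
  have h : ∀ R : Mat m, wishartWeight a R * powerFn κ R = gammaIntegrand a κ R := fun R => by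
    simp [gammaIntegrand, wishartWeight, mul_comm]
  simp_rw [h]
  rw [integral_gammaIntegrand ha hκ, gammaProd_eq ha, ← mul_assoc,
    inv_mul_cancel₀ (multiGamma_pos ha).ne', one_mul]

/-! ### Changes of variables, exponential moments and orthogonal averages for the Wishart law -/

theorem etr_add {m : ℕ} (X Y : Mat m) : etr (X + Y) = etr X * etr Y := by
  simp [etr, Real.exp_add]

/-- The exponential factor changes etr(-T) into etr(-(A Aᵀ)⁻¹ T), which is etr(-S) at T = A S Aᵀ.
The Jacobian |det A|^(m+1) and the determinant power combine to |det A|^(2a). -/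
theorem wishartWeight_congr {m : ℕ} (a : ℝ) {A : Mat m} (hA : IsUnit A.det) {S : Mat m}
    (hS : S.PosDef) :
    |A.det| ^ (m + 1) * (wishartWeight a (A * S * Aᵀ) * etr ((1 - (A * Aᵀ)⁻¹) * (A * S * Aᵀ))) =
      |A.det| ^ (2 * a) * wishartWeight a S := by
  have hAp : 0 < |A.det| := abs_pos.mpr hA.ne_zero
  have hAt : IsUnit (Aᵀ).det := by rwa [det_transpose]
  have h1 : (A * S * Aᵀ).det = |A.det| ^ (2 : ℝ) * S.det := by
    rw [det_mul, det_mul, det_transpose, Real.rpow_two, sq_abs]; ring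
  have h2 : ((A * Aᵀ)⁻¹ * (A * S * Aᵀ)).trace = S.trace := by
    rw [trace_mul_comm, Matrix.mul_inv_rev]
    have : A * S * Aᵀ * ((Aᵀ)⁻¹ * A⁻¹) = A * (S * (Aᵀ * (Aᵀ)⁻¹) * A⁻¹) := by
      simp only [Matrix.mul_assoc]
    rw [this, mul_nonsing_inv _ hAt, Matrix.mul_one, trace_mul_comm, Matrix.mul_assoc,
      nonsing_inv_mul _ hA, Matrix.mul_one]
  have h3 : etr (-(A * S * Aᵀ)) * etr ((1 - (A * Aᵀ)⁻¹) * (A * S * Aᵀ)) = etr (-S) := by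
    rw [← etr_add, Matrix.sub_mul, Matrix.one_mul]
    unfold etr
    congr 1
    rw [trace_add, trace_sub, h2, trace_neg, trace_neg]
    ring
  unfold wishartWeight
  rw [mul_assoc, h3, h1, Real.mul_rpow (by positivity) hS.det_pos.le, ← Real.rpow_mul hAp.le,
    ← Real.rpow_natCast, ← mul_assoc, ← mul_assoc, ← mul_assoc, ← Real.rpow_add hAp]
  congr 3
  push_cast
  ring

/-- Change of variables `T = A S Aᵀ` in a Wishart integral. -/
theorem integral_wishart_congr {m : ℕ} {a : ℝ} (ha : ((m : ℝ) - 1) / 2 < a) {A : Mat m}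
    (hA : IsUnit A.det) (f : Mat m → ℝ) :
    ∫ T, etr ((1 - (A * Aᵀ)⁻¹) * T) * f T ∂(wishart a (1 : Mat m)) =
      |A.det| ^ (2 * a) * ∫ T, f (A * T * Aᵀ) ∂(wishart a (1 : Mat m)) := by
  rw [integral_wishart ha, integral_wishart ha, setIntegral_congr_posDefCone A hA,
    mul_left_comm (|A.det| ^ (2 * a))]
  congr 1
  rw [← integral_const_mul, ← integral_const_mul]
  refine integral_congr_ae ((ae_restrict_iff' (measurableSet_posDefCone m)).mpr
    (Filter.Eventually.of_forall fun S hS => ?_))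
  simp only
  rw [← mul_assoc (wishartWeight _ _), ← mul_assoc, wishartWeight_congr a hA hS, mul_assoc]

theorem integrable_wishart_congr {m : ℕ} {a : ℝ} (ha : ((m : ℝ) - 1) / 2 < a) {A : Mat m}
    (hA : IsUnit A.det) (f : Mat m → ℝ) :
    Integrable (fun T => etr ((1 - (A * Aᵀ)⁻¹) * T) * f T) (wishart a (1 : Mat m)) ↔
      Integrable (fun T => f (A * T * Aᵀ)) (wishart a (1 : Mat m)) := by
  have hAp : 0 < |A.det| := abs_pos.mpr hA.ne_zero
  have hc1 : IsUnit (|A.det| ^ (m + 1)) := (by positivity : |A.det| ^ (m + 1) ≠ 0).isUnit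
  have hc2 : IsUnit (|A.det| ^ (2 * a)) := (by positivity : |A.det| ^ (2 * a) ≠ 0).isUnit
  rw [integrable_wishart_iff ha, integrable_wishart_iff ha, integrableOn_congr_posDefCone A hA]
  unfold IntegrableOn
  rw [← integrable_const_mul_iff hc1,
    ← integrable_const_mul_iff hc2 (fun R => wishartWeight a R * f (A * R * Aᵀ))]
  refine integrable_congr ((ae_restrict_iff' (measurableSet_posDefCone m)).mpr
    (Filter.Eventually.of_forall fun S hS => ?_))
  simp only
  rw [← mul_assoc (wishartWeight _ _), ← mul_assoc, wishartWeight_congr a hA hS, mul_assoc]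

theorem integral_wishart_orth {m : ℕ} {a : ℝ} (ha : ((m : ℝ) - 1) / 2 < a) (H : Orth m)
    (f : Mat m → ℝ) :
    ∫ T, f ((H : Mat m) * T * (H : Mat m)ᵀ) ∂(wishart a (1 : Mat m)) =
      ∫ T, f T ∂(wishart a (1 : Mat m)) := by
  have h := integral_wishart_congr ha H.isUnit_det f
  have hd : |(H : Mat m).det| = 1 := by
    have h1 := congrArg det H.mul_transpose
    rw [det_mul, det_one, det_transpose] at h1
    have h2 : |(H : Mat m).det| * |(H : Mat m).det| = 1 := by rw [← abs_mul, h1, abs_one]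
    nlinarith [abs_nonneg (H : Mat m).det]
  rw [H.mul_transpose, hd] at h
  simpa [etr] using h.symm

theorem isUnit_det_diagonal {m : ℕ} {z : Fin m → ℝ} (hz : ∀ i, 0 < z i) :
    IsUnit (diagonal z : Mat m).det := by
  rw [det_diagonal]
  exact (Finset.prod_pos fun i _ => hz i).ne'.isUnit

theorem diagonal_sq_inv {m : ℕ} {z : Fin m → ℝ} (hz : ∀ i, 0 < z i) :
    (diagonal (fun i => (√(z i))⁻¹) * (diagonal (fun i => (√(z i))⁻¹) : Mat m)ᵀ)⁻¹ =
      diagonal z := by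
  refine Matrix.inv_eq_right_inv ?_
  rw [diagonal_transpose, diagonal_mul_diagonal, diagonal_mul_diagonal, ← diagonal_one]
  congr 1
  ext i
  have h := Real.mul_self_sqrt (hz i).le
  have h2 := Real.sqrt_pos.mpr (hz i)
  field_simp
  nlinarith

theorem abs_det_diagonal_rpow {m : ℕ} {z : Fin m → ℝ} (hz : ∀ i, 0 < z i) (a : ℝ) :
    |(diagonal (fun i => (√(z i))⁻¹) : Mat m).det| ^ (2 * a) = (∏ i, z i) ^ (-a) := by
  have hp : ∀ i, 0 < (√(z i))⁻¹ := fun i => inv_pos.mpr (Real.sqrt_pos.mpr (hz i))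
  rw [det_diagonal, abs_of_pos (Finset.prod_pos fun i _ => hp i), Finset.prod_inv_distrib,
    ← Real.finsetProd_rpow _ _ (fun i _ => (hz i).le), Real.inv_rpow
      (Finset.prod_nonneg fun i _ => Real.sqrt_nonneg _),
    ← Real.finsetProd_rpow _ _ (fun i _ => Real.sqrt_nonneg _), ← Finset.prod_inv_distrib]
  refine Finset.prod_congr rfl fun i _ => ?_
  rw [Real.sqrt_eq_rpow, ← Real.rpow_mul (hz i).le, Real.rpow_neg (hz i).le]
  congr 2
  ring

/-- Wishart integrals with an exponential factor in a diagonal direction. -/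
theorem integral_wishart_diagonal {m : ℕ} {a : ℝ} (ha : ((m : ℝ) - 1) / 2 < a) {z : Fin m → ℝ}
    (hz : ∀ i, 0 < z i) (f : Mat m → ℝ) :
    ∫ T, etr ((1 - diagonal z) * T) * f T ∂(wishart a (1 : Mat m)) =
      (∏ i, z i) ^ (-a) * ∫ T, f (diagonal (fun i => (√(z i))⁻¹) * T *
        (diagonal (fun i => (√(z i))⁻¹))ᵀ) ∂(wishart a (1 : Mat m)) := by
  have hp : ∀ i, 0 < (√(z i))⁻¹ := fun i => inv_pos.mpr (Real.sqrt_pos.mpr (hz i))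
  have h := integral_wishart_congr ha (isUnit_det_diagonal hp) f
  rwa [diagonal_sq_inv hz, abs_det_diagonal_rpow hz] at h

/-- The congruence by (1-ε)^(-1/2) times the identity absorbs the exponential into the Wishart
weight, leaving a constant on a probability space. -/
theorem integrable_wishart_exp_trace {m : ℕ} {a : ℝ} (ha : ((m : ℝ) - 1) / 2 < a) {ε : ℝ}
    (hε : ε < 1) :
    Integrable (fun T : Mat m => Real.exp (ε * T.trace)) (wishart a (1 : Mat m)) := by
  have := isProbabilityMeasure_wishart (m := m) ha
  have hz : ∀ _ : Fin m, 0 < 1 - ε := fun _ => by linarith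
  have hp : ∀ _ : Fin m, 0 < (√(1 - ε))⁻¹ := fun i => inv_pos.mpr (Real.sqrt_pos.mpr (hz i))
  have h := (integrable_wishart_congr ha (isUnit_det_diagonal hp) (fun _ => 1)).mpr
    (integrable_const 1)
  rw [diagonal_sq_inv hz] at h
  refine h.congr (Filter.Eventually.of_forall fun T => ?_)
  have : (1 - diagonal (fun _ : Fin m => 1 - ε) : Mat m) = ε • 1 := by
    rw [smul_one_eq_diagonal, ← diagonal_one, diagonal_sub]; simp
  simp only [this, mul_one, etr, smul_mul, Matrix.one_mul, trace_smul, smul_eq_mul]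

theorem pow_le_exp_mul {x ε : ℝ} (hx : 0 ≤ x) (hε : 0 < ε) (k : ℕ) :
    x ^ k / (Nat.factorial k : ℝ) ≤ (ε⁻¹) ^ k * Real.exp (ε * x) := by
  have h := Real.pow_div_factorial_le_exp (ε * x) (by positivity) k
  rw [mul_pow] at h
  have h1 : x ^ k / (Nat.factorial k : ℝ) = (ε⁻¹) ^ k * (ε ^ k * x ^ k / Nat.factorial k) := by
    rw [inv_pow]; field_simp
  rw [h1]
  exact mul_le_mul_of_nonneg_left h (by positivity)

theorem integrable_wishart_trace_pow {m : ℕ} {a : ℝ} (ha : ((m : ℝ) - 1) / 2 < a) (k : ℕ) :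
    Integrable (fun T : Mat m => T.trace ^ k) (wishart a (1 : Mat m)) := by
  have h := (integrable_wishart_exp_trace (m := m) ha (ε := 1 / 2) (by norm_num)).const_mul
    ((Nat.factorial k : ℝ) * 2 ^ k)
  refine h.mono' (Continuous.aestronglyMeasurable (by fun_prop)) ?_
  filter_upwards [ae_posDef_wishart a] with T hT
  have h0 := hT.posSemidef.trace_nonneg
  rw [Real.norm_of_nonneg (by positivity)]
  have h2 := pow_le_exp_mul h0 (ε := 1 / 2) (by norm_num) k
  have h3 : (0 : ℝ) < Nat.factorial k := by positivity
  rw [div_le_iff₀ h3] at h2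
  refine h2.trans (le_of_eq ?_)
  norm_num
  ring

theorem trace_conj_le {m : ℕ} (A : Mat m) {T : Mat m} (hT : T.PosSemidef) :
    (A * T * Aᵀ).trace ≤ (∑ i, ∑ j, |(Aᵀ * A) i j|) * T.trace := by
  rw [trace_mul_comm, ← Matrix.mul_assoc, trace, Finset.sum_mul]
  refine Finset.sum_le_sum fun i _ => ?_
  rw [diag_apply, mul_apply, Finset.sum_mul]
  refine Finset.sum_le_sum fun j _ => ?_
  refine (le_abs_self _).trans ?_
  rw [abs_mul]
  exact mul_le_mul_of_nonneg_left (abs_apply_le_trace hT _ _) (abs_nonneg _)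

theorem integrable_spherical_conj_wishart {m : ℕ} {a : ℝ} (ha : ((m : ℝ) - 1) / 2 < a)
    {κ : Fin m → ℕ} (hκ : Antitone κ) (A : Mat m) :
    Integrable (fun T => spherical κ (A * T * Aᵀ)) (wishart a (1 : Mat m)) := by
  have hc : Continuous fun T : Mat m => spherical κ (A * T * Aᵀ) :=
    (continuous_spherical κ).comp (by fun_prop)
  set C := ∑ i, ∑ j, |(Aᵀ * A) i j|
  have h := (integrable_wishart_trace_pow (m := m) ha (weight κ)).const_mul
    (((Nat.factorial m : ℝ) * C) ^ weight κ)
  refine h.mono' hc.aestronglyMeasurable ?_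
  filter_upwards [ae_posDef_wishart a] with T hT
  have hAT := posSemidef_conj hT.posSemidef A
  rw [Real.norm_of_nonneg (spherical_nonneg κ hAT)]
  refine (spherical_le hκ hAT).trans ?_
  rw [← mul_pow]
  refine pow_le_pow_left₀ (mul_nonneg (by positivity) hAT.trace_nonneg) ?_ _
  rw [mul_assoc (Nat.factorial m : ℝ)]
  exact mul_le_mul_of_nonneg_left (trace_conj_le A hT.posSemidef) (Nat.cast_nonneg _)

/-- Averaging a Wishart integral over the orthogonal group. -/
theorem integral_wishart_average {m : ℕ} {a : ℝ} (ha : ((m : ℝ) - 1) / 2 < a) {f : Mat m → ℝ}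
    (hf : Measurable f) {g : Mat m → ℝ} (hg : Integrable g (wishart a (1 : Mat m)))
    (hfg : ∀ T : Mat m, T.PosDef → ∀ H : Orth m,
      |f ((H : Mat m) * T * (H : Mat m)ᵀ)| ≤ g T) :
    ∫ T, f T ∂(wishart a (1 : Mat m)) =
      ∫ T, (∫ H : Orth m, f ((H : Mat m) * T * (H : Mat m)ᵀ) ∂(orthHaar m))
        ∂(wishart a (1 : Mat m)) := by
  have := isProbabilityMeasure_wishart (m := m) ha
  have hc := Orth.continuous_coe (m := m)
  rw [integral_integral_swap]
  · simp_rw [integral_wishart_orth ha _ f]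
    simp
  · have hmeas : Measurable (Function.uncurry fun (T : Mat m) (H : Orth m) =>
        f ((H : Mat m) * T * (H : Mat m)ᵀ)) := by
      refine hf.comp (Continuous.measurable ?_)
      fun_prop
    refine (hg.comp_fst (orthHaar m)).mono' hmeas.aestronglyMeasurable ?_
    have h1 : ∀ᵐ p ∂(wishart a (1 : Mat m)).prod (orthHaar m), p.1.PosDef :=
      Measure.quasiMeasurePreserving_fst.ae (ae_posDef_wishart a)
    filter_upwards [h1] with p hp
    exact hfg p.1 hp p.2

/-- Spherical polynomials are eigenfunctions of Wishart averaging. -/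
theorem integral_spherical_conj_wishart {m : ℕ} {a : ℝ} (ha : ((m : ℝ) - 1) / 2 < a)
    {κ : Fin m → ℕ} (hκ : Antitone κ) (A : Mat m) :
    ∫ T, spherical κ (A * T * Aᵀ) ∂(wishart a (1 : Mat m)) =
      shiftedFactorial a κ * spherical κ (A * Aᵀ) := by
  have := isProbabilityMeasure_wishart (m := m) ha
  -- The Wishart law is invariant under orthogonal conjugation, so the power function and its
  -- orthogonal average have the same integral, namely the gamma integral.
  have h1 : ∫ T, spherical κ T ∂(wishart a (1 : Mat m)) = shiftedFactorial a κ := by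
    rw [← integral_powerFn_wishart ha hκ, integral_wishart_average ha (continuous_powerFn κ).measurable
      ((integrable_wishart_trace_pow (m := m) ha (weight κ)).const_mul
        ((Nat.factorial m : ℝ) ^ weight κ))]
    · rfl
    · intro T hT H
      rw [← mul_pow]
      exact powerFn_conj_le hκ hT.posSemidef H
  have hc : Continuous fun T : Mat m => spherical κ (A * T * Aᵀ) :=
    (continuous_spherical κ).comp (by fun_prop)
  set C := ∑ i, ∑ j, |(Aᵀ * A) i j|
  rw [integral_wishart_average ha hc.measurable ((integrable_wishart_trace_pow (m := m) ha
    (weight κ)).const_mul (((Nat.factorial m : ℝ) * C) ^ weight κ))]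
  -- By the product formula, averaging T over its orthogonal orbit separates A from T, which reduces
  -- the claim to A = 1.
  · simp_rw [integral_spherical_conj]
    rw [integral_const_mul, h1, mul_comm]
  · intro T hT H
    have hHT := posSemidef_conj hT.posSemidef (H : Mat m)
    have hAT := posSemidef_conj hHT A
    rw [abs_of_nonneg (spherical_nonneg κ hAT)]
    refine (spherical_le hκ hAT).trans ?_
    rw [← mul_pow]
    refine pow_le_pow_left₀ (mul_nonneg (by positivity) hAT.trace_nonneg) ?_ _
    rw [mul_assoc (Nat.factorial m : ℝ), ← trace_conj_orth H T]
    exact mul_le_mul_of_nonneg_left (trace_conj_le A hHT) (Nat.cast_nonneg _)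

/-! ### Bordering by a last row and column -/

/-- The block diagonal matrix with blocks `Y` and `c`. -/
def snocMat {m : ℕ} (Y : Mat m) (c : ℝ) : Mat (m + 1) :=
  Matrix.of (Fin.snoc (α := fun _ => Fin (m + 1) → ℝ)
    (fun i => Fin.snoc (α := fun _ => ℝ) (Y i) 0) (Fin.snoc (α := fun _ => ℝ) 0 c))

section
variable {m : ℕ} (Y : Mat m) (c : ℝ)

@[simp] theorem snocMat_castSucc_castSucc (i j : Fin m) :
    snocMat Y c i.castSucc j.castSucc = Y i j := by simp [snocMat]
@[simp] theorem snocMat_castSucc_last (i : Fin m) :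
    snocMat Y c i.castSucc (Fin.last m) = 0 := by simp [snocMat]
@[simp] theorem snocMat_last_castSucc (j : Fin m) :
    snocMat Y c (Fin.last m) j.castSucc = 0 := by simp [snocMat]
@[simp] theorem snocMat_last_last :
    snocMat Y c (Fin.last m) (Fin.last m) = c := by simp [snocMat]

end

theorem snocMat_mul {m : ℕ} (Y Z : Mat m) (c d : ℝ) :
    snocMat Y c * snocMat Z d = snocMat (Y * Z) (c * d) := by
  ext i j
  refine Fin.lastCases ?_ (fun i => ?_) i <;> refine Fin.lastCases ?_ (fun j => ?_) j <;>
    simp [mul_apply, Fin.sum_univ_castSucc]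

theorem snocMat_transpose {m : ℕ} (Y : Mat m) (c : ℝ) : (snocMat Y c)ᵀ = snocMat Yᵀ c := by
  ext i j
  refine Fin.lastCases ?_ (fun i => ?_) i <;> refine Fin.lastCases ?_ (fun j => ?_) j <;> simp

theorem snocMat_diagonal {m : ℕ} (y : Fin m → ℝ) (c : ℝ) :
    snocMat (diagonal y) c = diagonal (Fin.snoc (α := fun _ => ℝ) y c) := by
  ext i j
  refine Fin.lastCases ?_ (fun i => ?_) i <;> refine Fin.lastCases ?_ (fun j => ?_) j <;>
    simp [diagonal_apply, fun j : Fin m => (Fin.castSucc_lt_last j).ne']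

theorem snocMat_one {m : ℕ} : snocMat (1 : Mat m) 1 = 1 := by
  rw [← diagonal_one, snocMat_diagonal, ← diagonal_one]
  congr 1
  ext i
  refine Fin.lastCases ?_ (fun i => ?_) i <;> simp

/-- The embedding of `O(m)` into `O(m + 1)`. -/
noncomputable def snocOrth {m : ℕ} (K : Orth m) : Orth (m + 1) :=
  ⟨snocMat (K : Mat m) 1, by
    rw [mem_orthogonalGroup_iff, snocMat_transpose, snocMat_mul, K.mul_transpose, mul_one,
      snocMat_one]⟩

/-- The upper left block of order `m`. -/
abbrev initBlock {m : ℕ} (A : Mat (m + 1)) : Mat m := A.submatrix Fin.castSucc Fin.castSucc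

theorem initBlock_conj_snocMat {m : ℕ} (A : Mat (m + 1)) (Y : Mat m) :
    initBlock (A * snocMat Y 0 * Aᵀ) = initBlock A * Y * (initBlock A)ᵀ := by
  ext i j
  simp [mul_apply, Fin.sum_univ_castSucc]

theorem initBlock_mul_snocMat {m : ℕ} (A : Mat (m + 1)) (Y : Mat m) (c : ℝ) :
    initBlock (A * snocMat Y c) = initBlock A * Y := by
  ext i j
  simp [mul_apply, Fin.sum_univ_castSucc]

theorem part_castSucc {m : ℕ} {κ : Fin (m + 1) → ℕ} (h0 : κ (Fin.last m) = 0) (i : ℕ) :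
    part κ i = part (fun j => κ j.castSucc) i := by
  unfold part
  rcases lt_trichotomy i m with h | h | h
  · rw [dif_pos h, dif_pos (by omega)]; rfl
  · subst h
    rw [dif_pos (Nat.lt_succ_self _), dif_neg (lt_irrefl _)]
    exact h0
  · rw [dif_neg (by omega), dif_neg (by omega)]

theorem powerFn_initBlock {m : ℕ} {κ : Fin (m + 1) → ℕ} (h0 : κ (Fin.last m) = 0)
    (M : Mat (m + 1)) : powerFn κ M = powerFn (fun j => κ j.castSucc) (initBlock M) := by
  unfold powerFn
  rw [Fin.prod_univ_castSucc, h0, Nat.zero_sub, pow_zero, mul_one]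
  refine Finset.prod_congr rfl fun j _ => ?_
  rw [part_castSucc h0, Fin.val_castSucc]
  rfl

/-- When the last part is zero, only the upper left corner enters. Right invariance of the Haar
measure of O(m+1) under the embedded O(m) allows Y to be averaged over its orbit, and
`integral_powerFn_conj` splits off Y, with the corner of H in the role of B. -/
theorem spherical_snocMat {m : ℕ} {κ : Fin (m + 1) → ℕ} (h0 : κ (Fin.last m) = 0) (Y : Mat m) :
    spherical κ (snocMat Y 0) =
      spherical κ (snocMat 1 0) * spherical (fun j => κ j.castSucc) Y := by
  have hc := Orth.continuous_coe (m := m)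
  have hc' := Orth.continuous_coe (m := m + 1)
  have hb : Continuous fun H : Orth (m + 1) => initBlock (H : Mat (m + 1)) :=
    (Continuous.matrix_submatrix hc' _ _)
  set κ' : Fin m → ℕ := fun j => κ j.castSucc
  have h1 : ∀ K : Orth m, spherical κ (snocMat Y 0) = ∫ H : Orth (m + 1),
      powerFn κ' (initBlock (H : Mat (m + 1)) * ((K : Mat m) * Y * (K : Mat m)ᵀ) *
        (initBlock (H : Mat (m + 1)))ᵀ) ∂(orthHaar (m + 1)) := by
    intro K
    unfold spherical
    rw [← integral_mul_right_eq_self (μ := orthHaar (m + 1)) _ (snocOrth K)]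
    congr 1
    ext H
    rw [powerFn_initBlock h0, initBlock_conj_snocMat]
    change powerFn κ' (initBlock ((H : Mat (m + 1)) * snocMat (K : Mat m) 1) * Y *
      (initBlock ((H : Mat (m + 1)) * snocMat (K : Mat m) 1))ᵀ) = _
    rw [initBlock_mul_snocMat, transpose_mul]
    simp only [Matrix.mul_assoc]
  have h2 : spherical κ (snocMat Y 0) = ∫ K : Orth m, (∫ H : Orth (m + 1),
      powerFn κ' (initBlock (H : Mat (m + 1)) * ((K : Mat m) * Y * (K : Mat m)ᵀ) *
        (initBlock (H : Mat (m + 1)))ᵀ) ∂(orthHaar (m + 1))) ∂(orthHaar m) := by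
    simp_rw [← h1]
    simp
  rw [h2, integral_integral_swap]
  · simp_rw [integral_powerFn_conj]
    rw [integral_mul_const]
    congr 1
    unfold spherical
    congr 1
    ext H
    rw [powerFn_initBlock h0, initBlock_conj_snocMat, Matrix.mul_one]
  · have hcont : Continuous (Function.uncurry fun (K : Orth m) (H : Orth (m + 1)) =>
        powerFn κ' (initBlock (H : Mat (m + 1)) * ((K : Mat m) * Y * (K : Mat m)ᵀ) *
        (initBlock (H : Mat (m + 1)))ᵀ)) := by
      refine (continuous_powerFn κ').comp ?_
      have h3 : Continuous fun p : Orth m × Orth (m + 1) => initBlock (p.2 : Mat (m + 1)) :=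
        hb.comp continuous_snd
      have h4 : Continuous fun p : Orth m × Orth (m + 1) => (p.1 : Mat m) :=
        hc.comp continuous_fst
      exact (h3.matrix_mul ((h4.matrix_mul continuous_const).matrix_mul
        h4.matrix_transpose)).matrix_mul h3.matrix_transpose
    rw [← integrableOn_univ]
    exact hcont.continuousOn.integrableOn_compact isCompact_univ

/-! ### Radial Gaussian integrals -/

/-- The Gaussian weight `exp(-c |x|²)`. -/
noncomputable def gaussWeight {n : ℕ} (c : ℝ) (x : Fin n → ℝ) : ℝ :=
  Real.exp (-(c * ∑ i, x i ^ 2))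

theorem continuous_gaussWeight {n : ℕ} (c : ℝ) :
    Continuous (gaussWeight c : (Fin n → ℝ) → ℝ) := by
  unfold gaussWeight; fun_prop

theorem lintegral_pi_smul {n : ℕ} {r : ℝ} (hr : 0 < r) {f : (Fin n → ℝ) → ENNReal}
    (hf : Measurable f) :
    ∫⁻ x, f x = ENNReal.ofReal (r ^ n) * ∫⁻ x, f (r • x) := by
  have h := Measure.map_addHaar_smul (volume : Measure (Fin n → ℝ)) hr.ne'
  have h2 : ∫⁻ x, f (r • x) = ∫⁻ x, f x ∂(Measure.map (r • ·) volume) :=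
    (lintegral_map hf (measurable_const_smul r)).symm
  rw [h2, h, lintegral_smul_measure, smul_eq_mul, ← mul_assoc, ← ENNReal.ofReal_mul (by positivity)]
  simp only [Module.finrank_fintype_fun_eq_card, Fintype.card_fin]
  rw [abs_of_pos (by positivity), mul_inv_cancel₀ (by positivity), ENNReal.ofReal_one, one_mul]

/-- For x ≠ 0, exp(-|x|²) is the integral of |x|² exp(-c|x|²) over c > 1. After exchanging the
integrals, rescaling x by c^(-1/2) extracts c^(-(s+1)) with s = n/2 + q, whose integral over c > 1
is 1/s. -/
theorem lintegral_radial_succ {n : ℕ} {q : ℕ} (hn : 0 < n) {f : (Fin n → ℝ) → ℝ}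
    (hf : Continuous f) (hf0 : ∀ x, 0 ≤ f x) (hq : ∀ r x, f (r • x) = r ^ (2 * q) * f x) :
    ∫⁻ x, ENNReal.ofReal ((∑ i, x i ^ 2) * f x * gaussWeight 1 x) =
      ENNReal.ofReal ((n : ℝ) / 2 + q) * ∫⁻ x, ENNReal.ofReal (f x * gaussWeight 1 x) := by
  set s : ℝ := (n : ℝ) / 2 + q with hs
  have hnp : (0 : ℝ) < n := by exact_mod_cast hn
  have hs0 : 0 < s := by positivity
  set g : ℝ → ENNReal := fun c =>
    ∫⁻ x : Fin n → ℝ, ENNReal.ofReal ((∑ i, x i ^ 2) * f x * gaussWeight c x) with hg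
  have hsum0 : ∀ x : Fin n → ℝ, 0 ≤ ∑ i, x i ^ 2 := fun x =>
    Finset.sum_nonneg fun i _ => sq_nonneg _
  have hgw : ∀ c (x : Fin n → ℝ), 0 < gaussWeight c x := fun c x => Real.exp_pos _
  have hscale : ∀ c : ℝ, 0 < c → g c = ENNReal.ofReal (c ^ (-(s + 1))) * g 1 := by
    intro c hc
    have hsc : 0 < √c := Real.sqrt_pos.mpr hc
    have hsq : √c ^ 2 = c := Real.sq_sqrt hc.le
    have hcg := continuous_gaussWeight (n := n) c
    rw [hg]
    simp only
    have hp : 0 < (√c)⁻¹ := inv_pos.mpr hsc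
    rw [lintegral_pi_smul hp (by fun_prop), ← lintegral_const_mul' _ _ ENNReal.ofReal_ne_top,
      ← lintegral_const_mul' _ _ ENNReal.ofReal_ne_top]
    refine lintegral_congr fun x => ?_
    rw [← ENNReal.ofReal_mul (by positivity), ← ENNReal.ofReal_mul (by positivity)]
    congr 1
    have h1 : ∑ i, ((√c)⁻¹ • x) i ^ 2 = c⁻¹ * ∑ i, x i ^ 2 := by
      simp only [Pi.smul_apply, smul_eq_mul, mul_pow, inv_pow, hsq, Finset.mul_sum]
    have h2 : gaussWeight c ((√c)⁻¹ • x) = gaussWeight 1 x := by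
      unfold gaussWeight
      rw [h1]
      congr 1
      field_simp
    rw [h1, h2, hq]
    have h3 : c ^ (-(s + 1)) = (√c)⁻¹ ^ n * (c⁻¹ * (√c)⁻¹ ^ (2 * q)) := by
      rw [pow_mul, inv_pow (√c) 2, hsq, ← Real.sqrt_inv, Real.sqrt_eq_rpow, ← Real.rpow_natCast,
        ← Real.rpow_natCast, ← Real.rpow_mul (by positivity), ← Real.rpow_one_add' (by positivity),
        ← Real.rpow_add (by positivity), Real.inv_rpow hc.le, ← Real.rpow_neg hc.le]
      · congr 1
        rw [hs]; ring
      · positivity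
    rw [h3]
    ring
  have hint : ∫⁻ c in Set.Ioi (1 : ℝ), g c = ENNReal.ofReal s⁻¹ * g 1 := by
    have h1 : ∫⁻ c in Set.Ioi (1 : ℝ), g c =
        ∫⁻ c in Set.Ioi (1 : ℝ), ENNReal.ofReal (c ^ (-(s + 1))) * g 1 := by
      refine setLIntegral_congr_fun measurableSet_Ioi fun c hc => ?_
      exact hscale c (lt_trans one_pos hc)
    rw [h1, lintegral_mul_const _ (by fun_prop), ← ofReal_integral_eq_lintegral_ofReal
      (integrableOn_Ioi_rpow_of_lt (by linarith) one_pos), integral_Ioi_rpow_of_lt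
      (by linarith) one_pos]
    · congr 2
      rw [Real.one_rpow, neg_add, neg_add_cancel_right, neg_div_neg_eq, one_div]
    · refine (ae_restrict_iff' measurableSet_Ioi).mpr (Filter.Eventually.of_forall fun c hc => ?_)
      have : (0 : ℝ) < c := lt_trans one_pos hc
      positivity
  have hswap : ∫⁻ c in Set.Ioi (1 : ℝ), g c =
      ∫⁻ x : Fin n → ℝ, ENNReal.ofReal (f x * gaussWeight 1 x) := by
    rw [hg, lintegral_lintegral_swap]
    -- The integral representation of exp(-|x|²) fails at the origin, which is a null set because n
    -- > 0.
    · have hne : ∀ᵐ x : Fin n → ℝ, x ≠ 0 := by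
        have : Nonempty (Fin n) := ⟨⟨0, hn⟩⟩
        exact Measure.ae_ne volume 0
      refine lintegral_congr_ae ?_
      filter_upwards [hne] with x hx
      set σ := ∑ i, x i ^ 2 with hσ
      have hσ0 : 0 < σ := by
        obtain ⟨i, hi⟩ := Function.ne_iff.mp hx
        have : 0 < x i ^ 2 := by have : x i ≠ 0 := hi; positivity
        exact lt_of_lt_of_le this (Finset.single_le_sum (f := fun i => x i ^ 2)
          (fun i _ => sq_nonneg _) (Finset.mem_univ i))
      have hi1 : IntegrableOn (fun c : ℝ => σ * f x * Real.exp (-σ * c)) (Set.Ioi 1) :=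
        (integrableOn_exp_mul_Ioi (by linarith) 1).const_mul _
      have he : ∀ c : ℝ, gaussWeight c x = Real.exp (-σ * c) := fun c => by
        unfold gaussWeight; rw [← hσ]; congr 1; ring
      simp_rw [he]
      rw [← ofReal_integral_eq_lintegral_ofReal hi1, integral_const_mul,
        integral_exp_mul_Ioi (by linarith)]
      · congr 1
        field_simp
      · exact Filter.Eventually.of_forall fun c => by have := hf0 x; positivity
    · refine Measurable.aemeasurable ?_
      refine ENNReal.measurable_ofReal.comp (Continuous.measurable ?_)
      have : Continuous fun p : ℝ × (Fin n → ℝ) => gaussWeight p.1 p.2 := by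
        unfold gaussWeight; fun_prop
      have hf' : Continuous fun p : ℝ × (Fin n → ℝ) => f p.2 := hf.comp continuous_snd
      exact ((by fun_prop : Continuous fun p : ℝ × (Fin n → ℝ) => ∑ i, p.2 i ^ 2).mul hf').mul this
  rw [← hswap, hint, ← mul_assoc, ← ENNReal.ofReal_mul hs0.le, mul_inv_cancel₀ hs0.ne',
    ENNReal.ofReal_one, one_mul]

theorem lintegral_radial {n : ℕ} {q : ℕ} (hn : 0 < n) {f : (Fin n → ℝ) → ℝ}
    (hf : Continuous f) (hf0 : ∀ x, 0 ≤ f x) (hq : ∀ r x, f (r • x) = r ^ (2 * q) * f x) (e : ℕ) :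
    ∫⁻ x, ENNReal.ofReal ((∑ i, x i ^ 2) ^ e * f x * gaussWeight 1 x) =
      ENNReal.ofReal ((ascPochhammer ℝ e).eval ((n : ℝ) / 2 + q)) *
        ∫⁻ x, ENNReal.ofReal (f x * gaussWeight 1 x) := by
  have hnp : (0 : ℝ) < n := by exact_mod_cast hn
  induction e with
  | zero => simp
  | succ e ih =>
    have h := lintegral_radial_succ (q := q + e) hn (f := fun x => (∑ i, x i ^ 2) ^ e * f x)
      (by fun_prop) (fun x => mul_nonneg (pow_nonneg (Finset.sum_nonneg fun i _ => sq_nonneg _) _)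
        (hf0 x)) (fun r x => by
          simp only [Pi.smul_apply, smul_eq_mul, mul_pow, ← Finset.mul_sum, hq]; ring)
    have h2 : ∀ x : Fin n → ℝ, (∑ i, x i ^ 2) ^ (e + 1) * f x * gaussWeight 1 x =
        (∑ i, x i ^ 2) * ((∑ i, x i ^ 2) ^ e * f x) * gaussWeight 1 x := fun x => by ring
    simp_rw [h2]
    rw [h, ih, ← mul_assoc, ← ENNReal.ofReal_mul (by positivity), ascPochhammer_succ_eval]
    congr 2
    push_cast
    ring

/-- The product of the partial sums of squares, with the exponents of a power function. -/
noncomputable def tailPower {n : ℕ} (κ : Fin n → ℕ) (y : Fin n → ℝ) : ℝ :=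
  ∏ j : Fin n, (∑ i ∈ Finset.univ.filter (j ≤ ·), y i ^ 2) ^ (κ j - part κ (j + 1))

theorem continuous_tailPower {n : ℕ} (κ : Fin n → ℕ) : Continuous (tailPower κ) := by
  unfold tailPower; fun_prop

theorem tailPower_nonneg {n : ℕ} (κ : Fin n → ℕ) (y : Fin n → ℝ) : 0 ≤ tailPower κ y :=
  Finset.prod_nonneg fun _ _ => pow_nonneg (Finset.sum_nonneg fun _ _ => sq_nonneg _) _

theorem sum_sub_part {n : ℕ} {κ : Fin n → ℕ} (hκ : Antitone κ) :
    ∑ j, (κ j - part κ (j + 1)) = part κ 0 := by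
  rcases Nat.eq_zero_or_pos n with h | h
  · subst h; simp [part]
  · have : NeZero n := ⟨h.ne'⟩
    have := sum_part_sub hκ 0
    simp only [Fin.zero_le, if_true] at this
    rw [this, part, dif_pos h]
    exact congrArg κ (Fin.ext (by simp))

theorem tailPower_smul {n : ℕ} {κ : Fin n → ℕ} (hκ : Antitone κ) (r : ℝ) (y : Fin n → ℝ) :
    tailPower κ (r • y) = r ^ (2 * part κ 0) * tailPower κ y := by
  unfold tailPower
  simp only [Pi.smul_apply, smul_eq_mul, mul_pow, ← Finset.mul_sum, Finset.prod_mul_distrib]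
  rw [Finset.prod_pow_eq_pow_sum, sum_sub_part hκ, pow_mul]

theorem tailPower_succ {n : ℕ} (κ : Fin (n + 1) → ℕ) (y : Fin (n + 1) → ℝ) :
    tailPower κ y = (∑ i, y i ^ 2) ^ (κ 0 - part κ 1) *
      tailPower (fun j => κ j.succ) (fun j => y j.succ) := by
  unfold tailPower
  rw [Fin.prod_univ_succ]
  congr 1
  · simp
  · refine Finset.prod_congr rfl fun j _ => ?_
    rw [Fin.val_succ, part_succ κ]
    congr 1
    rw [Finset.sum_filter, Finset.sum_filter, Fin.sum_univ_succ]
    simp [Fin.succ_le_succ_iff]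

theorem lintegral_gauss_succ {n : ℕ} {f : (Fin n → ℝ) → ℝ} (hf : Continuous f) :
    ∫⁻ y : Fin (n + 1) → ℝ, ENNReal.ofReal (f (fun j => y j.succ) * gaussWeight 1 y) =
      ENNReal.ofReal (√Real.pi) * ∫⁻ x, ENNReal.ofReal (f x * gaussWeight 1 x) := by
  have hc := continuous_gaussWeight (n := n + 1) 1
  have hc' := continuous_gaussWeight (n := n) 1
  have h6 := (volume_preserving_piFinSuccAbove (fun _ : Fin (n + 1) => ℝ) 0).symm
  have hm : Measurable fun y : Fin (n + 1) → ℝ =>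
      ENNReal.ofReal (f (fun j => y j.succ) * gaussWeight 1 y) := by
    refine ENNReal.measurable_ofReal.comp (Continuous.measurable ?_)
    exact (hf.comp (by fun_prop)).mul hc
  have hm2 : Measurable fun p : ℝ × (Fin n → ℝ) => ENNReal.ofReal (f (fun j =>
      ((MeasurableEquiv.piFinSuccAbove (fun _ => ℝ) 0).symm p : Fin (n + 1) → ℝ) j.succ) *
      gaussWeight 1 ((MeasurableEquiv.piFinSuccAbove (fun _ => ℝ) 0).symm p :
        Fin (n + 1) → ℝ)) := hm.comp (MeasurableEquiv.measurable _)
  rw [← h6.lintegral_comp hm, Measure.volume_eq_prod, lintegral_prod _ hm2.aemeasurable]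
  have h1 : ∀ (t : ℝ) (x : Fin n → ℝ), ENNReal.ofReal (f (fun j =>
      ((MeasurableEquiv.piFinSuccAbove (fun _ => ℝ) 0).symm (t, x) : Fin (n + 1) → ℝ) j.succ) *
      gaussWeight 1 ((MeasurableEquiv.piFinSuccAbove (fun _ => ℝ) 0).symm (t, x) :
        Fin (n + 1) → ℝ)) = ENNReal.ofReal (Real.exp (-1 * t ^ 2)) *
          ENNReal.ofReal (f x * gaussWeight 1 x) := by
    intro t x
    rw [← ENNReal.ofReal_mul (Real.exp_pos _).le]
    congr 1
    have h2 : ((MeasurableEquiv.piFinSuccAbove (fun _ => ℝ) 0).symm (t, x) : Fin (n + 1) → ℝ) =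
      Fin.cons t x := by
      ext j
      refine Fin.cases ?_ (fun j => ?_) j <;> rfl
    rw [h2]
    unfold gaussWeight
    rw [Fin.sum_univ_succ]
    simp only [Fin.cons_zero, Fin.cons_succ]
    rw [mul_add, neg_add, Real.exp_add]
    have : -(1 * t ^ 2) = -1 * t ^ 2 := by ring
    rw [this]
    ring
  simp_rw [h1]
  simp_rw [lintegral_const_mul' _ _ ENNReal.ofReal_ne_top]
  rw [lintegral_mul_const _ (by fun_prop), ← ofReal_integral_eq_lintegral_ofReal
    (integrable_exp_neg_mul_sq one_pos) (Filter.Eventually.of_forall fun t => (Real.exp_pos _).le),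
    integral_gaussian, div_one]

/-- The first factor is a power of the full |y|², while the other factors do not involve the first
coordinate and are homogeneous of degree 2 `part κ 1`. So `lintegral_radial` removes the first
factor at the cost of one shifted factorial, and the free coordinate integrates to √π. -/
theorem lintegral_tailPower (n : ℕ) : ∀ κ : Fin n → ℕ, Antitone κ →
    ∫⁻ y : Fin n → ℝ, ENNReal.ofReal (tailPower κ y * gaussWeight 1 y) =
      ENNReal.ofReal (√Real.pi ^ n * ∏ j : Fin n, (ascPochhammer ℝ (κ j - part κ (j + 1))).eval
        (((n : ℝ) - j) / 2 + part κ (j + 1))) := by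
  induction n with
  | zero =>
    intro κ _
    simp [tailPower, gaussWeight, volume_pi]
  | succ n ih =>
    intro κ hκ
    have hκ' : Antitone fun j : Fin n => κ j.succ := fun i j hij =>
      hκ (Fin.succ_le_succ_iff.mpr hij)
    have hpart : part (fun j : Fin n => κ j.succ) 0 = part κ 1 := (part_succ κ 0).symm
    simp_rw [tailPower_succ κ]
    have hct := continuous_tailPower fun j : Fin n => κ j.succ
    rw [lintegral_radial (q := part κ 1) (Nat.succ_pos n)
      (f := fun y => tailPower (fun j => κ j.succ) (fun j => y j.succ))
      (hct.comp (by fun_prop)) (fun x => tailPower_nonneg _ _)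
      (fun r x => by rw [← hpart, ← tailPower_smul hκ']; rfl),
      lintegral_gauss_succ hct, ih _ hκ',
      ← ENNReal.ofReal_mul (by positivity), ← ENNReal.ofReal_mul]
    · congr 1
      rw [Fin.prod_univ_succ]
      have h1 : ∀ j : Fin n, (((n + 1 : ℕ) : ℝ) - ((j.succ : Fin (n + 1)) : ℕ)) / 2 =
          ((n : ℝ) - j) / 2 := fun j => by push_cast [Fin.val_succ]; ring
      simp_rw [h1, Fin.val_succ, part_succ κ]
      simp only [Fin.val_zero, Nat.cast_zero, sub_zero, hpart]
      have h2 : part κ 1 = part (fun j : Fin n => κ j.succ) 0 := part_succ κ 0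
      rw [h2, pow_succ]
      ring
    · refine (ascPochhammer_pos _ _ ?_).le
      positivity

/-! ### The spherical polynomial at a corank one projection -/

/-- The Householder reflection along v = e - u exchanges the last basis vector e and u. Its
normalization is |v|² = 2(1 - u_last), so u = e is treated apart. -/
theorem exists_orth_last {m : ℕ} (u : Fin (m + 1) → ℝ) (hu : ∑ i, u i ^ 2 = 1) :
    ∃ K : Orth (m + 1), ∀ i, (K : Mat (m + 1)) i (Fin.last m) = u i := by
  by_cases h1 : u (Fin.last m) = 1
  · refine ⟨1, fun i => ?_⟩
    have h2 : ∑ i : Fin m, u i.castSucc ^ 2 = 0 := by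
      rw [Fin.sum_univ_castSucc, h1] at hu
      linarith
    have h3 := (Finset.sum_eq_zero_iff_of_nonneg fun i _ => sq_nonneg _).mp h2
    refine Fin.lastCases ?_ (fun i => ?_) i
    · simp [h1]
    · have := h3 i (Finset.mem_univ _)
      rw [pow_eq_zero_iff two_ne_zero] at this
      simp [this, one_apply]
  · set e : Fin (m + 1) → ℝ := Pi.single (Fin.last m) 1 with he
    set v : Fin (m + 1) → ℝ := e - u with hv
    set c := 1 - u (Fin.last m) with hc
    have hc0 : c ≠ 0 := fun h => h1 (by rw [hc] at h; linarith)
    have hvv : v ⬝ᵥ v = 2 * c := by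
      have huu : u ⬝ᵥ u = 1 := by rw [← hu]; simp [dotProduct, sq]
      rw [hv, sub_dotProduct, dotProduct_sub, dotProduct_sub, huu]
      simp [he]
      ring
    have hK : (1 - c⁻¹ • vecMulVec v v) * (1 - c⁻¹ • vecMulVec v v)ᵀ = (1 : Mat (m + 1)) := by
      rw [transpose_sub, transpose_smul, transpose_vecMulVec, transpose_one]
      have hVV : vecMulVec v v * vecMulVec v v = (2 * c) • vecMulVec v v := by
        rw [vecMulVec_mul_vecMulVec, hvv, vecMulVec_smul]
      have hc2 : c⁻¹ • c⁻¹ • (2 * c) • vecMulVec v v = (2 * c⁻¹) • vecMulVec v v := by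
        rw [smul_smul, smul_smul]
        congr 1
        field_simp
      simp only [Matrix.sub_mul, Matrix.mul_sub, Matrix.one_mul, Matrix.mul_one, Matrix.smul_mul,
        Matrix.mul_smul, hVV, hc2, smul_sub]
      module
    refine ⟨⟨1 - c⁻¹ • vecMulVec v v, (mem_orthogonalGroup_iff _ _).mpr hK⟩, fun i => ?_⟩
    have hvl : v (Fin.last m) = c := by simp [hv, he, hc]
    simp only [Matrix.sub_apply, Matrix.smul_apply, vecMulVec_apply, hvl, smul_eq_mul]
    rw [mul_comm (v i), ← mul_assoc, inv_mul_cancel₀ hc0, one_mul, hv, he]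
    simp [one_apply, Pi.single_apply]

theorem exists_orth_last_smul {m : ℕ} (x : Fin (m + 1) → ℝ) :
    ∃ K : Orth (m + 1), x = √(∑ i, x i ^ 2) • fun i => (K : Mat (m + 1)) i (Fin.last m) := by
  have hnn : 0 ≤ ∑ i, x i ^ 2 := Finset.sum_nonneg fun i _ => sq_nonneg _
  by_cases h : ∑ i, x i ^ 2 = 0
  · refine ⟨1, ?_⟩
    have h3 := (Finset.sum_eq_zero_iff_of_nonneg fun i _ => sq_nonneg _).mp h
    rw [h, Real.sqrt_zero, zero_smul]
    ext i
    simpa using h3 i (Finset.mem_univ _)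
  · have hp : 0 < √(∑ i, x i ^ 2) := Real.sqrt_pos.mpr (lt_of_le_of_ne hnn (Ne.symm h))
    obtain ⟨K, hK⟩ := exists_orth_last ((√(∑ i, x i ^ 2))⁻¹ • x) (by
      simp only [Pi.smul_apply, smul_eq_mul, mul_pow, ← Finset.mul_sum, inv_pow, Real.sq_sqrt hnn]
      exact inv_mul_cancel₀ h)
    refine ⟨K, ?_⟩
    simp_rw [hK]
    ext i
    simp only [Pi.smul_apply, smul_eq_mul]
    field_simp

theorem conj_snocMat_one_apply {m : ℕ} (H : Orth (m + 1)) (a b : Fin (m + 1)) :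
    ((H : Mat (m + 1)) * snocMat 1 0 * (H : Mat (m + 1))ᵀ : Mat (m + 1)) a b =
      (1 : Mat (m + 1)) a b -
        (H : Mat (m + 1)) a (Fin.last m) * (H : Mat (m + 1)) b (Fin.last m) := by
  rw [← H.mul_transpose]
  simp [mul_apply, Fin.sum_univ_castSucc, one_apply]

theorem sum_castLE_sq {m : ℕ} (h : Fin (m + 1) → ℝ) (hh : ∑ i, h i ^ 2 = 1) (j : Fin m) :
    1 - ∑ a : Fin (j.castSucc.val + 1),
      h (Fin.castLE (Nat.succ_le_of_lt j.castSucc.isLt) a) ^ 2 =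
      ∑ i ∈ Finset.univ.filter (j ≤ ·), h i.succ ^ 2 := by
  have hinj : Function.Injective (Fin.castLE (Nat.succ_le_of_lt j.castSucc.isLt)) :=
    Fin.castLE_injective _
  rw [← hh, ← Finset.sum_image (f := fun i => h i ^ 2) (s := Finset.univ) (fun a _ b _ e => hinj e),
    ← Finset.sum_image (f := fun i => h i ^ 2) (g := Fin.succ)
      (fun a _ b _ e => Fin.succ_injective _ e), sub_eq_iff_eq_add', ← Finset.sum_union]
  · congr 1
    ext i
    simp only [Finset.mem_univ, Finset.mem_union, Finset.mem_image, true_and, Finset.mem_filter,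
      true_iff]
    by_cases hi : (i : ℕ) ≤ j
    · left
      exact ⟨⟨i, by simp; omega⟩, rfl⟩
    · right
      have hi0 : i ≠ 0 := by rintro rfl; simp at hi
      refine ⟨i.pred hi0, ?_, Fin.succ_pred _ _⟩
      rw [Fin.le_def, Fin.val_pred]
      omega
  · rw [Finset.disjoint_left]
    intro i hi hi'
    simp only [Finset.mem_univ, Finset.mem_image, true_and, Finset.mem_filter] at hi hi'
    obtain ⟨a, rfl⟩ := hi
    obtain ⟨b, hb, hab⟩ := hi'
    have h1 := a.isLt
    have h2 := congrArg Fin.val hab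
    simp only [Fin.val_succ, Fin.val_castLE, Fin.val_castSucc] at h1 h2
    rw [Fin.le_def] at hb
    omega

/-- The conjugated projection is 1 - h hᵀ, where h is the last column of H. Since det(1 - b bᵀ) = 1
- |b|² and |h| = 1, each leading minor is the sum of the squares of the entries of h not yet used.
-/
theorem powerFn_conj_snocMat_one {m : ℕ} {κ : Fin (m + 1) → ℕ} (h0 : κ (Fin.last m) = 0)
    (H : Orth (m + 1)) :
    powerFn κ ((H : Mat (m + 1)) * snocMat 1 0 * (H : Mat (m + 1))ᵀ) =
      tailPower (fun j => κ j.castSucc) fun i => (H : Mat (m + 1)) i.succ (Fin.last m) := by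
  unfold powerFn tailPower
  rw [Fin.prod_univ_castSucc, h0, Nat.zero_sub, pow_zero, mul_one]
  refine Finset.prod_congr rfl fun j _ => ?_
  rw [part_castSucc h0, Fin.val_castSucc]
  congr 1
  have hh : ∑ i, (H : Mat (m + 1)) i (Fin.last m) ^ 2 = 1 := by
    have := congrFun (congrFun H.transpose_mul (Fin.last m)) (Fin.last m)
    simpa [mul_apply, sq] using this
  rw [← sum_castLE_sq _ hh j]
  unfold leadingMinor
  set B : Matrix (Fin (j.castSucc.val + 1)) Unit ℝ := Matrix.of fun a _ =>
    (H : Mat (m + 1)) (Fin.castLE (Nat.succ_le_of_lt j.castSucc.isLt) a) (Fin.last m) with hB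
  have h1 : ((H : Mat (m + 1)) * snocMat 1 0 * (H : Mat (m + 1))ᵀ).submatrix
      (Fin.castLE (Nat.succ_le_of_lt j.castSucc.isLt))
      (Fin.castLE (Nat.succ_le_of_lt j.castSucc.isLt)) = 1 - B * Bᵀ := by
    ext a b
    rw [submatrix_apply, conj_snocMat_one_apply]
    simp [hB, mul_apply, one_apply, (Fin.castLE_injective _).eq_iff]
  rw [h1, det_one_sub_mul_comm, det_unique]
  simp [hB, mul_apply, sq]

theorem lintegral_pi_orth {n : ℕ} (H : Orth n) {f : (Fin n → ℝ) → ENNReal} (hf : Measurable f) :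
    ∫⁻ x, f ((H : Mat n) *ᵥ x) = ∫⁻ x, f x := by
  have h := Real.map_matrix_volume_pi_eq_smul_volume_pi H.isUnit_det.ne_zero
  have hd : |((H : Mat n).det)⁻¹| = 1 := by
    have h1 := congrArg det H.mul_transpose
    rw [det_mul, det_one, det_transpose] at h1
    have h2 : |(H : Mat n).det| * |(H : Mat n).det| = 1 := by rw [← abs_mul, h1, abs_one]
    rw [abs_inv]
    have h3 : |(H : Mat n).det| = 1 := by nlinarith [abs_nonneg (H : Mat n).det]
    rw [h3, inv_one]
  rw [hd, ENNReal.ofReal_one, one_smul] at h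
  conv_rhs => rw [← h]
  rw [lintegral_map hf (LinearMap.continuous_of_finiteDimensional _).measurable]
  simp

theorem gaussWeight_orth {n : ℕ} (H : Orth n) (c : ℝ) (x : Fin n → ℝ) :
    gaussWeight c ((H : Mat n) *ᵥ x) = gaussWeight c x := by
  have h : ∀ y : Fin n → ℝ, ∑ i, y i ^ 2 = y ⬝ᵥ y := fun y => by simp [dotProduct, sq]
  unfold gaussWeight
  rw [h, h, dotProduct_mulVec, vecMul_mulVec, H.transpose_mul, vecMul_one]

/-- The vector x is |x| times the last column of some K in O(m+1). Homogeneity extracts |x|, and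
right invariance absorbs K. -/
theorem integral_tailPower_orth {m : ℕ} {κ : Fin (m + 1) → ℕ} (hκ : Antitone κ)
    (h0 : κ (Fin.last m) = 0) (x : Fin (m + 1) → ℝ) :
    ∫ H : Orth (m + 1), tailPower (fun j => κ j.castSucc)
      (fun i => ((H : Mat (m + 1)) *ᵥ x) i.succ) ∂(orthHaar (m + 1)) =
      (∑ i, x i ^ 2) ^ κ 0 * spherical κ (snocMat 1 0) := by
  have hκ' : Antitone fun j : Fin m => κ j.castSucc := fun i j hij =>
    hκ (Fin.castSucc_le_castSucc_iff.mpr hij)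
  have hp : part (fun j : Fin m => κ j.castSucc) 0 = κ 0 := by
    rw [← part_castSucc h0]; simp [part]
  have hnn : 0 ≤ ∑ i, x i ^ 2 := Finset.sum_nonneg fun i _ => sq_nonneg _
  obtain ⟨K, hK⟩ := exists_orth_last_smul x
  have h1 : ∀ H : Orth (m + 1), tailPower (fun j => κ j.castSucc)
      (fun i => ((H : Mat (m + 1)) *ᵥ x) i.succ) = (∑ i, x i ^ 2) ^ κ 0 *
      powerFn κ (((H * K : Orth (m + 1)) : Mat (m + 1)) * snocMat 1 0 *
        ((H * K : Orth (m + 1)) : Mat (m + 1))ᵀ) := by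
    intro H
    have h2 : (fun i : Fin m => ((H : Mat (m + 1)) *ᵥ x) i.succ) = √(∑ i, x i ^ 2) •
        fun i : Fin m => ((H * K : Orth (m + 1)) : Mat (m + 1)) i.succ (Fin.last m) := by
      ext i
      conv_lhs => rw [hK]
      rw [mulVec_smul]
      rfl
    rw [h2, tailPower_smul hκ', powerFn_conj_snocMat_one h0, hp, pow_mul, Real.sq_sqrt hnn]
  simp_rw [h1]
  rw [integral_const_mul, integral_mul_right_eq_self (μ := orthHaar (m + 1))
    (fun H : Orth (m + 1) => powerFn κ ((H : Mat (m + 1)) * snocMat 1 0 * (H : Mat (m + 1))ᵀ)) K]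
  rfl

/-- One Gaussian integral is computed twice: coordinate by coordinate with `lintegral_tailPower`,
and, after averaging over O(m+1), as the wanted value times the radial integral of |x|^(2 κ 0). -/
theorem spherical_snocMat_one_aux {m : ℕ} {κ : Fin (m + 1) → ℕ} (hκ : Antitone κ)
    (h0 : κ (Fin.last m) = 0) :
    spherical κ (snocMat 1 0) * (ascPochhammer ℝ (κ 0)).eval (((m + 1 : ℕ) : ℝ) / 2) =
      ∏ j : Fin m, (ascPochhammer ℝ (κ j.castSucc - part κ (j + 1))).eval
        (((m : ℝ) - j) / 2 + part κ (j + 1)) := by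
  have hκ' : Antitone fun j : Fin m => κ j.castSucc := fun i j hij =>
    hκ (Fin.castSucc_le_castSucc_iff.mpr hij)
  set κ' : Fin m → ℕ := fun j => κ j.castSucc with hκ'def
  have hPSD : (snocMat (1 : Mat m) 0).PosSemidef := by
    rw [← diagonal_one, snocMat_diagonal]
    refine PosSemidef.diagonal fun i => ?_
    refine Fin.lastCases ?_ (fun i => ?_) i <;> simp
  have hρ := spherical_nonneg κ hPSD
  set ρ := spherical κ (snocMat 1 0)
  have hct := continuous_tailPower κ'
  have hcg := continuous_gaussWeight (n := m + 1) 1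
  have hco := Orth.continuous_coe (m := m + 1)
  have hm : Measurable fun x : Fin (m + 1) → ℝ =>
      ENNReal.ofReal (tailPower κ' (fun i => x i.succ) * gaussWeight 1 x) :=
    ENNReal.measurable_ofReal.comp ((hct.comp (by fun_prop)).mul hcg).measurable
  have hL := lintegral_gauss_succ hct
  have hT := lintegral_tailPower m κ' hκ'
  have hJ : ∫⁻ x : Fin (m + 1) → ℝ,
      ENNReal.ofReal (tailPower κ' (fun i => x i.succ) * gaussWeight 1 x) =
      ∫⁻ x : Fin (m + 1) → ℝ, ENNReal.ofReal (ρ * (∑ i, x i ^ 2) ^ κ 0 * gaussWeight 1 x) := by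
    have h1 : ∀ H : Orth (m + 1), ∫⁻ x : Fin (m + 1) → ℝ,
        ENNReal.ofReal (tailPower κ' (fun i => x i.succ) * gaussWeight 1 x) =
        ∫⁻ x : Fin (m + 1) → ℝ, ENNReal.ofReal
          (tailPower κ' (fun i => ((H : Mat (m + 1)) *ᵥ x) i.succ) * gaussWeight 1 x) := by
      intro H
      rw [← lintegral_pi_orth H hm]
      simp_rw [gaussWeight_orth]
    have h2 : ∫⁻ x : Fin (m + 1) → ℝ,
        ENNReal.ofReal (tailPower κ' (fun i => x i.succ) * gaussWeight 1 x) =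
        ∫⁻ H : Orth (m + 1), (∫⁻ x : Fin (m + 1) → ℝ, ENNReal.ofReal
          (tailPower κ' (fun i => ((H : Mat (m + 1)) *ᵥ x) i.succ) * gaussWeight 1 x))
          ∂(orthHaar (m + 1)) := by
      simp_rw [← h1]
      simp
    have hcont : Continuous fun p : Orth (m + 1) × (Fin (m + 1) → ℝ) =>
        tailPower κ' (fun i => ((p.1 : Mat (m + 1)) *ᵥ p.2) i.succ) := by
      have h3 : Continuous fun p : Orth (m + 1) × (Fin (m + 1) → ℝ) =>
          ((p.1 : Mat (m + 1)) *ᵥ p.2) :=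
        (hco.comp continuous_fst).matrix_mulVec continuous_snd
      exact hct.comp (continuous_pi fun i => (continuous_apply _).comp h3)
    rw [h2, lintegral_lintegral_swap]
    · refine lintegral_congr fun x => ?_
      have h3 : Continuous fun H : Orth (m + 1) =>
          tailPower κ' (fun i => ((H : Mat (m + 1)) *ᵥ x) i.succ) * gaussWeight 1 x :=
        (hcont.comp (Continuous.prodMk_left x)).mul continuous_const
      rw [← ofReal_integral_eq_lintegral_ofReal (integrable_orth h3)
        (Filter.Eventually.of_forall fun H =>
          mul_nonneg (tailPower_nonneg _ _) (Real.exp_pos _).le), integral_mul_const,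
        integral_tailPower_orth hκ h0, mul_comm ρ]
    · refine Measurable.aemeasurable (ENNReal.measurable_ofReal.comp (Continuous.measurable ?_))
      exact hcont.mul (hcg.comp continuous_snd)
  have hR := lintegral_radial (q := 0) (Nat.succ_pos m) (f := fun _ => ρ) continuous_const
    (fun _ => hρ) (fun r x => by simp) (κ 0)
  have hR0 : ∫⁻ x : Fin (m + 1) → ℝ, ENNReal.ofReal (ρ * gaussWeight 1 x) =
      ENNReal.ofReal (ρ * √Real.pi ^ (m + 1)) := by
    have h := lintegral_tailPower (m + 1) 0 antitone_zero
    simp only [tailPower, Pi.zero_apply, part, dite_eq_ite, ite_self, Nat.sub_self, pow_zero,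
      Finset.prod_const_one, one_mul, ascPochhammer_zero, Polynomial.eval_one, mul_one] at h
    simp_rw [ENNReal.ofReal_mul hρ]
    rw [lintegral_const_mul' _ _ ENNReal.ofReal_ne_top, h]
  rw [hL, hT] at hJ
  have hcomm : ∀ x : Fin (m + 1) → ℝ, ρ * (∑ i, x i ^ 2) ^ κ 0 * gaussWeight 1 x =
      (∑ i, x i ^ 2) ^ κ 0 * ρ * gaussWeight 1 x := fun x => by ring
  simp_rw [hcomm] at hJ
  rw [hR, hR0, ← ENNReal.ofReal_mul (by positivity), ← ENNReal.ofReal_mul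
    (ascPochhammer_pos _ _ (by positivity)).le] at hJ
  have hpoch : ∀ j : Fin m, 0 < (ascPochhammer ℝ (κ' j - part κ' (j + 1))).eval
      (((m : ℝ) - j) / 2 + part κ' (j + 1)) := by
    intro j
    refine ascPochhammer_pos _ _ ?_
    have h1 : ((j : ℕ) : ℝ) + 1 ≤ m := by exact_mod_cast j.isLt
    have h2 : (0 : ℝ) ≤ part κ' (j + 1) := Nat.cast_nonneg _
    linarith
  rw [ENNReal.ofReal_eq_ofReal_iff
    (mul_nonneg (by positivity) (mul_nonneg (by positivity)
      (Finset.prod_nonneg fun j _ => (hpoch j).le)))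
    (mul_nonneg (ascPochhammer_pos _ _ (by positivity)).le (by positivity))] at hJ
  simp_rw [part_castSucc h0]
  have hpi : 0 < √Real.pi := Real.sqrt_pos.mpr Real.pi_pos
  have hpi' : √Real.pi ^ (m + 1) ≠ 0 := by positivity
  apply mul_left_cancel₀ hpi'
  rw [pow_succ] at hJ ⊢
  simp only [Nat.cast_zero, add_zero] at hJ
  linear_combination -hJ

theorem ascPochhammer_eval_add (b : ℝ) (k l : ℕ) :
    (ascPochhammer ℝ (k + l)).eval b =
      (ascPochhammer ℝ k).eval b * (ascPochhammer ℝ l).eval (b + k) := by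
  rw [← ascPochhammer_mul, Polynomial.eval_mul, Polynomial.eval_comp]
  simp

/-- The factors of the preceding product complete those of the shifted factorial: (b)_p (b+p)_(q-p)
= (b)_q with b = (m-j)/2 and with p, q consecutive parts. -/
theorem spherical_snocMat_one {m : ℕ} {κ : Fin (m + 1) → ℕ} (hκ : Antitone κ)
    (h0 : κ (Fin.last m) = 0) :
    spherical κ (snocMat 1 0) * shiftedFactorial (((m + 1 : ℕ) : ℝ) / 2) κ =
      shiftedFactorial ((m : ℝ) / 2) fun j => κ j.castSucc := by
  have h := spherical_snocMat_one_aux hκ h0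
  unfold shiftedFactorial
  rw [Fin.prod_univ_succ]
  simp only [Fin.val_zero, Nat.cast_zero, zero_div, sub_zero]
  rw [← mul_assoc, h, ← Finset.prod_mul_distrib]
  refine Finset.prod_congr rfl fun j _ => ?_
  have h1 : part κ (j + 1) = κ j.succ := by
    rw [← part_coe κ j.succ, Fin.val_succ]
  have h2 : κ j.succ ≤ κ j.castSucc := hκ (Fin.castSucc_lt_succ).le
  have h3 : κ j.castSucc = κ j.succ + (κ j.castSucc - κ j.succ) := by omega
  conv_rhs => rw [h3, ascPochhammer_eval_add]
  rw [h1, mul_comm]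
  congr 2
  · push_cast [Fin.val_succ]; ring
  · ring

theorem spherical_snocMat_one_pos {m : ℕ} {κ : Fin (m + 1) → ℕ} (hκ : Antitone κ)
    (h0 : κ (Fin.last m) = 0) : 0 < spherical κ (snocMat (1 : Mat m) 0) := by
  have h := spherical_snocMat_one hκ h0
  have hp : ∀ (n : ℕ) (μ : Fin n → ℕ), 0 < shiftedFactorial ((n : ℝ) / 2) μ := by
    intro n μ
    refine Finset.prod_pos fun j _ => ascPochhammer_pos _ _ ?_
    have h1 : ((j : ℕ) : ℝ) + 1 ≤ n := by exact_mod_cast j.isLt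
    linarith
  have h1 := hp m fun j => κ j.castSucc
  rw [← h] at h1
  exact pos_of_mul_pos_left h1 (hp _ _).le

/-! ### Linear independence of the spherical polynomials -/

theorem mem_partitions {m k : ℕ} {κ : Fin m → ℕ} :
    κ ∈ partitions m k ↔ Antitone κ ∧ weight κ = k := by
  unfold partitions weight
  rw [Finset.mem_filter, Finset.mem_piAntidiag]
  constructor
  · exact fun h => ⟨h.2, h.1.1⟩
  · exact fun h => ⟨⟨h.2, fun i _ => Finset.mem_univ i⟩, h.1⟩

theorem weight_castSucc {m : ℕ} {κ : Fin (m + 1) → ℕ} (h0 : κ (Fin.last m) = 0) :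
    weight (fun j => κ j.castSucc) = weight κ := by
  unfold weight
  rw [Fin.sum_univ_castSucc, h0, add_zero]

theorem weight_add_one {m : ℕ} (κ : Fin m → ℕ) : weight (fun i => κ i + 1) = weight κ + m := by
  unfold weight
  simp [Finset.sum_add_distrib]

theorem antitone_snoc_zero {m : ℕ} {κ : Fin m → ℕ} (hκ : Antitone κ) :
    Antitone (Fin.snoc (α := fun _ => ℕ) κ 0) := by
  intro i j
  refine Fin.lastCases ?_ (fun i => ?_) i <;> refine Fin.lastCases ?_ (fun j => ?_) j
  · simp
  · intro h
    exact absurd h (not_le.mpr (Fin.castSucc_lt_last j))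
  · simp
  · intro h
    simpa using hκ (Fin.castSucc_le_castSucc_iff.mp h)

theorem castSucc_mem_partitions {m k : ℕ} {κ : Fin (m + 1) → ℕ} (h : κ ∈ partitions (m + 1) k)
    (h0 : κ (Fin.last m) = 0) : (fun j : Fin m => κ j.castSucc) ∈ partitions m k := by
  rw [mem_partitions] at h ⊢
  exact ⟨fun i j hij => h.1 (Fin.castSucc_le_castSucc_iff.mpr hij), by rw [weight_castSucc h0, h.2]⟩

theorem snoc_mem_partitions {m k : ℕ} {κ : Fin m → ℕ} (h : κ ∈ partitions m k) :
    (Fin.snoc (α := fun _ => ℕ) κ 0) ∈ partitions (m + 1) k := by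
  rw [mem_partitions] at h ⊢
  refine ⟨antitone_snoc_zero h.1, ?_⟩
  rw [← h.2]
  unfold weight
  simp [Fin.sum_univ_castSucc]

theorem add_one_mem_partitions {m k : ℕ} {κ : Fin m → ℕ} (h : κ ∈ partitions m k) :
    (fun i => κ i + 1) ∈ partitions m (k + m) := by
  rw [mem_partitions] at h ⊢
  exact ⟨fun i j hij => Nat.add_le_add_right (h.1 hij) 1, by rw [weight_add_one, h.2]⟩

theorem sub_one_add_one {m : ℕ} {κ : Fin (m + 1) → ℕ} (hκ : Antitone κ)
    (h0 : κ (Fin.last m) ≠ 0) (i : Fin (m + 1)) : κ i - 1 + 1 = κ i := by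
  have h1 := hκ (Fin.le_last i)
  omega

theorem exists_eq_add_one {m k : ℕ} {κ : Fin (m + 1) → ℕ} (h : κ ∈ partitions (m + 1) k)
    (h0 : κ (Fin.last m) ≠ 0) : ∃ l, k = l + (m + 1) ∧
      (fun i => κ i - 1) ∈ partitions (m + 1) l ∧ κ = fun i => (fun i => κ i - 1) i + 1 := by
  rw [mem_partitions] at h
  have h1 : κ = fun i => (fun i => κ i - 1) i + 1 := funext fun i => (sub_one_add_one h.1 h0 i).symm
  refine ⟨weight fun i => κ i - 1, ?_, ?_, h1⟩
  · rw [← h.2]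
    conv_lhs => rw [h1]
    exact weight_add_one _
  · rw [mem_partitions]
    exact ⟨fun i j hij => Nat.sub_le_sub_right (h.1 hij) 1, rfl⟩

theorem sum_partitions_succ {m k : ℕ} (f : (Fin (m + 1) → ℕ) → ℝ) :
    ∑ κ ∈ partitions (m + 1) k, f κ = ∑ κ ∈ partitions m k, f (Fin.snoc (α := fun _ => ℕ) κ 0) +
      ∑ κ ∈ (partitions (m + 1) k).filter (fun κ => ¬ κ (Fin.last m) = 0), f κ := by
  rw [← Finset.sum_filter_add_sum_filter_not _ (fun κ => κ (Fin.last m) = 0)]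
  congr 1
  symm
  refine Finset.sum_bij' (fun κ _ => Fin.snoc (α := fun _ => ℕ) κ 0)
    (fun κ _ => fun j => κ j.castSucc) ?_ ?_ ?_ ?_ ?_
  · intro κ h
    simp [snoc_mem_partitions h]
  · intro κ h
    rw [Finset.mem_filter] at h
    exact castSucc_mem_partitions h.1 h.2
  · intro κ _
    ext j
    simp
  · intro κ h
    rw [Finset.mem_filter] at h
    ext j
    refine Fin.lastCases ?_ (fun j => ?_) j
    · simp [h.2]
    · simp
  · intro κ _
    rfl

theorem sum_partitions_filter {m k : ℕ} (f : (Fin (m + 1) → ℕ) → ℝ) :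
    ∑ κ ∈ (partitions (m + 1) (k + (m + 1))).filter (fun κ => ¬ κ (Fin.last m) = 0), f κ =
      ∑ κ ∈ partitions (m + 1) k, f fun i => κ i + 1 := by
  symm
  refine Finset.sum_bij' (fun κ _ => fun i => κ i + 1) (fun κ _ => fun i => κ i - 1) ?_ ?_ ?_ ?_ ?_
  · intro κ h
    rw [Finset.mem_filter]
    exact ⟨add_one_mem_partitions h, by simp⟩
  · intro κ h
    rw [Finset.mem_filter] at h
    obtain ⟨l, hl, h1, -⟩ := exists_eq_add_one h.1 h.2
    rwa [Nat.add_right_cancel hl]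
  · intro κ _
    rfl
  · intro κ h
    rw [Finset.mem_filter] at h
    obtain ⟨l, hl, h1, h2⟩ := exists_eq_add_one h.1 h.2
    exact h2.symm
  · intro κ _
    rfl

theorem spherical_snocMat_zero_of_last_ne {m : ℕ} {κ : Fin (m + 1) → ℕ} (hκ : Antitone κ)
    (h0 : κ (Fin.last m) ≠ 0) (y : Fin m → ℝ) : spherical κ (snocMat (diagonal y) 0) = 0 := by
  have h1 : κ = fun i => (fun i => κ i - 1) i + 1 := funext fun i => (sub_one_add_one hκ h0 i).symm
  rw [h1, spherical_add_one, snocMat_diagonal, det_diagonal, Fin.prod_univ_castSucc]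
  simp

theorem spherical_snoc_snocMat {m : ℕ} (κ : Fin m → ℕ) (Y : Mat m) :
    spherical (Fin.snoc (α := fun _ => ℕ) κ 0) (snocMat Y 0) =
      spherical (Fin.snoc (α := fun _ => ℕ) κ 0) (snocMat 1 0) * spherical κ Y := by
  rw [spherical_snocMat (by simp)]
  simp

theorem sum_spherical_restrict {m k : ℕ} {c : (Fin (m + 1) → ℕ) → ℝ} (y : Fin m → ℝ) :
    ∑ κ ∈ partitions (m + 1) k, c κ * spherical κ (snocMat (diagonal y) 0) =
      ∑ κ ∈ partitions m k, c (Fin.snoc (α := fun _ => ℕ) κ 0) *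
        spherical (Fin.snoc (α := fun _ => ℕ) κ 0) (snocMat 1 0) * spherical κ (diagonal y) := by
  rw [sum_partitions_succ, Finset.sum_eq_zero (s := Finset.filter _ _), add_zero]
  · refine Finset.sum_congr rfl fun κ _ => ?_
    rw [spherical_snoc_snocMat, mul_assoc]
  · intro κ h
    rw [Finset.mem_filter, mem_partitions] at h
    rw [spherical_snocMat_zero_of_last_ne h.1.1 h.2, mul_zero]

theorem eq_zero_at_boundary {m : ℕ} {F : Mat (m + 1) → ℝ} (hF : Continuous F)
    (h : ∀ y : Fin (m + 1) → ℝ, (∀ i, 0 < y i) → F (diagonal y) = 0) {y : Fin m → ℝ}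
    (hy : ∀ i, 0 < y i) : F (snocMat (diagonal y) 0) = 0 := by
  have hc : Continuous fun t : ℝ => F (diagonal (Fin.snoc (α := fun _ => ℝ) y t)) := by
    refine hF.comp (Continuous.matrix_diagonal (continuous_pi fun i => ?_))
    refine Fin.lastCases ?_ (fun i => ?_) i
    · simp only [Fin.snoc_last]
      exact continuous_id
    · simpa using continuous_const
  have h1 : Filter.Tendsto (fun t : ℝ => F (diagonal (Fin.snoc (α := fun _ => ℝ) y t)))
      (nhdsWithin 0 (Set.Ioi 0)) (nhds (F (diagonal (Fin.snoc (α := fun _ => ℝ) y 0)))) :=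
    (hc.tendsto 0).mono_left nhdsWithin_le_nhds
  have h2 : (fun t : ℝ => F (diagonal (Fin.snoc (α := fun _ => ℝ) y t)))
      =ᶠ[nhdsWithin 0 (Set.Ioi 0)] fun _ => 0 := by
    filter_upwards [self_mem_nhdsWithin] with t ht
    refine h _ fun i => ?_
    refine Fin.lastCases ?_ (fun i => ?_) i
    · simpa using ht
    · simpa using hy i
  rw [snocMat_diagonal]
  exact tendsto_nhds_unique h1 (tendsto_const_nhds.congr' h2.symm)

theorem continuous_sum_spherical {m : ℕ} (s : Finset (Fin m → ℕ)) (c : (Fin m → ℕ) → ℝ) :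
    Continuous fun Y : Mat m => ∑ κ ∈ s, c κ * spherical κ Y :=
  continuous_finsetSum _ fun κ _ => continuous_const.mul (continuous_spherical κ)

/-- Induction on the size and, within it, on the degree. When the last eigenvalue tends to zero, the
polynomials with nonzero last part vanish, as they contain the determinant, and the others become
nonzero multiples of those in one variable less; so the coefficients of the latter vanish. The
remaining relation is divisible by the determinant, and division lowers the degree. -/
theorem spherical_linearIndependent : ∀ (m k : ℕ) (c : (Fin m → ℕ) → ℝ),
    (∀ y : Fin m → ℝ, (∀ i, 0 < y i) →
      ∑ κ ∈ partitions m k, c κ * spherical κ (diagonal y) = 0) →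
    ∀ κ ∈ partitions m k, c κ = 0 := by
  intro m
  induction m with
  | zero =>
    intro k c h κ hκ
    have h1 : partitions 0 k = {κ} := by
      ext μ
      simp only [Finset.mem_singleton]
      exact ⟨fun _ => Subsingleton.elim _ _, fun e => e ▸ hκ⟩
    have h2 := h 0 (fun i => i.elim0)
    rw [h1, Finset.sum_singleton] at h2
    have h3 : (diagonal (0 : Fin 0 → ℝ)) = 1 := Subsingleton.elim _ _
    rwa [h3, spherical_one, mul_one] at h2
  | succ m ih =>
    intro k
    induction k using Nat.strong_induction_on with
    | _ k ihk =>
      intro c h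
      have hlast : ∀ κ ∈ partitions (m + 1) k, κ (Fin.last m) = 0 → c κ = 0 := by
        intro κ hκ h0
        have h1 := ih k (fun κ => c (Fin.snoc (α := fun _ => ℕ) κ 0) *
          spherical (Fin.snoc (α := fun _ => ℕ) κ 0) (snocMat 1 0)) (fun y hy => by
            have := eq_zero_at_boundary (continuous_sum_spherical (partitions (m + 1) k) c) h hy
            rwa [sum_spherical_restrict] at this) _ (castSucc_mem_partitions hκ h0)
        have h2 : Fin.snoc (α := fun _ => ℕ) (fun j : Fin m => κ j.castSucc) 0 = κ := by
          ext j
          refine Fin.lastCases ?_ (fun j => ?_) j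
          · simp [h0]
          · simp
        simp only [h2] at h1
        exact (mul_eq_zero.mp h1).resolve_right
          (spherical_snocMat_one_pos (mem_partitions.mp hκ).1 h0).ne'
      intro κ hκ
      by_cases h0 : κ (Fin.last m) = 0
      · exact hlast κ hκ h0
      obtain ⟨l, rfl, h1, h2⟩ := exists_eq_add_one hκ h0
      have h3 := ihk l (by omega) (fun κ => c fun i => κ i + 1) (fun y hy => by
        have h4 := h y hy
        rw [sum_partitions_succ, sum_partitions_filter, Finset.sum_eq_zero, zero_add] at h4
        · simp_rw [spherical_add_one, det_diagonal] at h4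
          have h5 : (∏ i, y i) * ∑ κ ∈ partitions (m + 1) l,
              c (fun i => κ i + 1) * spherical κ (diagonal y) = 0 := by
            rw [← h4, Finset.mul_sum]
            refine Finset.sum_congr rfl fun κ _ => by ring
          exact (mul_eq_zero.mp h5).resolve_left (Finset.prod_pos fun i _ => hy i).ne'
        · intro κ hκ
          rw [hlast _ (snoc_mem_partitions hκ) (by simp), zero_mul]) _ h1
      rw [h2]
      exact h3

/-! ### The spherical polynomials span the invariant polynomials -/

/-- A continuous function on the orthogonal group as an element of the ring of such functions. -/
noncomputable def orthEntry {m : ℕ} (i j : Fin m) : C(Orth m, ℝ) :=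
  ⟨fun H => (H : Mat m) i j, (Orth.continuous_coe (m := m)).matrix_elem i j⟩

/-- The generic matrix `H diag(y) Hᵀ`, with `y` as variables and `H` in the coefficients. -/
noncomputable def genericConj (m : ℕ) : Matrix (Fin m) (Fin m) (MvPolynomial (Fin m) C(Orth m, ℝ)) :=
  Matrix.of fun i j => ∑ k, MvPolynomial.C (orthEntry i k * orthEntry j k) * MvPolynomial.X k

/-- The power function of the generic matrix. -/
noncomputable def genericPower {m : ℕ} (κ : Fin m → ℕ) : MvPolynomial (Fin m) C(Orth m, ℝ) :=
  ∏ j : Fin m, ((genericConj m).submatrix (Fin.castLE (Nat.succ_le_of_lt j.isLt))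
    (Fin.castLE (Nat.succ_le_of_lt j.isLt))).det ^ (κ j - part κ (j + 1))

/-- Evaluation of continuous functions on the orthogonal group at a point. -/
noncomputable def evalOrth {m : ℕ} (H : Orth m) : C(Orth m, ℝ) →+* ℝ where
  toFun f := f H
  map_one' := rfl
  map_zero' := rfl
  map_add' _ _ := rfl
  map_mul' _ _ := rfl

theorem eval_genericConj {m : ℕ} (H : Orth m) (y : Fin m → ℝ) (i j : Fin m) :
    MvPolynomial.eval₂Hom (evalOrth H) y (genericConj m i j) =
      ((H : Mat m) * diagonal y * (H : Mat m)ᵀ : Mat m) i j := by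
  simp only [genericConj, of_apply, map_sum, map_mul, MvPolynomial.coe_eval₂Hom,
    MvPolynomial.eval₂_C, MvPolynomial.eval₂_X]
  rw [mul_apply]
  simp only [mul_diagonal, transpose_apply]
  refine Finset.sum_congr rfl fun k _ => ?_
  change (H : Mat m) i k * (H : Mat m) j k * y k = _
  ring

theorem eval_genericPower {m : ℕ} (κ : Fin m → ℕ) (H : Orth m) (y : Fin m → ℝ) :
    MvPolynomial.eval₂Hom (evalOrth H) y (genericPower κ) =
      powerFn κ ((H : Mat m) * diagonal y * (H : Mat m)ᵀ) := by
  unfold genericPower powerFn leadingMinor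
  rw [map_prod]
  refine Finset.prod_congr rfl fun j _ => ?_
  rw [map_pow, RingHom.map_det]
  congr 2
  ext a b
  simp only [RingHom.mapMatrix_apply, map_apply, submatrix_apply, eval_genericConj]

theorem isHomogeneous_genericPower {m : ℕ} {κ : Fin m → ℕ} (hκ : Antitone κ) :
    (genericPower κ).IsHomogeneous (weight κ) := by
  have h1 : weight κ = ∑ j : Fin m, ((j : ℕ) + 1) * (κ j - part κ (j + 1)) := by
    -- The identity of exponents is read off from the power identity at c = 2, by injectivity of
    -- powers of two.
    have h := prod_pow_weight hκ (2 : ℝ)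
    simp_rw [← pow_mul] at h
    rw [Finset.prod_pow_eq_pow_sum] at h
    have h' : 2 ^ (∑ j : Fin m, ((j : ℕ) + 1) * (κ j - part κ (j + 1))) = 2 ^ weight κ := by
      exact_mod_cast h
    exact (Nat.pow_right_injective le_rfl h').symm
  rw [h1]
  refine MvPolynomial.IsHomogeneous.prod _ _ _ fun j _ => MvPolynomial.IsHomogeneous.pow ?_ _
  rw [det_apply]
  refine MvPolynomial.IsHomogeneous.sum _ _ _ fun σ _ => ?_
  have h2 : ∀ i k, MvPolynomial.IsHomogeneous (genericConj m i k) 1 := by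
    intro i k
    change MvPolynomial.IsHomogeneous
      (∑ l, MvPolynomial.C (orthEntry i l * orthEntry k l) * MvPolynomial.X l) 1
    refine MvPolynomial.IsHomogeneous.sum _ _ _ fun l _ => ?_
    exact MvPolynomial.isHomogeneous_C_mul_X _ _
  have h3 : MvPolynomial.IsHomogeneous (∏ i : Fin (j + 1),
      ((genericConj m).submatrix (Fin.castLE (Nat.succ_le_of_lt j.isLt))
        (Fin.castLE (Nat.succ_le_of_lt j.isLt))) (σ i) i) ((j : ℕ) + 1) := by
    have := MvPolynomial.IsHomogeneous.prod (Finset.univ : Finset (Fin (j + 1)))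
      (fun i => ((genericConj m).submatrix (Fin.castLE (Nat.succ_le_of_lt j.isLt))
      (Fin.castLE (Nat.succ_le_of_lt j.isLt))) (σ i) i) (fun _ => 1) fun i _ => h2 _ _
    simpa using this
  rcases Int.units_eq_one_or (Equiv.Perm.sign σ) with h | h <;> rw [h]
  · simpa using h3
  · simpa using h3.neg

/-- The spherical polynomial as a polynomial in the eigenvalues. -/
noncomputable def sphericalPoly {m : ℕ} (κ : Fin m → ℕ) : MvPolynomial (Fin m) ℝ :=
  ∑ s ∈ (genericPower κ).support,
    MvPolynomial.monomial s (∫ H, (genericPower κ).coeff s H ∂(orthHaar m))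

theorem eval_sphericalPoly {m : ℕ} (κ : Fin m → ℕ) (y : Fin m → ℝ) :
    MvPolynomial.eval y (sphericalPoly κ) = spherical κ (diagonal y) := by
  unfold spherical sphericalPoly
  simp_rw [← eval_genericPower, MvPolynomial.coe_eval₂Hom, MvPolynomial.eval₂_eq]
  rw [integral_finsetSum]
  · simp only [map_sum, MvPolynomial.eval_monomial]
    refine Finset.sum_congr rfl fun s _ => ?_
    rw [integral_mul_const, Finsupp.prod]
    rfl
  · intro s _
    exact integrable_orth (((genericPower κ).coeff s).continuous.mul continuous_const)

theorem isHomogeneous_sphericalPoly {m : ℕ} {κ : Fin m → ℕ} (hκ : Antitone κ) :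
    (sphericalPoly κ).IsHomogeneous (weight κ) := by
  refine MvPolynomial.IsHomogeneous.sum _ _ _ fun s hs => ?_
  refine MvPolynomial.isHomogeneous_monomial _ ?_
  by_contra h
  exact MvPolynomial.mem_support_iff.mp hs ((isHomogeneous_genericPower hκ).coeff_eq_zero h)

/-- Antitone exponent vectors determine a symmetric homogeneous polynomial. -/
theorem eq_zero_of_coeff_partitions {m k : ℕ} {p : MvPolynomial (Fin m) ℝ}
    (hh : p.IsHomogeneous k)
    (hs : ∀ (σ : Equiv.Perm (Fin m)) y, MvPolynomial.eval (y ∘ σ) p = MvPolynomial.eval y p)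
    (h : ∀ κ ∈ partitions m k, p.coeff (Finsupp.equivFunOnFinite.symm κ) = 0) : p = 0 := by
  ext s
  rw [MvPolynomial.coeff_zero]
  by_cases hk : s.degree = k
  swap
  · exact hh.coeff_eq_zero hk
  -- Sorting in the dual order rearranges the exponents decreasingly, that is, into a partition.
  set f : Fin m → OrderDual ℕ := fun i => OrderDual.toDual (s i)
  have hmono := Tuple.monotone_sort f
  set σ := Tuple.sort f
  have hanti : Antitone (s ∘ σ) := fun i j hij => hmono hij
  have h1 : MvPolynomial.rename σ p = p := by
    refine MvPolynomial.funext fun y => ?_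
    rw [MvPolynomial.eval_rename, hs]
  have h2 := h (s ∘ σ) (mem_partitions.mpr ⟨hanti, by
    rw [← hk, Finsupp.degree_eq_sum]
    exact Equiv.sum_comp σ s⟩)
  rw [← h2, ← MvPolynomial.coeff_rename_mapDomain σ σ.injective p
    (Finsupp.equivFunOnFinite.symm (s ∘ σ)), h1]
  congr 1
  ext i
  obtain ⟨j, rfl⟩ := σ.surjective i
  rw [Finsupp.mapDomain_apply σ.injective]
  rfl

/-- A dimension count. A symmetric form is determined by its coefficients at partitions, and the
spherical polynomials are independent, so the map from expansion coefficients to coefficients at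
partitions is injective. It acts between spaces of the same finite dimension, hence is surjective.
-/
theorem exists_spherical_expansion {m k : ℕ} {p : MvPolynomial (Fin m) ℝ}
    (hh : p.IsHomogeneous k)
    (hs : ∀ (σ : Equiv.Perm (Fin m)) y, MvPolynomial.eval (y ∘ σ) p = MvPolynomial.eval y p) :
    ∃ c : (Fin m → ℕ) → ℝ, ∀ y, MvPolynomial.eval y p =
      ∑ κ ∈ partitions m k, c κ * spherical κ (diagonal y) := by
  classical
  let P : (partitions m k → ℝ) →ₗ[ℝ] MvPolynomial (Fin m) ℝ :=
    ∑ κ : partitions m k, (LinearMap.proj κ).smulRight (sphericalPoly κ.1)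
  have hP : ∀ c, P c = ∑ κ : partitions m k, c κ • sphericalPoly κ.1 := fun c => by
    simp [P, LinearMap.sum_apply]
  let R : MvPolynomial (Fin m) ℝ →ₗ[ℝ] (partitions m k → ℝ) :=
    LinearMap.pi fun κ => MvPolynomial.lcoeff ℝ (Finsupp.equivFunOnFinite.symm κ.1)
  have heval : ∀ c y, MvPolynomial.eval y (P c) =
      ∑ κ : partitions m k, c κ * spherical κ.1 (diagonal y) := by
    intro c y
    simp only [hP, map_sum, MvPolynomial.smul_eval, eval_sphericalPoly]
  have hPh : ∀ c, (P c).IsHomogeneous k := by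
    intro c
    rw [hP]
    refine MvPolynomial.IsHomogeneous.sum _ _ _ fun κ _ => ?_
    have hκ := mem_partitions.mp κ.2
    rw [MvPolynomial.smul_eq_C_mul]
    have := (isHomogeneous_sphericalPoly hκ.1).C_mul (c κ)
    rwa [hκ.2] at this
  have hPs : ∀ c (σ : Equiv.Perm (Fin m)) y,
      MvPolynomial.eval (y ∘ σ) (P c) = MvPolynomial.eval y (P c) := by
    intro c σ y
    simp only [heval, spherical_diagonal_perm]
  have hR : ∀ q : MvPolynomial (Fin m) ℝ, q.IsHomogeneous k → (∀ (σ : Equiv.Perm (Fin m)) y,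
      MvPolynomial.eval (y ∘ σ) q = MvPolynomial.eval y q) → R q = 0 → q = 0 := by
    intro q hq hqs h
    refine eq_zero_of_coeff_partitions hq hqs fun κ hκ => ?_
    exact congrFun h ⟨κ, hκ⟩
  have hinj : Function.Injective (R ∘ₗ P) := by
    rw [← LinearMap.ker_eq_bot, LinearMap.ker_eq_bot']
    intro c hc
    have h0 : P c = 0 := hR _ (hPh c) (hPs c) hc
    have h1 := spherical_linearIndependent m k (fun κ => if h : κ ∈ partitions m k then c ⟨κ, h⟩ else 0)
      (fun y _ => by
        have h2 := heval c y
        rw [h0, map_zero] at h2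
        rw [h2, ← Finset.sum_coe_sort (partitions m k)]
        refine Finset.sum_congr rfl fun κ _ => by rw [dif_pos κ.2])
    ext κ
    have := h1 κ.1 κ.2
    rwa [dif_pos κ.2] at this
  obtain ⟨c, hc⟩ := LinearMap.injective_iff_surjective.mp hinj (R p)
  have h0 : p - P c = 0 := by
    refine hR _ (hh.sub (hPh c)) (fun σ y => by rw [map_sub, map_sub, hs, hPs]) ?_
    rw [map_sub, sub_eq_zero]
    exact hc.symm
  refine ⟨fun κ => if h : κ ∈ partitions m k then c ⟨κ, h⟩ else 0, fun y => ?_⟩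
  rw [sub_eq_zero.mp h0, heval, ← Finset.sum_coe_sort (partitions m k)]
  refine Finset.sum_congr rfl fun κ _ => by simp only [κ.2, dif_pos]

/-- `f` is, on symmetric matrices, a combination of the spherical polynomials of degree `k`. -/
def IsSphericalSum {m : ℕ} (k : ℕ) (f : Mat m → ℝ) : Prop :=
  ∃ c : (Fin m → ℕ) → ℝ, ∀ Y : Mat m, Y.IsSymm →
    f Y = ∑ κ ∈ partitions m k, c κ * spherical κ Y

theorem isSphericalSum_spherical {m : ℕ} {κ : Fin m → ℕ} (hκ : Antitone κ) :
    IsSphericalSum (weight κ) (spherical κ) := by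
  classical
  refine ⟨fun μ => if μ = κ then 1 else 0, fun Y _ => ?_⟩
  simp [mem_partitions, hκ]

theorem isSphericalSum_zero {m k : ℕ} : IsSphericalSum k (fun _ : Mat m => 0) :=
  ⟨0, fun Y _ => by simp⟩

theorem IsSphericalSum.add {m k : ℕ} {f g : Mat m → ℝ} (hf : IsSphericalSum k f)
    (hg : IsSphericalSum k g) : IsSphericalSum k (fun Y => f Y + g Y) := by
  obtain ⟨c, hc⟩ := hf
  obtain ⟨d, hd⟩ := hg
  refine ⟨c + d, fun Y hY => ?_⟩
  simp only []
  rw [hc Y hY, hd Y hY, ← Finset.sum_add_distrib]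
  refine Finset.sum_congr rfl fun κ _ => by rw [Pi.add_apply, add_mul]

theorem IsSphericalSum.const_mul {m k : ℕ} {f : Mat m → ℝ} (hf : IsSphericalSum k f) (a : ℝ) :
    IsSphericalSum k (fun Y => a * f Y) := by
  obtain ⟨c, hc⟩ := hf
  refine ⟨fun κ => a * c κ, fun Y hY => ?_⟩
  simp only []
  rw [hc Y hY, Finset.mul_sum]
  refine Finset.sum_congr rfl fun κ _ => by rw [mul_assoc]

theorem IsSphericalSum.sum {m k : ℕ} {ι : Type*} (s : Finset ι) {f : ι → Mat m → ℝ}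
    (hf : ∀ i ∈ s, IsSphericalSum k (f i)) : IsSphericalSum k (fun Y => ∑ i ∈ s, f i Y) := by
  classical
  induction s using Finset.induction_on with
  | empty => simpa using isSphericalSum_zero
  | insert a s ha ih =>
    simp only [Finset.sum_insert ha]
    exact (hf a (Finset.mem_insert_self _ _)).add
      (ih fun i hi => hf i (Finset.mem_insert_of_mem hi))

theorem isSphericalSum_trace_mul_spherical {m : ℕ} {κ : Fin m → ℕ} (hκ : Antitone κ) :
    IsSphericalSum (weight κ + 1) (fun Y => Y.trace * spherical κ Y) := by
  have he : ∀ y, MvPolynomial.eval y ((∑ i, MvPolynomial.X i) * sphericalPoly κ) =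
      (diagonal y).trace * spherical κ (diagonal y) := by
    intro y
    rw [map_mul, eval_sphericalPoly, map_sum, trace_diagonal]
    simp
  obtain ⟨c, hc⟩ := exists_spherical_expansion (m := m) (k := weight κ + 1)
    (p := (∑ i, MvPolynomial.X i) * sphericalPoly κ) (by
      rw [add_comm]
      exact (MvPolynomial.IsHomogeneous.sum _ _ _ fun i _ =>
        MvPolynomial.isHomogeneous_X _ i).mul (isHomogeneous_sphericalPoly hκ))
    (fun σ y => by
      rw [he, he, spherical_diagonal_perm, trace_diagonal, trace_diagonal]
      congr 1
      exact Equiv.sum_comp σ y)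
  refine ⟨c, fun Y hY => ?_⟩
  obtain ⟨H, y, rfl⟩ := exists_orth_diagonal hY
  simp only [trace_conj_orth, spherical_orth_left]
  rw [← he, hc]

theorem IsSphericalSum.trace_mul {m k : ℕ} {f : Mat m → ℝ} (hf : IsSphericalSum k f) :
    IsSphericalSum (k + 1) (fun Y => Y.trace * f Y) := by
  obtain ⟨c, hc⟩ := hf
  have h : IsSphericalSum (k + 1) fun Y : Mat m =>
      ∑ κ ∈ partitions m k, c κ * (Y.trace * spherical κ Y) := by
    refine IsSphericalSum.sum _ fun κ hκ => IsSphericalSum.const_mul ?_ _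
    have hκ' := mem_partitions.mp hκ
    rw [← hκ'.2]
    exact isSphericalSum_trace_mul_spherical hκ'.1
  obtain ⟨d, hd⟩ := h
  refine ⟨d, fun Y hY => ?_⟩
  rw [← hd Y hY]
  simp only [hc Y hY, Finset.mul_sum]
  refine Finset.sum_congr rfl fun κ _ => by ring

theorem IsSphericalSum.trace_pow_mul {m k : ℕ} {f : Mat m → ℝ} (hf : IsSphericalSum k f) (l : ℕ) :
    IsSphericalSum (l + k) (fun Y => Y.trace ^ l * f Y) := by
  induction l with
  | zero => simpa using hf
  | succ l ih =>
    have := ih.trace_mul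
    simp_rw [← mul_assoc, ← pow_succ'] at this
    rwa [add_right_comm]

theorem spherical_zero {m : ℕ} (Y : Mat m) : spherical 0 Y = 1 := by
  unfold spherical
  simp [powerFn_zero]

theorem isSphericalSum_trace_pow {m : ℕ} (k : ℕ) :
    IsSphericalSum k (fun Y : Mat m => Y.trace ^ k) := by
  have h := (isSphericalSum_spherical (m := m) (antitone_zero)).trace_pow_mul k
  simpa [spherical_zero, weight] using h

/-! ### Power series on an interval to the right of zero -/

/-- The identities in t used below hold for small positive t only. Once the lower coefficients
vanish, divide by t^k and let t decrease to zero; the series at a fixed s > t dominates. -/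
theorem hasSum_eq_zero_coeff {a : ℕ → ℝ} {ε : ℝ} (hε : 0 < ε)
    (h : ∀ t, 0 < t → t < ε → HasSum (fun k => a k * t ^ k) 0) (k : ℕ) : a k = 0 := by
  induction k using Nat.strong_induction_on with
  | _ k ih =>
    obtain ⟨s, hs0, hs⟩ := exists_between hε
    have hsum := (h s hs0 hs).summable
    have hshift : ∀ t, 0 < t → t < ε → HasSum (fun j => a (j + k) * t ^ j) 0 := by
      intro t ht0 ht
      have h1 := (hasSum_nat_add_iff' k).mpr (h t ht0 ht)
      rw [Finset.sum_eq_zero (fun i hi => by rw [ih i (Finset.mem_range.mp hi), zero_mul]),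
        sub_zero] at h1
      have h2 := h1.mul_left ((t ^ k)⁻¹)
      rw [mul_zero] at h2
      refine h2.congr_fun fun j => ?_
      have : t ^ k ≠ 0 := by positivity
      rw [pow_add]
      field_simp
    have hsum' := (hshift s hs0 hs).summable.norm
    have hlim : Filter.Tendsto (fun t : ℝ => ∑' j, a (j + k) * t ^ j) (nhdsWithin 0 (Set.Ioi 0))
        (nhds (∑' j, a (j + k) * (0 : ℝ) ^ j)) := by
      refine tendsto_tsum_of_dominated_convergence hsum' (fun j => ?_) ?_
      · exact ((continuous_const.mul (continuous_pow j)).tendsto 0).mono_left nhdsWithin_le_nhds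
      · filter_upwards [Ioo_mem_nhdsGT hs0] with t ht j
        rw [norm_mul, norm_mul, norm_pow, norm_pow]
        gcongr
        rw [Real.norm_of_nonneg ht.1.le, Real.norm_of_nonneg hs0.le]
        exact ht.2.le
    have h0 : (fun t : ℝ => ∑' j, a (j + k) * t ^ j) =ᶠ[nhdsWithin 0 (Set.Ioi 0)] fun _ => 0 := by
      filter_upwards [Ioo_mem_nhdsGT hε] with t ht
      exact (hshift t ht.1 ht.2).tsum_eq
    have h1 := tendsto_nhds_unique hlim (tendsto_const_nhds.congr' h0.symm)
    rw [tsum_eq_single 0 (fun j hj => by rw [zero_pow hj, mul_zero])] at h1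
    simpa using h1

theorem hasSum_unique_coeff {a b : ℕ → ℝ} {v : ℝ → ℝ} {ε : ℝ} (hε : 0 < ε)
    (ha : ∀ t, 0 < t → t < ε → HasSum (fun k => a k * t ^ k) (v t))
    (hb : ∀ t, 0 < t → t < ε → HasSum (fun k => b k * t ^ k) (v t)) (k : ℕ) : a k = b k := by
  refine sub_eq_zero.mp (hasSum_eq_zero_coeff (a := fun k => a k - b k) hε (fun t h0 h1 => ?_) k)
  simpa only [sub_mul, sub_self] using (ha t h0 h1).sub (hb t h0 h1)

theorem hasSum_coeff_mul {f g : PowerSeries ℝ} {t x y : ℝ}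
    (hf : HasSum (fun k => PowerSeries.coeff k f * t ^ k) x)
    (hg : HasSum (fun k => PowerSeries.coeff k g * t ^ k) y) :
    HasSum (fun k => PowerSeries.coeff k (f * g) * t ^ k) (x * y) := by
  have h1 := summable_norm_sum_mul_antidiagonal_of_summable_norm hf.summable.norm hg.summable.norm
  have h2 := tsum_mul_tsum_eq_tsum_sum_antidiagonal_of_summable_norm hf.summable.norm
    hg.summable.norm
  have h3 : ∀ k, PowerSeries.coeff k (f * g) * t ^ k = ∑ kl ∈ Finset.HasAntidiagonal.antidiagonal k,
      PowerSeries.coeff kl.1 f * t ^ kl.1 * (PowerSeries.coeff kl.2 g * t ^ kl.2) := by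
    intro k
    rw [PowerSeries.coeff_mul, Finset.sum_mul]
    refine Finset.sum_congr rfl fun kl hkl => ?_
    rw [← Finset.HasAntidiagonal.mem_antidiagonal.mp hkl, pow_add]
    ring
  simp_rw [h3]
  rw [hf.tsum_eq, hg.tsum_eq] at h2
  rw [h2]
  exact h1.of_norm.hasSum

theorem hasSum_coeff_polynomial (p : Polynomial ℝ) (t : ℝ) :
    HasSum (fun k => PowerSeries.coeff k (p : PowerSeries ℝ) * t ^ k) (p.eval t) := by
  rw [Polynomial.eval_eq_sum_range]
  simp_rw [Polynomial.coeff_coe]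
  refine hasSum_sum_of_ne_finset_zero fun k hk => ?_
  rw [Polynomial.coeff_eq_zero_of_natDegree_lt, zero_mul]
  simpa using hk

/-- The polynomial `det (1 + t diag(y))` in `t`. -/
noncomputable def detPoly {m : ℕ} (y : Fin m → ℝ) : Polynomial ℝ :=
  ∏ i, (1 + Polynomial.C (y i) * Polynomial.X)

theorem eval_detPoly {m : ℕ} (y : Fin m → ℝ) (t : ℝ) :
    (detPoly y).eval t = ∏ i, (1 + t * y i) := by
  unfold detPoly
  rw [Polynomial.eval_prod]
  refine Finset.prod_congr rfl fun i _ => ?_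
  rw [Polynomial.eval_add, Polynomial.eval_one, Polynomial.eval_C_mul, Polynomial.eval_X, mul_comm]

theorem reflect_one_add_C_mul_X {z : ℝ} (hz : z ≠ 0) :
    (1 + Polynomial.C z * Polynomial.X).reflect 1 =
      Polynomial.C z * (1 + Polynomial.C z⁻¹ * Polynomial.X) := by
  have h1 : (Polynomial.C z * Polynomial.X).reflect 1 = Polynomial.C z := by
    simp
  have h2 : (1 : Polynomial ℝ).reflect 1 = Polynomial.X := by
    rw [← Polynomial.C_1, Polynomial.reflect_C]
    simp
  have h3 : Polynomial.C z * Polynomial.C z⁻¹ = 1 := by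
    rw [← Polynomial.C_mul, mul_inv_cancel₀ hz, Polynomial.C_1]
  rw [Polynomial.reflect_add, h1, h2]
  linear_combination (-Polynomial.X) * h3

/-- Reversing coefficients is multiplicative as long as the nominal degrees add, and the factor 1 +
zX reverses to z(1 + z⁻¹X). -/
theorem reflect_detPoly_pow {m : ℕ} {y : Fin m → ℝ} (hy : ∀ i, 0 < y i) (N : ℕ) :
    ((detPoly y) ^ N).reflect (m * N) =
      Polynomial.C ((∏ i, y i) ^ N) * (detPoly fun i => (y i)⁻¹) ^ N := by
  have hdeg : ∀ z : ℝ, (1 + Polynomial.C z * Polynomial.X).natDegree ≤ 1 := fun z => by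
    compute_degree
  have h1 : ∀ s : Finset (Fin m), (∏ i ∈ s, (1 + Polynomial.C (y i) * Polynomial.X)).natDegree ≤
      s.card ∧ (∏ i ∈ s, (1 + Polynomial.C (y i) * Polynomial.X)).reflect s.card =
      ∏ i ∈ s, (Polynomial.C (y i) * (1 + Polynomial.C (y i)⁻¹ * Polynomial.X)) := by
    classical
    intro s
    induction s using Finset.induction_on with
    | empty => simp
    | insert a s ha ih =>
      rw [Finset.prod_insert ha, Finset.prod_insert ha, Finset.card_insert_of_notMem ha,
        Nat.add_comm s.card 1]
      refine ⟨(Polynomial.natDegree_mul_le).trans (add_le_add (hdeg _) ih.1), ?_⟩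
      rw [Polynomial.reflect_mul _ _ (hdeg _) ih.1, ih.2, reflect_one_add_C_mul_X (hy a).ne']
  have h2 := h1 Finset.univ
  rw [Finset.card_fin, Finset.prod_mul_distrib, ← map_prod] at h2
  change (detPoly y).natDegree ≤ m ∧ (detPoly y).reflect m = _ at h2
  have h3 : ((detPoly y) ^ N).natDegree ≤ m * N ∧ ((detPoly y) ^ N).reflect (m * N) =
      (Polynomial.C (∏ i, y i) * (detPoly fun i => (y i)⁻¹)) ^ N := by
    induction N with
    | zero => simp
    | succ N ih =>
      rw [pow_succ, pow_succ, Nat.mul_succ]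
      refine ⟨(Polynomial.natDegree_mul_le).trans (add_le_add ih.1 h2.1), ?_⟩
      rw [Polynomial.reflect_mul _ _ ih.1 h2.1, ih.2]
      congr 1
      exact h2.2
  rw [h3.2, mul_pow, Polynomial.C_pow]

theorem coeff_detPoly_pow {m : ℕ} {y : Fin m → ℝ} (hy : ∀ i, 0 < y i) {N k : ℕ} (hk : k ≤ m * N) :
    ((detPoly y) ^ N).coeff k =
      (∏ i, y i) ^ N * ((detPoly fun i => (y i)⁻¹) ^ N).coeff (m * N - k) := by
  have h := congrArg (fun p => Polynomial.coeff p (m * N - k)) (reflect_detPoly_pow hy N)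
  simp only [Polynomial.coeff_reflect, Polynomial.coeff_C_mul] at h
  rwa [Polynomial.revAt_le (Nat.sub_le _ _), Nat.sub_sub_self hk] at h

/-- If the negative powers `D^{-M}`, for large `M`, have coefficients polynomial in `M`, then so
have the positive powers, with the same polynomials. -/
theorem coeff_pow_eq_eval_neg {D : PowerSeries ℝ} {p : ℕ → Polynomial ℝ} {P : ℕ → PowerSeries ℝ}
    (hp : (p 0).eval 0 = 1) (hp' : ∀ k, k ≠ 0 → (p k).eval 0 = 0) {M₀ : ℕ}
    (hP : ∀ M, M₀ ≤ M → D ^ M * P M = 1)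
    (hc : ∀ M, M₀ ≤ M → ∀ k, PowerSeries.coeff k (P M) = (p k).eval (M : ℝ)) (N k : ℕ) :
    PowerSeries.coeff k (D ^ N) = (p k).eval (-(N : ℝ)) := by
  -- Both sides are inverse to D^M.
  have h1 : ∀ M, M₀ ≤ M → P M = D ^ N * P (M + N) := by
    intro M hM
    have h2 := hP M hM
    have h3 := hP (M + N) (by omega)
    calc P M = P M * (D ^ (M + N) * P (M + N)) := by rw [h3, mul_one]
      _ = (D ^ M * P M) * (D ^ N * P (M + N)) := by rw [pow_add]; ring
      _ = _ := by rw [h2, one_mul]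
  -- The k-th coefficients agree at infinitely many integers M, hence as polynomials in M. At M = -N
  -- every shifted polynomial is evaluated at zero, where only the one of degree index 0 survives.
  have h2 : p k = ∑ ij ∈ Finset.HasAntidiagonal.antidiagonal k, Polynomial.C (PowerSeries.coeff ij.1 (D ^ N)) *
      (p ij.2).comp (Polynomial.X + Polynomial.C (N : ℝ)) := by
    refine Polynomial.eq_of_infinite_eval_eq _ _ ?_
    refine Set.Infinite.mono (s := (fun M : ℕ => (M : ℝ)) '' Set.Ici M₀) ?_
      ((Set.Ici_infinite M₀).image Nat.cast_injective.injOn)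
    rintro _ ⟨M, hM, rfl⟩
    rw [Set.mem_ofPred_eq]
    simp only []
    rw [← hc M hM k, h1 M hM, PowerSeries.coeff_mul, Polynomial.eval_finsetSum]
    refine Finset.sum_congr rfl fun ij _ => ?_
    rw [hc (M + N) (le_trans hM (Nat.le_add_right _ _)), Polynomial.eval_mul, Polynomial.eval_C,
      Polynomial.eval_comp]
    simp
  rw [h2, Polynomial.eval_finsetSum, Finset.sum_eq_single (k, 0)]
  · simp [Polynomial.eval_comp, hp]
  · rintro ⟨i, j⟩ hij hne
    have : j ≠ 0 := by
      rintro rfl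
      rw [Finset.HasAntidiagonal.mem_antidiagonal] at hij
      simp only [add_zero] at hij
      exact hne (by rw [hij])
    simp [Polynomial.eval_comp, hp' j this]
  · intro h
    exact absurd (Finset.HasAntidiagonal.mem_antidiagonal.mpr (add_zero k)) h

/-! ### Expansions under the Wishart integral -/

/-- Dominated convergence: the bounds sum to C exp((r+s) tr T), which is Wishart integrable because
r + s < 1. -/
theorem hasSum_integral_wishart_exp {m : ℕ} {a : ℝ} (ha : ((m : ℝ) - 1) / 2 < a)
    {F : ℕ → Mat m → ℝ} (hF : ∀ k, AEStronglyMeasurable (F k) (wishart a (1 : Mat m)))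
    {C r s : ℝ} (hr : r + s < 1)
    (hb : ∀ k (T : Mat m), T.PosDef →
      |F k T| ≤ C * ((r * T.trace) ^ k / (Nat.factorial k : ℝ)) * Real.exp (s * T.trace))
    {f : Mat m → ℝ} (hf : ∀ T : Mat m, T.PosDef → HasSum (fun k => F k T) (f T)) :
    HasSum (fun k => ∫ T, F k T ∂(wishart a (1 : Mat m))) (∫ T, f T ∂(wishart a (1 : Mat m))) := by
  have hs : ∀ T : Mat m, HasSum
      (fun k => C * ((r * T.trace) ^ k / (Nat.factorial k : ℝ)) * Real.exp (s * T.trace))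
      (C * Real.exp ((r + s) * T.trace)) := by
    intro T
    have h := ((NormedSpace.expSeries_div_hasSum_exp (r * T.trace)).mul_left C).mul_right
      (Real.exp (s * T.trace))
    rwa [← Real.exp_eq_exp_ℝ, mul_assoc C, ← Real.exp_add, ← add_mul] at h
  refine hasSum_integral_of_dominated_convergence
    (fun k T => C * ((r * T.trace) ^ k / (Nat.factorial k : ℝ)) * Real.exp (s * T.trace))
    hF (fun k => ?_) ?_ ?_ ?_
  · filter_upwards [ae_posDef_wishart a] with T hT using hb k T hT
  · exact Filter.Eventually.of_forall fun T => (hs T).summable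
  · simp_rw [fun T => (hs T).tsum_eq]
    exact (integrable_wishart_exp_trace ha hr).const_mul C
  · filter_upwards [ae_posDef_wishart a] with T hT using hf T hT

theorem hasSum_integral_wishart {m : ℕ} {a : ℝ} (ha : ((m : ℝ) - 1) / 2 < a)
    {F : ℕ → Mat m → ℝ} (hF : ∀ k, AEStronglyMeasurable (F k) (wishart a (1 : Mat m)))
    {C r : ℝ} (hr : r < 1)
    (hb : ∀ k (T : Mat m), T.PosDef → |F k T| ≤ C * ((r * T.trace) ^ k / (Nat.factorial k : ℝ)))
    {f : Mat m → ℝ} (hf : ∀ T : Mat m, T.PosDef → HasSum (fun k => F k T) (f T)) :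
    HasSum (fun k => ∫ T, F k T ∂(wishart a (1 : Mat m))) (∫ T, f T ∂(wishart a (1 : Mat m))) :=
  hasSum_integral_wishart_exp ha hF (C := C) (r := r) (s := 0) (by linarith)
    (fun k T hT => by rw [zero_mul, Real.exp_zero, mul_one]; exact hb k T hT) hf

/-! ### Trace powers in the spherical basis and powers of det(1 + tD) -/

theorem exists_trace_pow_expansion (m k : ℕ) : ∃ c : (Fin m → ℕ) → ℝ, ∀ Y : Mat m, Y.IsSymm →
    Y.trace ^ k = ∑ κ ∈ partitions m k, c κ * spherical κ Y :=
  isSphericalSum_trace_pow k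

/-- The coefficients of `(tr Y)^k` with respect to the spherical polynomials. -/
noncomputable def traceCoeff {m : ℕ} (κ : Fin m → ℕ) : ℝ :=
  (exists_trace_pow_expansion m (weight κ)).choose κ

theorem trace_pow_eq {m : ℕ} (k : ℕ) {Y : Mat m} (hY : Y.IsSymm) :
    Y.trace ^ k = ∑ κ ∈ partitions m k, traceCoeff κ * spherical κ Y := by
  rw [(exists_trace_pow_expansion m k).choose_spec Y hY]
  refine Finset.sum_congr rfl fun κ hκ => ?_
  obtain ⟨-, rfl⟩ := mem_partitions.mp hκ
  rfl

theorem integral_trace_pow_wishart {m : ℕ} {a : ℝ} (ha : ((m : ℝ) - 1) / 2 < a) (k : ℕ)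
    (A : Mat m) :
    ∫ T, (A * T * Aᵀ).trace ^ k ∂(wishart a (1 : Mat m)) =
      ∑ κ ∈ partitions m k, traceCoeff κ * shiftedFactorial a κ * spherical κ (A * Aᵀ) := by
  have h1 : ∀ᵐ T ∂(wishart a (1 : Mat m)), (A * T * Aᵀ).trace ^ k =
      ∑ κ ∈ partitions m k, traceCoeff κ * spherical κ (A * T * Aᵀ) := by
    filter_upwards [ae_posDef_wishart a] with T hT
    exact trace_pow_eq k (IsSymm.conj (PosDef.isSymm hT) A)
  rw [integral_congr_ae h1, integral_finsetSum]
  · refine Finset.sum_congr rfl fun κ hκ => ?_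
    rw [integral_const_mul, integral_spherical_conj_wishart ha (mem_partitions.mp hκ).1, mul_assoc]
  · intro κ hκ
    exact (integrable_spherical_conj_wishart ha (mem_partitions.mp hκ).1 A).const_mul _

/-- The diagonal matrix with entries `√(y i)`. -/
noncomputable def sqrtDiag {m : ℕ} (y : Fin m → ℝ) : Mat m := diagonal fun i => √(y i)

theorem sqrtDiag_mul_transpose {m : ℕ} {y : Fin m → ℝ} (hy : ∀ i, 0 < y i) :
    sqrtDiag y * (sqrtDiag y)ᵀ = diagonal y := by
  rw [sqrtDiag, diagonal_transpose, diagonal_mul_diagonal]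
  congr 1
  ext i
  exact Real.mul_self_sqrt (hy i).le

theorem trace_sqrtDiag_conj {m : ℕ} {y : Fin m → ℝ} (hy : ∀ i, 0 < y i) (T : Mat m) :
    (sqrtDiag y * T * (sqrtDiag y)ᵀ).trace = (diagonal y * T).trace := by
  rw [trace_mul_comm, ← Matrix.mul_assoc]
  congr 2
  rw [sqrtDiag, diagonal_transpose, diagonal_mul_diagonal]
  congr 1
  ext i
  exact Real.mul_self_sqrt (hy i).le

/-- A constant with `tr (A T Aᵀ) ≤ conjBound A * tr T` for positive semidefinite `T`. -/
noncomputable def conjBound {m : ℕ} (A : Mat m) : ℝ := ∑ i, ∑ j, |(Aᵀ * A) i j|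

theorem conjBound_nonneg {m : ℕ} (A : Mat m) : 0 ≤ conjBound A :=
  Finset.sum_nonneg fun _ _ => Finset.sum_nonneg fun _ _ => abs_nonneg _

theorem exists_pos_mul_lt (R : ℝ) {s : ℝ} (hs : 0 < s) : ∃ ε > 0, ∀ t, 0 < t → t < ε → t * R < s := by
  refine ⟨s / (|R| + 1), by positivity, fun t h0 h1 => ?_⟩
  rw [lt_div_iff₀ (by positivity)] at h1
  nlinarith [le_abs_self R, abs_nonneg R]

theorem integral_exp_trace_wishart {m : ℕ} {a : ℝ} (ha : ((m : ℝ) - 1) / 2 < a) {y : Fin m → ℝ}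
    (hy : ∀ i, 0 < y i) {t : ℝ} (ht : 0 ≤ t) :
    ∫ T, Real.exp (-t * (sqrtDiag y * T * (sqrtDiag y)ᵀ).trace) ∂(wishart a (1 : Mat m)) =
      (∏ i, (1 + t * y i)) ^ (-a) := by
  have := isProbabilityMeasure_wishart (m := m) ha
  have hz : ∀ i, 0 < 1 + t * y i := fun i => by have := mul_nonneg ht (hy i).le; linarith
  have h := integral_wishart_diagonal ha hz (fun _ => 1)
  simp only [mul_one, integral_const, probReal_univ, smul_eq_mul] at h
  rw [← h]
  refine integral_congr_ae (Filter.Eventually.of_forall fun T => ?_)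
  simp only [etr]
  congr 1
  have h1 : (1 : Mat m) - diagonal (fun i => 1 + t * y i) = (-t) • diagonal y := by
    rw [← diagonal_one, ← diagonal_smul, diagonal_sub]
    congr 1
    ext i
    simp
  rw [h1, trace_sqrtDiag_conj hy, smul_mul, trace_smul, smul_eq_mul]

/-- The determinant power is the Wishart integral of exp(-t tr(DT)), with D = diag(y); the
exponential series is integrated termwise for small t. The point is that the coefficients depend
polynomially on a, through [a]_κ alone. -/
theorem hasSum_det_rpow {m : ℕ} {a : ℝ} (ha : ((m : ℝ) - 1) / 2 < a) {y : Fin m → ℝ}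
    (hy : ∀ i, 0 < y i) : ∃ ε > 0, ∀ t, 0 < t → t < ε →
    HasSum (fun k => ((-1) ^ k / (Nat.factorial k : ℝ) * ∑ κ ∈ partitions m k,
      traceCoeff κ * shiftedFactorial a κ * spherical κ (diagonal y)) * t ^ k)
      ((∏ i, (1 + t * y i)) ^ (-a)) := by
  obtain ⟨ε, hε, h⟩ := exists_pos_mul_lt (conjBound (sqrtDiag y)) one_pos
  refine ⟨ε, hε, fun t ht0 ht => ?_⟩
  rw [← integral_exp_trace_wishart ha hy ht0.le]
  have h1 := hasSum_integral_wishart ha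
    (F := fun k T => (-1) ^ k / (Nat.factorial k : ℝ) * t ^ k *
      (sqrtDiag y * T * (sqrtDiag y)ᵀ).trace ^ k)
    (f := fun T => Real.exp (-t * (sqrtDiag y * T * (sqrtDiag y)ᵀ).trace))
    (C := 1) (r := t * conjBound (sqrtDiag y))
    (fun k => Continuous.aestronglyMeasurable (by fun_prop)) (h t ht0 ht)
    (fun k T hT => by
      have h2 := (posSemidef_conj hT.posSemidef (sqrtDiag y)).trace_nonneg
      have h3 := trace_conj_le (sqrtDiag y) hT.posSemidef
      have h4 : (sqrtDiag y * T * (sqrtDiag y)ᵀ).trace ^ k ≤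
          (conjBound (sqrtDiag y) * T.trace) ^ k := pow_le_pow_left₀ h2 h3 k
      have h5 : |(-1 : ℝ) ^ k| = 1 := by rw [abs_pow, abs_neg, abs_one, one_pow]
      rw [abs_mul, abs_mul, abs_div, h5, abs_of_nonneg (pow_nonneg h2 k),
        abs_of_pos (pow_pos ht0 k), Nat.abs_cast, one_mul, mul_assoc t, mul_pow, div_mul_eq_mul_div,
        one_mul, div_mul_eq_mul_div]
      gcongr)
    (fun T hT => by
      have h2 := NormedSpace.expSeries_div_hasSum_exp
        (-t * (sqrtDiag y * T * (sqrtDiag y)ᵀ).trace)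
      rw [← Real.exp_eq_exp_ℝ] at h2
      refine h2.congr_fun fun k => ?_
      rw [mul_pow, neg_pow]
      ring)
  refine h1.congr_fun fun k => ?_
  rw [integral_const_mul, integral_trace_pow_wishart ha, sqrtDiag_mul_transpose hy]
  ring

/-- The partitional shifted factorial as a polynomial. -/
noncomputable def shiftedPoly {m : ℕ} (κ : Fin m → ℕ) : Polynomial ℝ :=
  ∏ j : Fin m, (ascPochhammer ℝ (κ j)).comp (Polynomial.X - Polynomial.C ((j : ℝ) / 2))

theorem eval_shiftedPoly {m : ℕ} (κ : Fin m → ℕ) (a : ℝ) :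
    (shiftedPoly κ).eval a = shiftedFactorial a κ := by
  unfold shiftedPoly shiftedFactorial
  rw [Polynomial.eval_prod]
  simp [Polynomial.eval_comp]

theorem shiftedFactorial_zero_left {m k : ℕ} {κ : Fin m → ℕ} (hκ : κ ∈ partitions m k)
    (hk : k ≠ 0) : shiftedFactorial 0 κ = 0 := by
  obtain ⟨h1, h2⟩ := mem_partitions.mp hκ
  cases m with
  | zero => simp [weight] at h2; omega
  | succ m =>
    have h0 : κ 0 ≠ 0 := by
      intro h
      apply hk
      rw [← h2]
      exact Finset.sum_eq_zero fun i _ => Nat.le_zero.mp (h ▸ h1 (Fin.zero_le i))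
    unfold shiftedFactorial
    refine Finset.prod_eq_zero (Finset.mem_univ 0) ?_
    simp [ascPochhammer_ne_zero_eval_zero _ h0]

theorem partitions_zero_right (m : ℕ) : partitions m 0 = {0} := by
  ext κ
  rw [mem_partitions, Finset.mem_singleton]
  constructor
  · rintro ⟨-, h⟩
    ext i
    exact Finset.sum_eq_zero_iff.mp h i (Finset.mem_univ i)
  · rintro rfl
    exact ⟨antitone_zero, by simp [weight]⟩

theorem traceCoeff_zero {m : ℕ} : traceCoeff (0 : Fin m → ℕ) = 1 := by
  have h := trace_pow_eq (m := m) 0 isSymm_one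
  rw [partitions_zero_right, Finset.sum_singleton, spherical_one, mul_one, pow_zero] at h
  exact h.symm

/-- The Wishart expansion covers the negative integral powers of det(1+tD) with exponent at least m
in absolute value. As its coefficients are polynomials in the exponent, `coeff_pow_eq_eval_neg`
continues it to the positive powers. -/
theorem coeff_detPoly_pow_eq {m : ℕ} {y : Fin m → ℝ} (hy : ∀ i, 0 < y i) (N k : ℕ) :
    ((detPoly y) ^ N).coeff k = (-1) ^ k / (Nat.factorial k : ℝ) * ∑ κ ∈ partitions m k,
      traceCoeff κ * shiftedFactorial (-(N : ℝ)) κ * spherical κ (diagonal y) := by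
  let p : ℕ → Polynomial ℝ := fun k => ∑ κ ∈ partitions m k,
    Polynomial.C ((-1) ^ k / (Nat.factorial k : ℝ) * traceCoeff κ * spherical κ (diagonal y)) *
      shiftedPoly κ
  have hp : ∀ k a, (p k).eval a = (-1) ^ k / (Nat.factorial k : ℝ) * ∑ κ ∈ partitions m k,
      traceCoeff κ * shiftedFactorial a κ * spherical κ (diagonal y) := by
    intro k a
    simp only [p]
    rw [Polynomial.eval_finsetSum, Finset.mul_sum]
    refine Finset.sum_congr rfl fun κ _ => ?_
    rw [Polynomial.eval_C_mul, eval_shiftedPoly]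
    ring
  have h1 := coeff_pow_eq_eval_neg (D := (detPoly y : PowerSeries ℝ)) (p := p)
    (P := fun M => PowerSeries.mk fun k => (p k).eval (M : ℝ)) (M₀ := m) ?_ ?_ ?_ ?_ N k
  · rw [hp, ← Polynomial.coe_pow, Polynomial.coeff_coe] at h1
    exact h1
  · rw [hp, partitions_zero_right]
    simp [traceCoeff_zero, spherical_zero, shiftedFactorial]
  · intro k hk
    rw [hp, Finset.sum_eq_zero, mul_zero]
    intro κ hκ
    rw [shiftedFactorial_zero_left hκ hk, mul_zero, zero_mul]
  · intro M hM
    have ha : ((m : ℝ) - 1) / 2 < (M : ℝ) := by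
      have h1 : (m : ℝ) ≤ M := by exact_mod_cast hM
      have h2 : (0 : ℝ) ≤ m := Nat.cast_nonneg m
      linarith
    obtain ⟨ε, hε, h⟩ := hasSum_det_rpow ha hy
    ext k
    refine hasSum_unique_coeff (v := fun _ => 1)
      (a := fun k => PowerSeries.coeff k ((detPoly y : PowerSeries ℝ) ^ M *
        PowerSeries.mk fun k => (p k).eval (M : ℝ)))
      (b := fun k => PowerSeries.coeff k (1 : PowerSeries ℝ)) hε (fun t ht0 ht => ?_) (fun t ht0 ht => ?_) k
    · have h2 : HasSum (fun k => PowerSeries.coeff k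
          (PowerSeries.mk fun k => (p k).eval (M : ℝ)) * t ^ k) ((∏ i, (1 + t * y i)) ^ (-(M : ℝ))) := by
        simp only [PowerSeries.coeff_mk, hp]
        exact h t ht0 ht
      have h3 := hasSum_coeff_polynomial (detPoly y ^ M) t
      have h4 := hasSum_coeff_mul h3 h2
      rw [Polynomial.eval_pow, eval_detPoly, Polynomial.coe_pow] at h4
      have hpos : 0 < ∏ i, (1 + t * y i) := Finset.prod_pos fun i _ => by
        have := mul_pos ht0 (hy i); linarith
      rwa [Real.rpow_neg hpos.le, Real.rpow_natCast, mul_inv_cancel₀ (by positivity)] at h4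
    · have := hasSum_coeff_polynomial 1 t
      simpa using this
  · intro M _ k
    simp

/-! ### Recursions for the coefficients of the trace powers -/

/-- A vanishing last eigenvalue does not change the trace. The restricted expansion in m + 1
variables must therefore coincide with the expansion in m variables. -/
theorem traceCoeff_restrict {m : ℕ} {κ : Fin m → ℕ} (hκ : Antitone κ) :
    traceCoeff (Fin.snoc (α := fun _ => ℕ) κ 0) *
      spherical (Fin.snoc (α := fun _ => ℕ) κ 0) (snocMat 1 0) = traceCoeff κ := by
  have h := spherical_linearIndependent m (weight κ)
    (fun κ => traceCoeff (Fin.snoc (α := fun _ => ℕ) κ 0) *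
      spherical (Fin.snoc (α := fun _ => ℕ) κ 0) (snocMat 1 0) - traceCoeff κ) (fun y _ => by
        have h1 := trace_pow_eq (weight κ) (isSymm_diagonal y)
        have h2 := trace_pow_eq (weight κ)
          (isSymm_diagonal (Fin.snoc (α := fun _ => ℝ) y 0))
        rw [← snocMat_diagonal, sum_spherical_restrict, snocMat_diagonal, trace_diagonal,
          Fin.sum_univ_castSucc] at h2
        rw [trace_diagonal] at h1
        simp only [Fin.snoc_castSucc, Fin.snoc_last, add_zero] at h2
        simp only [sub_mul, Finset.sum_sub_distrib]
        rw [← h1, ← h2, sub_self]) κ (mem_partitions.mpr ⟨hκ, rfl⟩)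
  exact sub_eq_zero.mp h

theorem complement_complement {m N : ℕ} {κ : Fin m → ℕ} (hN : ∀ i, κ i ≤ N) :
    complement N (complement N κ) = κ := by
  ext i
  simp only [complement, Fin.rev_rev]
  exact Nat.sub_sub_self (hN i)

theorem weight_complement {m N : ℕ} {κ : Fin m → ℕ} (hN : ∀ i, κ i ≤ N) :
    weight (complement N κ) = m * N - weight κ := by
  have h : weight (complement N κ) + weight κ = m * N := by
    unfold weight complement
    have h1 : ∑ i : Fin m, (N - κ i.rev) = ∑ i, (N - κ i) :=
      Equiv.sum_comp Fin.revPerm fun i => N - κ i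
    rw [h1, ← Finset.sum_add_distrib, Finset.sum_congr rfl fun i _ => Nat.sub_add_cancel (hN i)]
    simp
  omega

theorem complement_le {m N : ℕ} (κ : Fin m → ℕ) (i : Fin m) : complement N κ i ≤ N :=
  Nat.sub_le _ _

theorem complement_mem_partitions {m N k : ℕ} {κ : Fin m → ℕ} (h : κ ∈ partitions m k)
    (hN : ∀ i, κ i ≤ N) : complement N κ ∈ partitions m (m * N - k) := by
  rw [mem_partitions] at h ⊢
  exact ⟨complement_antitone N h.1, by rw [weight_complement hN, h.2]⟩

theorem ascPochhammer_eval_neg_eq_zero {N k : ℕ} (h : N < k) :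
    (ascPochhammer ℝ k).eval (-(N : ℝ)) = 0 := by
  obtain ⟨l, rfl⟩ := Nat.exists_eq_add_of_lt h
  have h1 : N + l + 1 = N + (1 + l) := by ring
  rw [h1, ascPochhammer_eval_add, ascPochhammer_eval_add]
  simp

theorem shiftedFactorial_neg_eq_zero {m k N : ℕ} {κ : Fin m → ℕ} (hκ : κ ∈ partitions m k)
    (h : ¬ ∀ i, κ i ≤ N) : shiftedFactorial (-(N : ℝ)) κ = 0 := by
  obtain ⟨h1, h2⟩ := mem_partitions.mp hκ
  push Not at h
  obtain ⟨i, hi⟩ := h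
  cases m with
  | zero => exact i.elim0
  | succ m =>
    refine Finset.prod_eq_zero (Finset.mem_univ 0) ?_
    simp only [Fin.val_zero, Nat.cast_zero, zero_div, sub_zero]
    exact ascPochhammer_eval_neg_eq_zero (lt_of_lt_of_le hi (h1 (Fin.zero_le i)))

theorem ascPochhammer_eval_ne_zero {b : ℝ} {k : ℕ} (h : ∀ i, i < k → b + i ≠ 0) :
    (ascPochhammer ℝ k).eval b ≠ 0 := by
  induction k with
  | zero => simp
  | succ k ih =>
    rw [ascPochhammer_succ_eval]
    exact mul_ne_zero (ih fun i hi => h i (by omega)) (h k (by omega))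

theorem shiftedFactorial_neg_ne_zero {m N : ℕ} {κ : Fin m → ℕ} (h : ∀ i, κ i ≤ N) :
    shiftedFactorial (-(N : ℝ)) κ ≠ 0 := by
  refine Finset.prod_ne_zero_iff.mpr fun j _ => ?_
  refine ascPochhammer_eval_ne_zero fun i hi => ?_
  have h1 : (i : ℝ) + 1 ≤ N := by exact_mod_cast le_trans hi (h j)
  have h2 : (0 : ℝ) ≤ (j : ℕ) := Nat.cast_nonneg _
  intro h0
  linarith

/-- The coefficient of t^k in det(1+tY)^N is (det Y)^N times that of t^(mN-k) for Y⁻¹. The factor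
[-N]_κ removes the partitions outside the m × N rectangle; for the others, passing to the complement
turns Y⁻¹ back into Y, and linear independence compares coefficients. -/
theorem traceCoeff_complement {m N k : ℕ} {κ : Fin m → ℕ} (hκ : κ ∈ partitions m k)
    (hN : ∀ i, κ i ≤ N) :
    (-1) ^ k / (Nat.factorial k : ℝ) * (traceCoeff κ * shiftedFactorial (-(N : ℝ)) κ) =
      (-1) ^ (m * N - k) / (Nat.factorial (m * N - k) : ℝ) *
        (traceCoeff (complement N κ) * shiftedFactorial (-(N : ℝ)) (complement N κ)) := by
  classical
  have hk : k ≤ m * N := by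
    rw [← (mem_partitions.mp hκ).2]
    calc weight κ ≤ ∑ _ : Fin m, N := Finset.sum_le_sum fun i _ => hN i
      _ = m * N := by simp
  have h := spherical_linearIndependent m k
    (fun κ => if ∀ i, κ i ≤ N then
      (-1) ^ k / (Nat.factorial k : ℝ) * (traceCoeff κ * shiftedFactorial (-(N : ℝ)) κ) -
      (-1) ^ (m * N - k) / (Nat.factorial (m * N - k) : ℝ) *
        (traceCoeff (complement N κ) * shiftedFactorial (-(N : ℝ)) (complement N κ)) else 0)
    (fun y hy => by
      have h1 := coeff_detPoly_pow hy hk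
      rw [coeff_detPoly_pow_eq hy, coeff_detPoly_pow_eq fun i => inv_pos.mpr (hy i)] at h1
      rw [← Finset.sum_filter_add_sum_filter_not _ (fun κ : Fin m → ℕ => ∀ i, κ i ≤ N),
        Finset.sum_eq_zero (s := Finset.filter (fun κ : Fin m → ℕ => ¬ ∀ i, κ i ≤ N) _), add_zero,
        ← Finset.sum_filter_add_sum_filter_not (partitions m (m * N - k))
          (fun κ : Fin m → ℕ => ∀ i, κ i ≤ N), Finset.sum_eq_zero
          (s := Finset.filter (fun κ : Fin m → ℕ => ¬ ∀ i, κ i ≤ N) (partitions m (m * N - k))),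
        add_zero] at h1
      · have h2 : ∑ κ ∈ (partitions m (m * N - k)).filter (fun κ : Fin m → ℕ => ∀ i, κ i ≤ N),
            traceCoeff κ * shiftedFactorial (-(N : ℝ)) κ *
              spherical κ (diagonal fun i => (y i)⁻¹) =
            ∑ κ ∈ (partitions m k).filter (fun κ : Fin m → ℕ => ∀ i, κ i ≤ N),
              traceCoeff (complement N κ) * shiftedFactorial (-(N : ℝ)) (complement N κ) *
              spherical (complement N κ) (diagonal fun i => (y i)⁻¹) := by
          refine Finset.sum_bij' (fun κ _ => complement N κ) (fun κ _ => complement N κ)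
            ?_ ?_ ?_ ?_ ?_
          · intro κ hκ
            rw [Finset.mem_filter] at hκ ⊢
            have := complement_mem_partitions hκ.1 hκ.2
            rw [Nat.sub_sub_self hk] at this
            exact ⟨this, complement_le κ⟩
          · intro κ hκ
            rw [Finset.mem_filter] at hκ ⊢
            exact ⟨complement_mem_partitions hκ.1 hκ.2, complement_le κ⟩
          · intro κ hκ
            exact complement_complement (Finset.mem_filter.mp hκ).2
          · intro κ hκ
            exact complement_complement (Finset.mem_filter.mp hκ).2
          · intro κ hκ
            simp only [complement_complement (Finset.mem_filter.mp hκ).2]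
        rw [h2] at h1
        rw [← Finset.sum_filter_add_sum_filter_not _ (fun κ : Fin m → ℕ => ∀ i, κ i ≤ N),
          Finset.sum_eq_zero (s := Finset.filter (fun κ : Fin m → ℕ => ¬ ∀ i, κ i ≤ N) _),
          add_zero]
        · rw [Finset.mul_sum, Finset.mul_sum, Finset.mul_sum, ← sub_eq_zero,
            ← Finset.sum_sub_distrib] at h1
          rw [← h1]
          refine Finset.sum_congr rfl fun κ hκ => ?_
          rw [Finset.mem_filter] at hκ
          rw [if_pos hκ.2]
          have hinv : (diagonal y)⁻¹ = diagonal fun i => (y i)⁻¹ := by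
            refine Matrix.inv_eq_right_inv ?_
            rw [diagonal_mul_diagonal, ← diagonal_one]
            congr 1
            ext i
            exact mul_inv_cancel₀ (hy i).ne'
          have h3 := spherical_complement (N := N)
            (complement_antitone N (mem_partitions.mp hκ.1).1) (complement_le κ)
            (posDef_diagonal_iff.mpr hy)
          rw [complement_complement hκ.2, det_diagonal, hinv] at h3
          rw [h3]
          ring
        · intro κ hκ
          rw [if_neg (Finset.mem_filter.mp hκ).2, zero_mul]
      · intro κ hκ
        rw [Finset.mem_filter] at hκ
        rw [shiftedFactorial_neg_eq_zero hκ.1 hκ.2, mul_zero, zero_mul]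
      · intro κ hκ
        rw [Finset.mem_filter] at hκ
        rw [shiftedFactorial_neg_eq_zero hκ.1 hκ.2, mul_zero, zero_mul]) κ hκ
  rw [if_pos hN] at h
  exact sub_eq_zero.mp h

theorem shiftedFactorial_add_one {m : ℕ} (a : ℝ) (κ : Fin m → ℕ) :
    shiftedFactorial (a - 1) (fun i => κ i + 1) =
      (∏ j : Fin m, (a - 1 - (j : ℝ) / 2)) * shiftedFactorial a κ := by
  unfold shiftedFactorial
  rw [← Finset.prod_mul_distrib]
  refine Finset.prod_congr rfl fun j _ => ?_
  change (ascPochhammer ℝ (κ j + 1)).eval _ = _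
  rw [Nat.add_comm (κ j) 1, ascPochhammer_eval_add]
  simp only [ascPochhammer_one, Polynomial.eval_X, Nat.cast_one]
  congr 2
  ring

theorem shiftedFactorial_sub_one {m : ℕ} (a : ℝ) (κ : Fin m → ℕ) :
    shiftedFactorial (a - 1) κ * (∏ j : Fin m, (a - 1 - (j : ℝ) / 2 + κ j)) =
      (∏ j : Fin m, (a - 1 - (j : ℝ) / 2)) * shiftedFactorial a κ := by
  rw [← shiftedFactorial_add_one]
  unfold shiftedFactorial
  rw [← Finset.prod_mul_distrib]
  refine Finset.prod_congr rfl fun j _ => ?_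
  rw [ascPochhammer_eval_add]
  simp

/-- The complement of κ in the m × N rectangle is also the complement of κ + 1 in the m × (N+1)
rectangle. The complement formula at N and at N + 1 relates both coefficients to that of the common
complement, which is eliminated. -/
theorem traceCoeff_add_one {m : ℕ} {κ : Fin m → ℕ} (hκ : Antitone κ) :
    traceCoeff (fun i => κ i + 1) * ∏ j : Fin m, ((κ j : ℝ) + 1 + ((m : ℝ) - 1 - j) / 2) =
      traceCoeff κ * ((Nat.factorial (weight κ + m) : ℝ) / Nat.factorial (weight κ)) := by
  obtain ⟨N, hN⟩ : ∃ N, ∀ i, κ i ≤ N := ⟨∑ i, κ i, fun i =>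
    Finset.single_le_sum (f := κ) (fun _ _ => Nat.zero_le _) (Finset.mem_univ i)⟩
  have hmem : κ ∈ partitions m (weight κ) := mem_partitions.mpr ⟨hκ, rfl⟩
  have h1 := traceCoeff_complement hmem hN
  have h2 := traceCoeff_complement (N := N + 1) (add_one_mem_partitions hmem)
    fun i => Nat.add_le_add_right (hN i) 1
  have hc : complement (N + 1) (fun i => κ i + 1) = complement N κ := by
    ext i
    simp [complement]
  have hw : m * (N + 1) - (weight κ + m) = m * N - weight κ := by
    rw [Nat.mul_succ]; omega
  have hcast : (-((N + 1 : ℕ) : ℝ)) = -(N : ℝ) - 1 := by push_cast; ring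
  rw [hc, hw, hcast, shiftedFactorial_add_one] at h2
  have h3 := shiftedFactorial_sub_one (-(N : ℝ)) (complement N κ)
  have hQ : ∏ j : Fin m, (-(N : ℝ) - 1 - (j : ℝ) / 2 + complement N κ j) =
      (-1) ^ m * ∏ j : Fin m, ((κ j : ℝ) + 1 + ((m : ℝ) - 1 - j) / 2) := by
    have h4 : ∀ j : Fin m, -(N : ℝ) - 1 - (j : ℝ) / 2 + complement N κ j =
        (-1) * ((κ j.rev : ℝ) + 1 + ((m : ℝ) - 1 - (j.rev : ℕ)) / 2) := by
      intro j
      unfold complement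
      rw [Nat.cast_sub (hN _), Fin.val_rev, Nat.cast_sub j.isLt]
      push_cast
      ring
    simp_rw [h4]
    rw [Finset.prod_mul_distrib, Finset.prod_const, Finset.card_fin]
    congr 1
    exact Equiv.prod_comp Fin.revPerm
      fun j : Fin m => (κ j : ℝ) + 1 + ((m : ℝ) - 1 - (j : ℕ)) / 2
  rw [hQ] at h3
  have hP : ∏ j : Fin m, (-(N : ℝ) - 1 - (j : ℝ) / 2) ≠ 0 := by
    refine Finset.prod_ne_zero_iff.mpr fun j _ => ?_
    have h5 : (0 : ℝ) ≤ (j : ℕ) := Nat.cast_nonneg _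
    have h6 : (0 : ℝ) ≤ N := Nat.cast_nonneg _
    intro h0
    linarith
  have hS := shiftedFactorial_neg_ne_zero hN
  set P := ∏ j : Fin m, (-(N : ℝ) - 1 - (j : ℝ) / 2)
  set Q := ∏ j : Fin m, ((κ j : ℝ) + 1 + ((m : ℝ) - 1 - j) / 2)
  set S := shiftedFactorial (-(N : ℝ)) κ
  set k := weight κ
  set s := (-1 : ℝ) ^ k with hs
  have hs2 : s ≠ 0 := pow_ne_zero _ (by norm_num)
  have hm2 : ((-1 : ℝ) ^ m) ^ 2 = 1 := by rw [← pow_mul, mul_comm, pow_mul]; norm_num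
  have hf1 : (Nat.factorial k : ℝ) ≠ 0 := by positivity
  have hf2 : (Nat.factorial (k + m) : ℝ) ≠ 0 := by positivity
  rw [pow_add, ← hs] at h2
  set B := (-1 : ℝ) ^ (m * N - k) / (Nat.factorial (m * N - k) : ℝ)
  have h4 : (s / (Nat.factorial k : ℝ) * (traceCoeff κ * S)) * P =
      (s * (-1) ^ m / (Nat.factorial (k + m) : ℝ) *
        (traceCoeff (fun i => κ i + 1) * (P * S))) * ((-1) ^ m * Q) := by
    rw [h1, h2]
    linear_combination (-B * traceCoeff (complement N κ)) * h3
  have h5 : s * P * S ≠ 0 := mul_ne_zero (mul_ne_zero hs2 hP) hS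
  apply mul_left_cancel₀ h5
  field_simp at h4 ⊢
  rw [hm2] at h4
  linear_combination (-1 : ℝ) * h4

/-! ### The value of the zonal polynomials at the identity -/

/-- The quotient in the formula for `zonalOne`, with `L` in place of the length. -/
noncomputable def hookQuotient {m : ℕ} (κ : Fin m → ℕ) (L : ℕ) : ℝ :=
  (∏ j ∈ Finset.range L, ∏ i ∈ Finset.range j,
      (2 * (part κ i : ℝ) - 2 * (part κ j : ℝ) - (i : ℝ) + (j : ℝ))) /
    ∏ i ∈ Finset.range L, (Nat.factorial (2 * part κ i + L - (i + 1)) : ℝ)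

theorem zonalOne_eq_len {m : ℕ} (κ : Fin m → ℕ) : zonalOne κ = 2 ^ (2 * weight κ) *
    (Nat.factorial (weight κ) : ℝ) * shiftedFactorial ((m : ℝ) / 2) κ * hookQuotient κ (len κ) := by
  unfold zonalOne hookQuotient
  rw [mul_div_assoc]

/-- A further zero part multiplies the numerator by the product of 2k_i - i + L, and the factorials
gain exactly these factors. So the length may be replaced by the number m of all parts, which is
easier to carry through an induction. -/
theorem hookQuotient_succ {m : ℕ} (κ : Fin m → ℕ) {L : ℕ} (h : part κ L = 0) :
    hookQuotient κ (L + 1) = hookQuotient κ L := by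
  unfold hookQuotient
  rw [Finset.prod_range_succ, Finset.prod_range_succ (fun i =>
    (Nat.factorial (2 * part κ i + (L + 1) - (i + 1)) : ℝ)), h]
  have h1 : ∏ i ∈ Finset.range L, (Nat.factorial (2 * part κ i + (L + 1) - (i + 1)) : ℝ) =
      (∏ i ∈ Finset.range L, (2 * (part κ i : ℝ) - 2 * ((0 : ℕ) : ℝ) - (i : ℝ) + (L : ℝ))) *
      ∏ i ∈ Finset.range L, (Nat.factorial (2 * part κ i + L - (i + 1)) : ℝ) := by
    rw [← Finset.prod_mul_distrib]
    refine Finset.prod_congr rfl fun i hi => ?_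
    rw [Finset.mem_range] at hi
    have h2 : 2 * part κ i + (L + 1) - (i + 1) = (2 * part κ i + L - (i + 1)) + 1 := by omega
    rw [h2, Nat.factorial_succ]
    push_cast [show i + 1 ≤ 2 * part κ i + L by omega]
    ring
  have h3 : ∏ i ∈ Finset.range L,
      (2 * (part κ i : ℝ) - 2 * ((0 : ℕ) : ℝ) - (i : ℝ) + (L : ℝ)) ≠ 0 := by
    refine Finset.prod_ne_zero_iff.mpr fun i hi => ?_
    rw [Finset.mem_range] at hi
    have h4 : (i : ℝ) + 1 ≤ L := by exact_mod_cast hi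
    have h5 : (0 : ℝ) ≤ part κ i := Nat.cast_nonneg _
    simp only [Nat.cast_zero]
    intro h0
    linarith
  rw [h1]
  simp only [mul_zero, zero_add, Nat.sub_self, Nat.factorial_zero, Nat.cast_one, mul_one]
  rw [mul_comm, mul_div_mul_left _ _ h3]

theorem len_le {m : ℕ} (κ : Fin m → ℕ) : len κ ≤ m := by
  unfold len
  exact (Finset.card_filter_le _ _).trans (by simp)

theorem part_eq_zero_of_len_le {m : ℕ} {κ : Fin m → ℕ} (hκ : Antitone κ) {i : ℕ}
    (h : len κ ≤ i) : part κ i = 0 := by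
  by_contra h0
  have hi : i < m := by
    by_contra hi
    exact h0 (dif_neg hi)
  have h1 : Finset.univ.filter (fun j : Fin m => j ≤ ⟨i, hi⟩) ⊆
      Finset.univ.filter fun j => κ j ≠ 0 := by
    intro j hj
    simp only [Finset.mem_filter, Finset.mem_univ, true_and] at hj ⊢
    have h2 := hκ hj
    have h3 : part κ i = κ ⟨i, hi⟩ := dif_pos hi
    omega
  have h2 := Finset.card_le_card h1
  have h3 : (Finset.univ.filter fun j : Fin m => j ≤ ⟨i, hi⟩) = Finset.Iic ⟨i, hi⟩ := by
    ext; simp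
  rw [h3, Fin.card_Iic] at h2
  unfold len at h
  simp only at h2
  omega

theorem hookQuotient_of_len_le {m : ℕ} {κ : Fin m → ℕ} (hκ : Antitone κ) {L : ℕ}
    (h : len κ ≤ L) : hookQuotient κ L = hookQuotient κ (len κ) := by
  induction L, h using Nat.le_induction with
  | base => rfl
  | succ L hL ih => rw [hookQuotient_succ κ (part_eq_zero_of_len_le hκ hL), ih]

theorem zonalOne_eq {m : ℕ} {κ : Fin m → ℕ} (hκ : Antitone κ) : zonalOne κ = 2 ^ (2 * weight κ) *
    (Nat.factorial (weight κ) : ℝ) * shiftedFactorial ((m : ℝ) / 2) κ * hookQuotient κ m := by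
  rw [zonalOne_eq_len, hookQuotient_of_len_le hκ (len_le κ)]

theorem hookQuotient_castSucc {m : ℕ} {κ : Fin (m + 1) → ℕ}
    (h0 : κ (Fin.last m) = 0) :
    hookQuotient κ (m + 1) = hookQuotient (fun j => κ j.castSucc) m := by
  have h1 : part κ m = 0 := by
    have := part_coe κ (Fin.last m)
    rwa [h0] at this
  rw [hookQuotient_succ κ h1]
  unfold hookQuotient
  simp only [part_castSucc h0]

theorem shiftedFactorial_half_pos {m : ℕ} (κ : Fin m → ℕ) : 0 < shiftedFactorial ((m : ℝ) / 2) κ := by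
  refine Finset.prod_pos fun j _ => ascPochhammer_pos _ _ ?_
  have h1 : ((j : ℕ) : ℝ) + 1 ≤ m := by exact_mod_cast j.isLt
  linarith

theorem zonalOne_restrict {m : ℕ} {κ : Fin m → ℕ} (hκ : Antitone κ) :
    zonalOne (Fin.snoc (α := fun _ => ℕ) κ 0) *
      spherical (Fin.snoc (α := fun _ => ℕ) κ 0) (snocMat 1 0) = zonalOne κ := by
  have hs := antitone_snoc_zero hκ
  have h0 : (Fin.snoc (α := fun _ => ℕ) κ 0 : Fin (m + 1) → ℕ) (Fin.last m) = 0 := by simp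
  have h1 : (fun j : Fin m => (Fin.snoc (α := fun _ => ℕ) κ 0 : Fin (m + 1) → ℕ) j.castSucc) = κ := by
    ext j; simp
  have h2 := spherical_snocMat_one hs h0
  have h3 := hookQuotient_castSucc h0
  have h4 := weight_castSucc h0
  rw [h1] at h2 h3 h4
  rw [zonalOne_eq hs, zonalOne_eq hκ, h3, ← h4, ← h2]
  ring

theorem hookQuotient_add_one {m : ℕ} (κ : Fin m → ℕ) :
    hookQuotient (fun i => κ i + 1) m *
      (∏ j : Fin m, ((2 * (κ j : ℝ) + m - j + 1) * (2 * (κ j : ℝ) + m - j))) = hookQuotient κ m := by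
  unfold hookQuotient
  have hp : ∀ i < m, part (fun i => κ i + 1) i = part κ i + 1 := by
    intro i hi
    simp [part, hi]
  have h1 : ∏ j ∈ Finset.range m, ∏ i ∈ Finset.range j,
      (2 * (part (fun i => κ i + 1) i : ℝ) - 2 * (part (fun i => κ i + 1) j : ℝ) - (i : ℝ) + (j : ℝ)) =
      ∏ j ∈ Finset.range m, ∏ i ∈ Finset.range j,
      (2 * (part κ i : ℝ) - 2 * (part κ j : ℝ) - (i : ℝ) + (j : ℝ)) := by
    refine Finset.prod_congr rfl fun j hj => Finset.prod_congr rfl fun i hi => ?_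
    rw [Finset.mem_range] at hi hj
    rw [hp i (by omega), hp j hj]
    push_cast
    ring
  rw [h1]
  have h2 : ∀ μ : Fin m → ℕ,
      ∏ i ∈ Finset.range m, (Nat.factorial (2 * part μ i + m - (i + 1)) : ℝ) =
      ∏ j : Fin m, (Nat.factorial (2 * μ j + m - (j + 1)) : ℝ) := by
    intro μ
    rw [← Fin.prod_univ_eq_prod_range (fun i => (Nat.factorial (2 * part μ i + m - (i + 1)) : ℝ)) m]
    simp only [part_coe]
  rw [h2, h2, div_mul_eq_mul_div, div_eq_div_iff
    (Finset.prod_ne_zero_iff.mpr fun j _ => by positivity)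
    (Finset.prod_ne_zero_iff.mpr fun j _ => by positivity), mul_assoc, ← Finset.prod_mul_distrib]
  congr 1
  refine Finset.prod_congr rfl fun j _ => ?_
  have hj := j.isLt
  have h3 : 2 * (κ j + 1) + m - (j + 1) = (2 * κ j + m - (j + 1)) + 1 + 1 := by omega
  rw [h3, Nat.factorial_succ, Nat.factorial_succ]
  push_cast [show (j : ℕ) + 1 ≤ 2 * κ j + m by omega]
  ring

/-- The hook quotient loses (2κ_j + m - j + 1)(2κ_j + m - j) for each j. The first factor is twice
the one in the statement, the second is twice the one gained by [m/2]_κ, and the resulting 4^m is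
supplied by the power of two. -/
theorem zonalOne_add_one {m : ℕ} {κ : Fin m → ℕ} (hκ : Antitone κ) :
    zonalOne (fun i => κ i + 1) * ∏ j : Fin m, ((κ j : ℝ) + 1 + ((m : ℝ) - 1 - j) / 2) =
      zonalOne κ * ((Nat.factorial (weight κ + m) : ℝ) / Nat.factorial (weight κ)) := by
  have hκ' : Antitone fun i => κ i + 1 := fun i j hij => Nat.add_le_add_right (hκ hij) 1
  have h1 : shiftedFactorial ((m : ℝ) / 2) (fun i => κ i + 1) =
      shiftedFactorial ((m : ℝ) / 2) κ * ∏ j : Fin m, (((m : ℝ) - j) / 2 + κ j) := by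
    unfold shiftedFactorial
    rw [← Finset.prod_mul_distrib]
    refine Finset.prod_congr rfl fun j _ => ?_
    rw [ascPochhammer_eval_add]
    simp
    ring_nf
    simp
  have h2 : ∏ j : Fin m, ((2 * (κ j : ℝ) + m - j + 1) * (2 * (κ j : ℝ) + m - j)) =
      4 ^ m * (∏ j : Fin m, ((κ j : ℝ) + 1 + ((m : ℝ) - 1 - j) / 2)) *
        ∏ j : Fin m, (((m : ℝ) - j) / 2 + κ j) := by
    have : (4 : ℝ) ^ m = ∏ _ : Fin m, (4 : ℝ) := by simp
    rw [this, ← Finset.prod_mul_distrib, ← Finset.prod_mul_distrib]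
    refine Finset.prod_congr rfl fun j _ => ?_
    ring
  rw [zonalOne_eq hκ', zonalOne_eq hκ, ← hookQuotient_add_one κ, h1, h2, weight_add_one]
  have h3 : (2 : ℝ) ^ (2 * (weight κ + m)) = 2 ^ (2 * weight κ) * 4 ^ m := by
    rw [mul_add, pow_add, pow_mul 2 2 m]
    norm_num
  rw [h3]
  have hf1 : (Nat.factorial (weight κ) : ℝ) ≠ 0 := by positivity
  field_simp

/-- Both families obey the same two recursions, for appending a zero part and for raising all parts
by one, and every partition is reached from the empty one in this way. This confirms that the
explicit constant C_κ(I_m) is the normalization for which the zonal polynomials of degree k sum to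
(tr Y)^k. -/
theorem zonalOne_eq_traceCoeff : ∀ (m k : ℕ) (κ : Fin m → ℕ), κ ∈ partitions m k →
    traceCoeff κ = zonalOne κ := by
  intro m
  induction m with
  | zero =>
    intro k κ _
    have h0 : κ = 0 := Subsingleton.elim _ _
    rw [h0, traceCoeff_zero, zonalOne_eq antitone_zero]
    simp [weight, shiftedFactorial, hookQuotient]
  | succ m ih =>
    intro k
    induction k using Nat.strong_induction_on with
    | _ k ihk =>
      intro κ hκ
      by_cases h0 : κ (Fin.last m) = 0
      · have h1 := castSucc_mem_partitions hκ h0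
        have h2 : Fin.snoc (α := fun _ => ℕ) (fun j : Fin m => κ j.castSucc) 0 = κ := by
          ext j
          refine Fin.lastCases ?_ (fun j => ?_) j
          · simp [h0]
          · simp
        have h3 := traceCoeff_restrict (mem_partitions.mp h1).1
        have h4 := zonalOne_restrict (mem_partitions.mp h1).1
        rw [ih k _ h1, ← h4, h2] at h3
        exact mul_right_cancel₀ (spherical_snocMat_one_pos (mem_partitions.mp hκ).1 h0).ne' h3
      · obtain ⟨l, rfl, h1, h2⟩ := exists_eq_add_one hκ h0
        have h3 := traceCoeff_add_one (mem_partitions.mp h1).1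
        have h4 := zonalOne_add_one (mem_partitions.mp h1).1
        rw [ihk l (by omega) _ h1, ← h4] at h3
        rw [h2]
        refine mul_right_cancel₀ (Finset.prod_ne_zero_iff.mpr fun j _ => ?_) h3
        have h5 : ((j : ℕ) : ℝ) + 1 ≤ ((m + 1 : ℕ) : ℝ) := by exact_mod_cast j.isLt
        have h6 : (0 : ℝ) ≤ ((κ j - 1 : ℕ) : ℝ) := Nat.cast_nonneg _
        intro h7
        linarith

theorem trace_pow_eq_sum_zonal {m : ℕ} (k : ℕ) {Y : Mat m} (hY : Y.IsSymm) :
    Y.trace ^ k = ∑ κ ∈ partitions m k, zonalOne κ * spherical κ Y := by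
  rw [trace_pow_eq k hY]
  exact Finset.sum_congr rfl fun κ hκ => by rw [zonalOne_eq_traceCoeff m k κ hκ]

theorem zonalOne_pos {m : ℕ} {κ : Fin m → ℕ} (hκ : Antitone κ) : 0 < zonalOne κ := by
  rw [zonalOne_eq hκ]
  have h1 := shiftedFactorial_half_pos κ
  have h2 : 0 < hookQuotient κ m := by
    unfold hookQuotient
    refine div_pos (Finset.prod_pos fun j _ => Finset.prod_pos fun i hi => ?_)
      (Finset.prod_pos fun j _ => by positivity)
    rw [Finset.mem_range] at hi
    have h3 : (i : ℝ) + 1 ≤ j := by exact_mod_cast hi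
    have h4 : (part κ j : ℝ) ≤ part κ i := by exact_mod_cast part_antitone hκ hi.le
    linarith
  positivity

/-! ### Convergence of the Bessel series -/

/-- The multinomial coefficient of κ is one of the terms of (1 + ⋯ + 1)^k = m^k. -/
theorem factorial_le_pow_mul_prod {m k : ℕ} {κ : Fin m → ℕ} (hκ : κ ∈ partitions m k) :
    Nat.factorial k ≤ m ^ k * ∏ j, Nat.factorial (κ j) := by
  have hw : ∑ j, κ j = k := (mem_partitions.mp hκ).2
  have h1 := Nat.multinomial_spec Finset.univ κ
  have h2 := Finset.sum_pow_eq_sum_piAntidiag (Finset.univ : Finset (Fin m)) (fun _ => (1 : ℕ)) k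
  simp only [Finset.sum_const, Finset.card_fin, smul_eq_mul, mul_one, one_pow, Finset.prod_const_one,
    Nat.cast_id] at h2
  have h3 : Nat.multinomial Finset.univ κ ≤ m ^ k := by
    rw [h2]
    exact Finset.single_le_sum (f := fun κ : Fin m → ℕ => Nat.multinomial Finset.univ κ)
      (fun _ _ => Nat.zero_le _) (Finset.mem_piAntidiag.mpr ⟨hw, fun i _ => Finset.mem_univ i⟩)
  rw [← hw, ← h1, hw, mul_comm]
  exact Nat.mul_le_mul_right _ h3

theorem ascPochhammer_eval_ge {b c : ℝ} (hc : 0 < c) (hc1 : c ≤ 1) (hb : c ≤ b) (k : ℕ) :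
    c ^ k * (Nat.factorial k : ℝ) ≤ (ascPochhammer ℝ k).eval b := by
  induction k with
  | zero => simp
  | succ k ih =>
    rw [ascPochhammer_succ_eval, Nat.factorial_succ, pow_succ]
    have h1 : c * (k + 1) ≤ b + k := by
      have : c * (k : ℝ) ≤ k := mul_le_of_le_one_left (Nat.cast_nonneg k) hc1
      linarith
    have h2 : c ^ (k : ℕ) * c * (((k + 1) * Nat.factorial k : ℕ) : ℝ) =
        (c ^ k * (Nat.factorial k : ℝ)) * (c * (k + 1)) := by push_cast; ring
    rw [h2]
    exact mul_le_mul ih h1 (by positivity) (le_trans (by positivity) ih)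

/-- A lower bound for all factors of the partitional shifted factorials. -/
noncomputable def shapeGap (m : ℕ) (a : ℝ) : ℝ := min (a - ((m : ℝ) - 1) / 2) 1

theorem shapeGap_pos {m : ℕ} {a : ℝ} (ha : ((m : ℝ) - 1) / 2 < a) : 0 < shapeGap m a :=
  lt_min (by linarith) one_pos

theorem shiftedFactorial_ge {m : ℕ} {a : ℝ} (ha : ((m : ℝ) - 1) / 2 < a) (κ : Fin m → ℕ) :
    shapeGap m a ^ weight κ * ∏ j, (Nat.factorial (κ j) : ℝ) ≤ shiftedFactorial a κ := by
  have hg := shapeGap_pos ha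
  unfold weight shiftedFactorial
  rw [← Finset.prod_pow_eq_pow_sum, ← Finset.prod_mul_distrib]
  refine Finset.prod_le_prod (fun j _ => by positivity) fun j _ => ?_
  refine ascPochhammer_eval_ge hg (min_le_right _ _) ((min_le_left _ _).trans ?_) _
  have h1 : ((j : ℕ) : ℝ) + 1 ≤ m := by exact_mod_cast j.isLt
  linarith

theorem shiftedFactorial_pos {m : ℕ} {a : ℝ} (ha : ((m : ℝ) - 1) / 2 < a) (κ : Fin m → ℕ) :
    0 < shiftedFactorial a κ := by
  have hg := shapeGap_pos ha
  exact lt_of_lt_of_le (by positivity) (shiftedFactorial_ge ha κ)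

/-- This supplies the second factorial in the denominators of the Bessel series, the source of all
growth bounds below. -/
theorem inv_shiftedFactorial_le {m k : ℕ} {a : ℝ} (ha : ((m : ℝ) - 1) / 2 < a) {κ : Fin m → ℕ}
    (hκ : κ ∈ partitions m k) :
    (shiftedFactorial a κ)⁻¹ ≤ (m / shapeGap m a) ^ k / (Nat.factorial k : ℝ) := by
  have hg := shapeGap_pos ha
  have h1 : (Nat.factorial k : ℝ) ≤ (m : ℝ) ^ k * ∏ j, (Nat.factorial (κ j) : ℝ) := by
    exact_mod_cast factorial_le_pow_mul_prod hκ
  have h2 := shiftedFactorial_ge ha κ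
  rw [(mem_partitions.mp hκ).2] at h2
  have hf : (0 : ℝ) < Nat.factorial k := by positivity
  rw [inv_le_comm₀ (shiftedFactorial_pos ha κ) (by
    have hm : (0 : ℝ) < (m : ℝ) ^ k := by
      by_contra h
      have h0 : (m : ℝ) ^ k = 0 := le_antisymm (not_lt.mp h) (by positivity)
      rw [h0, zero_mul] at h1
      linarith
    rw [div_pow]
    positivity), inv_div, div_pow, div_div_eq_mul_div]
  refine le_trans ?_ h2
  have hm : (0 : ℝ) < (m : ℝ) ^ k := by
    by_contra h
    have h0 : (m : ℝ) ^ k = 0 := le_antisymm (not_lt.mp h) (by positivity)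
    rw [h0, zero_mul] at h1
    linarith
  rw [div_le_iff₀ hm]
  have hgk : 0 < shapeGap m a ^ k := by positivity
  nlinarith [mul_le_mul_of_nonneg_left h1 hgk.le]

/-- The sum of the absolute values of the entries. -/
noncomputable def entrySum {m : ℕ} (Y : Mat m) : ℝ := ∑ k, ∑ l, |Y k l|

theorem entrySum_nonneg {m : ℕ} (Y : Mat m) : 0 ≤ entrySum Y :=
  Finset.sum_nonneg fun _ _ => Finset.sum_nonneg fun _ _ => abs_nonneg _

theorem entrySum_le_trace {m : ℕ} {Y : Mat m} (hY : Y.PosSemidef) :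
    entrySum Y ≤ (m : ℝ) ^ 2 * Y.trace := by
  calc entrySum Y ≤ ∑ _ : Fin m, ∑ _ : Fin m, Y.trace :=
        Finset.sum_le_sum fun i _ => Finset.sum_le_sum fun j _ => abs_apply_le_trace hY i j
    _ = _ := by simp; ring

/-- The homogeneous parts of the Bessel function. -/
noncomputable def besselCoeff {m : ℕ} (a : ℝ) (k : ℕ) (X Y : Mat m) : ℝ :=
  ∑ κ ∈ partitions m k, zonalOne κ * spherical κ X * spherical κ Y / shiftedFactorial a κ

/-- The Bessel function, normalized to be one at zero. -/
noncomputable def bessel {m : ℕ} (a : ℝ) (X Y : Mat m) : ℝ :=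
  ∑' k, (-1) ^ k / (Nat.factorial k : ℝ) * besselCoeff a k X Y

theorem besselCoeff_comm {m : ℕ} (a : ℝ) (k : ℕ) (X Y : Mat m) :
    besselCoeff a k X Y = besselCoeff a k Y X :=
  Finset.sum_congr rfl fun κ _ => by rw [mul_right_comm]

theorem besselCoeff_neg {m : ℕ} (a : ℝ) (k : ℕ) (X Y : Mat m) :
    besselCoeff a k (-X) Y = (-1) ^ k * besselCoeff a k X Y := by
  unfold besselCoeff
  rw [Finset.mul_sum]
  refine Finset.sum_congr rfl fun κ hκ => ?_
  obtain ⟨h1, h2⟩ := mem_partitions.mp hκ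
  rw [spherical_neg h1, h2]
  ring

theorem besselCoeff_smul {m : ℕ} (a : ℝ) (k : ℕ) (X Y : Mat m) (t : ℝ) :
    besselCoeff a k X (t • Y) = t ^ k * besselCoeff a k X Y := by
  unfold besselCoeff
  rw [Finset.mul_sum]
  refine Finset.sum_congr rfl fun κ hκ => ?_
  obtain ⟨h1, h2⟩ := mem_partitions.mp hκ
  rw [spherical_smul h1, h2]
  ring

theorem bessel_comm {m : ℕ} (a : ℝ) (X Y : Mat m) : bessel a X Y = bessel a Y X := by
  unfold bessel
  simp_rw [besselCoeff_comm a _ X Y]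

theorem besselCoeff_orth {m : ℕ} (a : ℝ) (k : ℕ) (H : Orth m) (X Y : Mat m) :
    besselCoeff a k ((H : Mat m) * X * (H : Mat m)ᵀ) Y = besselCoeff a k X Y := by
  unfold besselCoeff
  simp_rw [spherical_orth_left]

theorem bessel_orth {m : ℕ} (a : ℝ) (H : Orth m) (X Y : Mat m) :
    bessel a ((H : Mat m) * X * (H : Mat m)ᵀ) Y = bessel a X Y := by
  unfold bessel
  simp_rw [besselCoeff_orth]

theorem besselTerm_eq {m : ℕ} (a : ℝ) (X Y : Mat m) (k : ℕ) :
    besselTerm (order m a) X Y k = (-1) ^ k / (Nat.factorial k : ℝ) * besselCoeff a k X Y := by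
  unfold besselTerm besselCoeff order
  rw [sub_add_cancel]
  congr 1
  refine Finset.sum_congr rfl fun κ hκ => ?_
  have hd := (zonalOne_pos (mem_partitions.mp hκ).1).ne'
  rw [zonal_eq, zonal_eq, zonal_eq, spherical_one, mul_one, mul_mul_mul_comm, mul_assoc (zonalOne κ),
    mul_comm (shiftedFactorial a κ), mul_assoc, mul_div_mul_left _ _ hd]

theorem continuous_besselCoeff {m : ℕ} (a : ℝ) (k : ℕ) (Y : Mat m) :
    Continuous fun X => besselCoeff a k X Y :=
  continuous_finsetSum _ fun κ _ =>
    ((continuous_const.mul (continuous_spherical κ)).mul continuous_const).div_const _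

theorem sum_zonalOne (m k : ℕ) : ∑ κ ∈ partitions m k, zonalOne κ = (m : ℝ) ^ k := by
  have h := trace_pow_eq_sum_zonal (m := m) k isSymm_one
  simp only [spherical_one, mul_one] at h
  rw [← h]
  simp

/-- The constant in the bound for the homogeneous parts of the Bessel function. -/
noncomputable def besselConst (m : ℕ) (a : ℝ) : ℝ :=
  m * (Nat.factorial m : ℝ) ^ 2 * (m / shapeGap m a)

theorem besselConst_nonneg {m : ℕ} {a : ℝ} (ha : ((m : ℝ) - 1) / 2 < a) : 0 ≤ besselConst m a := by
  have hg := shapeGap_pos ha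
  unfold besselConst
  positivity

theorem abs_besselCoeff_le {m : ℕ} {a : ℝ} (ha : ((m : ℝ) - 1) / 2 < a) (k : ℕ) (X Y : Mat m) :
    |besselCoeff a k X Y| ≤
      (besselConst m a * entrySum X * entrySum Y) ^ k / (Nat.factorial k : ℝ) := by
  have hg := shapeGap_pos ha
  have hX := entrySum_nonneg X
  have hY := entrySum_nonneg Y
  calc |besselCoeff a k X Y| ≤ ∑ κ ∈ partitions m k, zonalOne κ *
        (((Nat.factorial m : ℝ) * entrySum X) ^ k * ((Nat.factorial m : ℝ) * entrySum Y) ^ k *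
          ((m / shapeGap m a) ^ k / (Nat.factorial k : ℝ))) := by
        refine (Finset.abs_sum_le_sum_abs _ _).trans (Finset.sum_le_sum fun κ hκ => ?_)
        obtain ⟨h1, h2⟩ := mem_partitions.mp hκ
        have hd := zonalOne_pos h1
        have h3 := abs_spherical_le h1 X
        have h4 := abs_spherical_le h1 Y
        have h5 := inv_shiftedFactorial_le ha hκ
        have h6 := shiftedFactorial_pos ha κ
        rw [h2] at h3 h4
        change |spherical κ X| ≤ ((Nat.factorial m : ℝ) * entrySum X) ^ k at h3
        change |spherical κ Y| ≤ ((Nat.factorial m : ℝ) * entrySum Y) ^ k at h4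
        rw [abs_div, abs_mul, abs_mul, abs_of_pos hd, abs_of_pos h6, div_eq_mul_inv, mul_assoc,
          mul_assoc]
        refine mul_le_mul_of_nonneg_left ?_ hd.le
        rw [← mul_assoc]
        gcongr
    _ = _ := by
        rw [← Finset.sum_mul, sum_zonalOne]
        unfold besselConst
        simp only [mul_pow, div_pow]
        ring

theorem summable_bessel {m : ℕ} {a : ℝ} (ha : ((m : ℝ) - 1) / 2 < a) (X Y : Mat m) :
    Summable fun k => (-1) ^ k / (Nat.factorial k : ℝ) * besselCoeff a k X Y := by
  set R := besselConst m a * entrySum X * entrySum Y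
  refine Summable.of_norm_bounded (g := fun k => R ^ k / (Nat.factorial k : ℝ))
    (Real.summable_pow_div_factorial R) fun k => ?_
  have h := abs_besselCoeff_le ha k X Y
  rw [Real.norm_eq_abs, abs_mul, abs_div, abs_pow, abs_neg, abs_one, one_pow, Nat.abs_cast]
  have hf : (1 : ℝ) / (Nat.factorial k : ℝ) ≤ 1 := by
    rw [div_le_one (by positivity)]
    exact_mod_cast Nat.factorial_pos k
  calc 1 / (Nat.factorial k : ℝ) * |besselCoeff a k X Y| ≤ 1 * |besselCoeff a k X Y| :=
        mul_le_mul_of_nonneg_right hf (abs_nonneg _)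
    _ ≤ _ := by rw [one_mul]; exact h

theorem hasSum_bessel {m : ℕ} {a : ℝ} (ha : ((m : ℝ) - 1) / 2 < a) (X Y : Mat m) :
    HasSum (fun k => (-1) ^ k / (Nat.factorial k : ℝ) * besselCoeff a k X Y) (bessel a X Y) :=
  (summable_bessel ha X Y).hasSum

theorem hasSum_bessel_neg {m : ℕ} {a : ℝ} (ha : ((m : ℝ) - 1) / 2 < a) (X Y : Mat m) :
    HasSum (fun k => besselCoeff a k X Y / (Nat.factorial k : ℝ)) (bessel a (-X) Y) := by
  refine (hasSum_bessel ha (-X) Y).congr_fun fun k => ?_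
  rw [besselCoeff_neg, ← mul_assoc, div_mul_eq_mul_div, ← mul_pow]
  norm_num
  ring

theorem measurable_bessel {m : ℕ} {a : ℝ} (ha : ((m : ℝ) - 1) / 2 < a) (Y : Mat m) :
    Measurable fun X => bessel a X Y := by
  refine measurable_of_tendsto_metrizable (f := fun n X => ∑ k ∈ Finset.range n,
    (-1) ^ k / (Nat.factorial k : ℝ) * besselCoeff a k X Y) (fun n => ?_) ?_
  · exact (continuous_finsetSum _ fun k _ =>
      continuous_const.mul (continuous_besselCoeff a k Y)).measurable
  · rw [tendsto_pi_nhds]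
    exact fun X => (hasSum_bessel ha X Y).tendsto_sum_nat

/-- A constant such that `|besselCoeff a k T X| ≤ (besselRate a X * tr T)^k / k!`. -/
noncomputable def besselRate {m : ℕ} (a : ℝ) (X : Mat m) : ℝ :=
  besselConst m a * (m : ℝ) ^ 2 * entrySum X

theorem besselRate_nonneg {m : ℕ} {a : ℝ} (ha : ((m : ℝ) - 1) / 2 < a) (X : Mat m) :
    0 ≤ besselRate a X := by
  have := besselConst_nonneg ha
  have := entrySum_nonneg X
  unfold besselRate
  positivity

theorem abs_besselCoeff_le_trace {m : ℕ} {a : ℝ} (ha : ((m : ℝ) - 1) / 2 < a) (k : ℕ) {T : Mat m}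
    (hT : T.PosSemidef) (X : Mat m) :
    |besselCoeff a k T X| ≤ (besselRate a X * T.trace) ^ k / (Nat.factorial k : ℝ) := by
  have h1 := besselConst_nonneg ha
  have h2 := entrySum_nonneg X
  have h3 := entrySum_nonneg T
  have h4 := entrySum_le_trace hT
  refine (abs_besselCoeff_le ha k T X).trans ?_
  have h5 : besselConst m a * entrySum T * entrySum X ≤ besselRate a X * T.trace := by
    unfold besselRate
    calc _ ≤ besselConst m a * ((m : ℝ) ^ 2 * T.trace) * entrySum X := by gcongr
      _ = _ := by ring
  gcongr

theorem abs_besselTerm_le {m : ℕ} {a : ℝ} (ha : ((m : ℝ) - 1) / 2 < a) (k : ℕ) {T : Mat m}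
    (hT : T.PosSemidef) (X : Mat m) {ε : ℝ} (hε : 0 < ε) :
    |(-1) ^ k / (Nat.factorial k : ℝ) * besselCoeff a k T X| ≤
      (besselRate a X / ε) ^ k / (Nat.factorial k : ℝ) *
        ((ε * T.trace) ^ k / (Nat.factorial k : ℝ)) := by
  have h := abs_besselCoeff_le_trace ha k hT X
  rw [abs_mul, abs_div, abs_pow, abs_neg, abs_one, one_pow, Nat.abs_cast]
  have h1 : (besselRate a X / ε) ^ k / (Nat.factorial k : ℝ) *
      ((ε * T.trace) ^ k / (Nat.factorial k : ℝ)) = 1 / (Nat.factorial k : ℝ) *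
      ((besselRate a X * T.trace) ^ k / (Nat.factorial k : ℝ)) := by
    have : besselRate a X * T.trace = besselRate a X / ε * (ε * T.trace) := by field_simp
    rw [this, mul_pow (besselRate a X / ε)]
    ring
  rw [h1]
  exact mul_le_mul_of_nonneg_left h (by positivity)

/-- The terms carry two factorials. Writing R tr T as (R/ε)(ε tr T) and giving one factorial to each
factor leads to two exponentials. As ε is arbitrary, products of two Bessel functions remain
integrable against etr(-T). -/
theorem abs_bessel_le {m : ℕ} {a : ℝ} (ha : ((m : ℝ) - 1) / 2 < a) {T : Mat m}
    (hT : T.PosSemidef) (X : Mat m) {ε : ℝ} (hε : 0 < ε) :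
    |bessel a T X| ≤ Real.exp (besselRate a X / ε) * Real.exp (ε * T.trace) := by
  have hs := (NormedSpace.expSeries_div_hasSum_exp (besselRate a X / ε)).mul_right
    (Real.exp (ε * T.trace))
  rw [← Real.exp_eq_exp_ℝ] at hs
  rw [← Real.norm_eq_abs]
  unfold bessel
  refine tsum_of_norm_bounded hs fun k => ?_
  rw [Real.norm_eq_abs]
  refine (abs_besselTerm_le ha k hT X hε).trans ?_
  have h1 := besselRate_nonneg ha X
  have h2 := hT.trace_nonneg
  refine mul_le_mul_of_nonneg_left ?_ (by positivity)
  exact Real.pow_div_factorial_le_exp _ (by positivity) k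

/-! ### Laplace transforms of the Bessel function -/

theorem integrable_wishart_of_le {m : ℕ} {a : ℝ} (ha : ((m : ℝ) - 1) / 2 < a) {f : Mat m → ℝ}
    (hf : AEStronglyMeasurable f (wishart a (1 : Mat m))) {C s : ℝ} (hs : s < 1)
    (hb : ∀ T : Mat m, T.PosDef → |f T| ≤ C * Real.exp (s * T.trace)) :
    Integrable f (wishart a (1 : Mat m)) := by
  refine ((integrable_wishart_exp_trace ha hs).const_mul C).mono' hf ?_
  filter_upwards [ae_posDef_wishart a] with T hT using hb T hT

theorem spherical_conj_le {m : ℕ} {κ : Fin m → ℕ} (hκ : Antitone κ) (A : Mat m) {T : Mat m}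
    (hT : T.PosSemidef) :
    |spherical κ (A * T * Aᵀ)| ≤ ((Nat.factorial m : ℝ) * conjBound A * T.trace) ^ weight κ := by
  have hAT := posSemidef_conj hT A
  rw [abs_of_nonneg (spherical_nonneg κ hAT)]
  refine (spherical_le hκ hAT).trans ?_
  refine pow_le_pow_left₀ (mul_nonneg (by positivity) hAT.trace_nonneg) ?_ _
  rw [mul_assoc (Nat.factorial m : ℝ)]
  exact mul_le_mul_of_nonneg_left (trace_conj_le A hT) (Nat.cast_nonneg _)

theorem mul_trace_pow_mul_exp_le {m : ℕ} {T : Mat m} (hT : T.PosSemidef) {R s δ : ℝ} (hR : 0 ≤ R)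
    (hδ : 0 < δ) (k : ℕ) : (R * T.trace) ^ k * Real.exp (s * T.trace) ≤
      (Nat.factorial k : ℝ) * (R * δ⁻¹) ^ k * Real.exp ((s + δ) * T.trace) := by
  have h := pow_le_exp_mul hT.trace_nonneg hδ k
  rw [div_le_iff₀ (by positivity)] at h
  rw [mul_pow, mul_pow, add_mul, Real.exp_add]
  calc R ^ k * T.trace ^ k * Real.exp (s * T.trace)
      ≤ R ^ k * ((δ⁻¹) ^ k * Real.exp (δ * T.trace) * Nat.factorial k) * Real.exp (s * T.trace) := by
        gcongr
    _ = _ := by ring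

theorem integrable_spherical_conj_mul {m : ℕ} {a : ℝ} (ha : ((m : ℝ) - 1) / 2 < a)
    {κ : Fin m → ℕ} (hκ : Antitone κ) (A : Mat m) {g : Mat m → ℝ} (hg : Measurable g) {C s : ℝ}
    (hs : s < 1) (hb : ∀ T : Mat m, T.PosDef → |g T| ≤ C * Real.exp (s * T.trace)) :
    Integrable (fun T => spherical κ (A * T * Aᵀ) * g T) (wishart a (1 : Mat m)) := by
  have hc : Continuous fun T : Mat m => spherical κ (A * T * Aᵀ) :=
    (continuous_spherical κ).comp (by fun_prop)
  have hδ : 0 < (1 - s) / 2 := by linarith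
  set R := (Nat.factorial m : ℝ) * conjBound A
  have hR : 0 ≤ R := mul_nonneg (Nat.cast_nonneg _) (conjBound_nonneg A)
  refine integrable_wishart_of_le ha (hc.measurable.mul hg).aestronglyMeasurable
    (C := |C| * ((Nat.factorial (weight κ) : ℝ) * (R * ((1 - s) / 2)⁻¹) ^ weight κ))
    (s := s + (1 - s) / 2) (by linarith) fun T hT => ?_
  have h1 := mul_trace_pow_mul_exp_le hT.posSemidef (s := s) hR hδ (weight κ)
  have h2 := spherical_conj_le hκ A hT.posSemidef
  have h3 := (hb T hT).trans (mul_le_mul_of_nonneg_right (le_abs_self C) (Real.exp_pos _).le)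
  rw [abs_mul]
  calc |spherical κ (A * T * Aᵀ)| * |g T|
      ≤ (R * T.trace) ^ weight κ * (|C| * Real.exp (s * T.trace)) :=
        mul_le_mul h2 h3 (abs_nonneg _) ((abs_nonneg _).trans h2)
    _ = |C| * ((R * T.trace) ^ weight κ * Real.exp (s * T.trace)) := by ring
    _ ≤ |C| * ((Nat.factorial (weight κ) : ℝ) * (R * ((1 - s) / 2)⁻¹) ^ weight κ *
          Real.exp ((s + (1 - s) / 2) * T.trace)) := mul_le_mul_of_nonneg_left h1 (abs_nonneg _)
    _ = _ := by ring

/-- Since g is orthogonally invariant, averaging T over its orbit affects only the spherical factor,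
which the product formula splits. -/
theorem integral_spherical_conj_mul {m : ℕ} {a : ℝ} (ha : ((m : ℝ) - 1) / 2 < a)
    {κ : Fin m → ℕ} (hκ : Antitone κ) (A : Mat m) {g : Mat m → ℝ} (hg : Measurable g) {C s : ℝ}
    (hs : s < 1) (hb : ∀ T : Mat m, T.PosDef → |g T| ≤ C * Real.exp (s * T.trace))
    (hinv : ∀ (H : Orth m) T, g ((H : Mat m) * T * (H : Mat m)ᵀ) = g T) :
    ∫ T, spherical κ (A * T * Aᵀ) * g T ∂(wishart a (1 : Mat m)) =
      spherical κ (A * Aᵀ) * ∫ T, spherical κ T * g T ∂(wishart a (1 : Mat m)) := by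
  have hc : Continuous fun T : Mat m => spherical κ (A * T * Aᵀ) :=
    (continuous_spherical κ).comp (by fun_prop)
  have hδ : 0 < (1 - s) / 2 := by linarith
  set R := (Nat.factorial m : ℝ) * conjBound A
  have hR : 0 ≤ R := mul_nonneg (Nat.cast_nonneg _) (conjBound_nonneg A)
  rw [integral_wishart_average ha (f := fun T => spherical κ (A * T * Aᵀ) * g T)
    (g := fun T => |C| * ((Nat.factorial (weight κ) : ℝ) * (R * ((1 - s) / 2)⁻¹) ^ weight κ) *
      Real.exp ((s + (1 - s) / 2) * T.trace)) (hc.measurable.mul hg)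
    ((integrable_wishart_exp_trace ha (by linarith)).const_mul _)]
  · simp_rw [hinv, integral_mul_const, integral_spherical_conj, mul_assoc]
    rw [integral_const_mul]
  · intro T hT H
    have hHT := posSemidef_conj hT.posSemidef (H : Mat m)
    have h1 := mul_trace_pow_mul_exp_le hT.posSemidef (s := s) hR hδ (weight κ)
    have h2 := spherical_conj_le hκ A hHT
    rw [trace_conj_orth] at h2
    have h3 := (hb T hT).trans (mul_le_mul_of_nonneg_right (le_abs_self C) (Real.exp_pos _).le)
    rw [abs_mul, hinv]
    calc |spherical κ (A * ((H : Mat m) * T * (H : Mat m)ᵀ) * Aᵀ)| * |g T|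
        ≤ (R * T.trace) ^ weight κ * (|C| * Real.exp (s * T.trace)) :=
          mul_le_mul h2 h3 (abs_nonneg _) ((abs_nonneg _).trans h2)
      _ = |C| * ((R * T.trace) ^ weight κ * Real.exp (s * T.trace)) := by ring
      _ ≤ |C| * ((Nat.factorial (weight κ) : ℝ) * (R * ((1 - s) / 2)⁻¹) ^ weight κ *
            Real.exp ((s + (1 - s) / 2) * T.trace)) := mul_le_mul_of_nonneg_left h1 (abs_nonneg _)
      _ = _ := by ring

/-- The orthogonal average of `etr (V H X Hᵀ)`. -/
noncomputable def etrAverage {m : ℕ} (X V : Mat m) : ℝ :=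
  ∫ H : Orth m, etr (V * ((H : Mat m) * X * (H : Mat m)ᵀ)) ∂(orthHaar m)

/-- With the square root of V on both sides, the exponent is the trace of a symmetric matrix. Its
powers are sums of zonal polynomials, and the product formula evaluates the average over H. -/
theorem hasSum_etrAverage {m : ℕ} {X : Mat m} (hX : X.IsSymm) {v : Fin m → ℝ} (hv : ∀ i, 0 < v i) :
    HasSum (fun k => (∑ κ ∈ partitions m k, zonalOne κ * spherical κ X * spherical κ (diagonal v)) /
      (Nat.factorial k : ℝ)) (etrAverage X (diagonal v)) := by
  have hco := Orth.continuous_coe (m := m)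
  set x : Orth m → ℝ := fun H => (sqrtDiag v * ((H : Mat m) * X * (H : Mat m)ᵀ) *
    (sqrtDiag v)ᵀ).trace with hx
  have hxc : Continuous x := by
    simp only [hx]
    fun_prop
  obtain ⟨M, hM⟩ := isCompact_univ.exists_bound_of_continuousOn hxc.continuousOn
  have hM' : ∀ H, |x H| ≤ M := fun H => hM H (Set.mem_univ H)
  have h1 : HasSum (fun k => ∫ H, x H ^ k / (Nat.factorial k : ℝ) ∂(orthHaar m))
      (∫ H, Real.exp (x H) ∂(orthHaar m)) := by
    refine hasSum_integral_of_dominated_convergence (fun k _ => M ^ k / (Nat.factorial k : ℝ))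
      (fun k => ((hxc.pow k).div_const _).aestronglyMeasurable) (fun k => ?_) ?_ ?_ ?_
    · refine Filter.Eventually.of_forall fun H => ?_
      rw [norm_div, norm_pow, Real.norm_eq_abs, Real.norm_eq_abs, Nat.abs_cast]
      gcongr
      exact hM' H
    · exact Filter.Eventually.of_forall fun H => Real.summable_pow_div_factorial M
    · exact integrable_const _
    · refine Filter.Eventually.of_forall fun H => ?_
      have h := NormedSpace.expSeries_div_hasSum_exp (x H)
      rwa [← Real.exp_eq_exp_ℝ] at h
  have h2 : etrAverage X (diagonal v) = ∫ H, Real.exp (x H) ∂(orthHaar m) := by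
    unfold etrAverage
    congr 1
    ext H
    rw [etr, hx]
    simp only [trace_sqrtDiag_conj hv]
  rw [h2]
  refine h1.congr_fun fun k => ?_
  rw [integral_div]
  congr 1
  have h3 : ∀ H, x H ^ k = ∑ κ ∈ partitions m k, zonalOne κ *
      spherical κ (sqrtDiag v * ((H : Mat m) * X * (H : Mat m)ᵀ) * (sqrtDiag v)ᵀ) := fun H =>
    trace_pow_eq_sum_zonal k (IsSymm.conj (IsSymm.conj hX _) _)
  simp_rw [h3]
  rw [integral_finsetSum]
  · refine Finset.sum_congr rfl fun κ _ => ?_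
    rw [integral_const_mul, integral_spherical_conj, sqrtDiag_mul_transpose hv]
    ring
  · intro κ _
    refine (integrable_orth ?_).const_mul _
    exact (continuous_spherical κ).comp (by fun_prop)

/-- The trace of H X Hᵀ does not depend on H, so the part of the exponent belonging to the identity
leaves the average. This is the source of the factor etr(-X) in the Weber integral. -/
theorem etrAverage_neg {m : ℕ} (X U : Mat m) :
    etrAverage (-X) (1 - U) = etr (-X) * etrAverage X U := by
  unfold etrAverage
  rw [← integral_const_mul]
  congr 1
  ext H
  rw [etr, etr, etr, ← Real.exp_add]
  congr 1
  rw [Matrix.mul_neg, Matrix.neg_mul, Matrix.mul_neg, Matrix.sub_mul, Matrix.one_mul, trace_neg,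
    trace_sub, trace_conj_orth, trace_neg]
  ring

theorem etrAverage_smul_one {m : ℕ} (X : Mat m) (c : ℝ) :
    etrAverage X (c • (1 : Mat m)) = etr (c • X) := by
  unfold etrAverage
  have h : ∀ H : Orth m, etr (c • (1 : Mat m) * ((H : Mat m) * X * (H : Mat m)ᵀ)) = etr (c • X) := by
    intro H
    rw [etr, etr, smul_mul, Matrix.one_mul, trace_smul, trace_smul, trace_conj_orth]
  simp_rw [h]
  simp

theorem integral_besselCoeff_conj {m : ℕ} {a : ℝ} (ha : ((m : ℝ) - 1) / 2 < a) (k : ℕ) (X A : Mat m) :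
    ∫ T, besselCoeff a k (A * T * Aᵀ) X ∂(wishart a (1 : Mat m)) =
      ∑ κ ∈ partitions m k, zonalOne κ * spherical κ X * spherical κ (A * Aᵀ) := by
  unfold besselCoeff
  rw [integral_finsetSum]
  · refine Finset.sum_congr rfl fun κ hκ => ?_
    have hp := (shiftedFactorial_pos ha κ).ne'
    rw [integral_div, integral_mul_const, integral_const_mul,
      integral_spherical_conj_wishart ha (mem_partitions.mp hκ).1]
    field_simp
  · intro κ hκ
    exact (((integrable_spherical_conj_wishart ha (mem_partitions.mp hκ).1 A).const_mul _).mul_const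
      _).div_const _

/-- Wishart averaging multiplies each spherical polynomial by [a]_κ, which cancels the denominators
of the Bessel series and leaves the series of the averaged exponential. -/
theorem integral_bessel_conj {m : ℕ} {a : ℝ} (ha : ((m : ℝ) - 1) / 2 < a) {X : Mat m}
    (hX : X.IsSymm) {A : Mat m} {v : Fin m → ℝ} (hv : ∀ i, 0 < v i) (hA : A * Aᵀ = diagonal v) :
    ∫ T, bessel a (A * T * Aᵀ) X ∂(wishart a (1 : Mat m)) = etrAverage (-X) (diagonal v) := by
  have hK := conjBound_nonneg A
  set K := conjBound A with hKdef
  -- The congruence can enlarge the trace by the factor K; the rate 1/(K+1) keeps the dominating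
  -- exponential below the Wishart decay.
  have hε : 0 < (K + 1)⁻¹ := by positivity
  have h1 := hasSum_integral_wishart ha
    (F := fun k T => (-1) ^ k / (Nat.factorial k : ℝ) * besselCoeff a k (A * T * Aᵀ) X)
    (f := fun T => bessel a (A * T * Aᵀ) X)
    (C := Real.exp (besselRate a X / (K + 1)⁻¹)) (r := (K + 1)⁻¹ * K)
    (fun k => (continuous_const.mul ((continuous_besselCoeff a k X).comp
      (by fun_prop))).aestronglyMeasurable)
    (by rw [inv_mul_lt_iff₀ (by positivity)]; linarith)
    (fun k T hT => by
      have hAT := posSemidef_conj hT.posSemidef A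
      have h2 := besselRate_nonneg ha X
      have h3 := hAT.trace_nonneg
      refine (abs_besselTerm_le ha k hAT X hε).trans ?_
      refine mul_le_mul (Real.pow_div_factorial_le_exp _ (by positivity) k) ?_ (by positivity)
        (Real.exp_pos _).le
      rw [mul_assoc _ K]
      have h4 := trace_conj_le A hT.posSemidef
      change _ ≤ K * T.trace at h4
      gcongr)
    (fun T _ => hasSum_bessel ha _ X)
  refine HasSum.unique h1 ((hasSum_etrAverage (X := -X) hX.neg hv).congr_fun fun k => ?_)
  rw [integral_const_mul, integral_besselCoeff_conj ha, hA, div_mul_eq_mul_div, Finset.mul_sum]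
  congr 1
  refine Finset.sum_congr rfl fun κ hκ => ?_
  obtain ⟨h2, h3⟩ := mem_partitions.mp hκ
  rw [spherical_neg h2, h3]
  ring

theorem diagonal_sq_mul {m : ℕ} {z : Fin m → ℝ} (hz : ∀ i, 0 < z i) :
    diagonal (fun i => (√(z i))⁻¹) * (diagonal (fun i => (√(z i))⁻¹) : Mat m)ᵀ =
      diagonal fun i => (z i)⁻¹ := by
  rw [diagonal_transpose, diagonal_mul_diagonal]
  congr 1
  ext i
  rw [← mul_inv, Real.mul_self_sqrt (hz i).le]

theorem integral_etr_mul_bessel {m : ℕ} {a : ℝ} (ha : ((m : ℝ) - 1) / 2 < a) {X : Mat m}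
    (hX : X.IsSymm) {z : Fin m → ℝ} (hz : ∀ i, 0 < z i) :
    ∫ T, etr ((1 - diagonal z) * T) * bessel a T X ∂(wishart a (1 : Mat m)) =
      (∏ i, z i) ^ (-a) * etrAverage (-X) (diagonal fun i => (z i)⁻¹) := by
  rw [integral_wishart_diagonal ha hz (fun T => bessel a T X),
    integral_bessel_conj ha hX (fun i => inv_pos.mpr (hz i)) (diagonal_sq_mul hz)]

/-! ### The integral of a product of two Bessel functions -/

theorem exp_trace_sqrtDiag {m : ℕ} {y : Fin m → ℝ} (hy : ∀ i, 0 < y i) (t : ℝ) (T : Mat m) :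
    Real.exp (-t * (sqrtDiag y * T * (sqrtDiag y)ᵀ).trace) =
      etr ((1 - diagonal fun i => 1 + t * y i) * T) := by
  have h1 : (1 : Mat m) - diagonal (fun i => 1 + t * y i) = (-t) • diagonal y := by
    rw [← diagonal_one, ← diagonal_smul, diagonal_sub]
    congr 1
    ext i
    simp
  rw [etr, h1, trace_sqrtDiag_conj hy, smul_mul, trace_smul, smul_eq_mul]

/-- The moments of the Bessel function against the spherical polynomials. -/
noncomputable def besselMoment {m : ℕ} (a : ℝ) (X : Mat m) (κ : Fin m → ℕ) : ℝ :=
  ∫ T, spherical κ T * bessel a T X ∂(wishart a (1 : Mat m))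

theorem integral_trace_pow_mul_bessel {m : ℕ} {a : ℝ} (ha : ((m : ℝ) - 1) / 2 < a) (X A : Mat m)
    (k : ℕ) :
    ∫ T, (A * T * Aᵀ).trace ^ k * bessel a T X ∂(wishart a (1 : Mat m)) =
      ∑ κ ∈ partitions m k, zonalOne κ * spherical κ (A * Aᵀ) * besselMoment a X κ := by
  have hb : ∀ T : Mat m, T.PosDef → |bessel a T X| ≤
      Real.exp (besselRate a X / (1 / 2)) * Real.exp (1 / 2 * T.trace) := fun T hT =>
    abs_bessel_le ha hT.posSemidef X (by norm_num)
  have hm := measurable_bessel ha X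
  have h1 : ∀ᵐ T ∂(wishart a (1 : Mat m)), (A * T * Aᵀ).trace ^ k * bessel a T X =
      ∑ κ ∈ partitions m k, zonalOne κ * (spherical κ (A * T * Aᵀ) * bessel a T X) := by
    filter_upwards [ae_posDef_wishart a] with T hT
    rw [trace_pow_eq_sum_zonal k (IsSymm.conj (PosDef.isSymm hT) A), Finset.sum_mul]
    exact Finset.sum_congr rfl fun κ _ => mul_assoc _ _ _
  rw [integral_congr_ae h1, integral_finsetSum]
  · refine Finset.sum_congr rfl fun κ hκ => ?_
    rw [integral_const_mul, integral_spherical_conj_mul ha (mem_partitions.mp hκ).1 A hm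
      (by norm_num) hb (fun H T => bessel_orth a H T X), mul_assoc]
    rfl
  · intro κ hκ
    exact (integrable_spherical_conj_mul ha (mem_partitions.mp hκ).1 A hm
      (by norm_num) hb).const_mul _

/-- The Laplace transform of the Bessel function at Z = 1 + tD, expanded in t through etr(-tDT),
generates its moments against the spherical polynomials. -/
theorem hasSum_besselMoment {m : ℕ} {a : ℝ} (ha : ((m : ℝ) - 1) / 2 < a) {X : Mat m}
    (hX : X.IsSymm) {y : Fin m → ℝ} (hy : ∀ i, 0 < y i) : ∃ ε > 0, ∀ t, 0 < t → t < ε →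
    HasSum (fun k => ((-1) ^ k / (Nat.factorial k : ℝ) * ∑ κ ∈ partitions m k,
      zonalOne κ * spherical κ (diagonal y) * besselMoment a X κ) * t ^ k)
      ((∏ i, (1 + t * y i)) ^ (-a) *
        etrAverage (-X) (diagonal fun i => (1 + t * y i)⁻¹)) := by
  obtain ⟨ε, hε, h⟩ := exists_pos_mul_lt (conjBound (sqrtDiag y)) (s := 1 / 2) (by norm_num)
  refine ⟨ε, hε, fun t ht0 ht => ?_⟩
  have hz : ∀ i, 0 < 1 + t * y i := fun i => by have := mul_pos ht0 (hy i); linarith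
  rw [← integral_etr_mul_bessel ha hX hz]
  have h1 := hasSum_integral_wishart_exp ha
    (F := fun k T => (-1) ^ k / (Nat.factorial k : ℝ) * t ^ k *
      ((sqrtDiag y * T * (sqrtDiag y)ᵀ).trace ^ k * bessel a T X))
    (f := fun T => etr ((1 - diagonal fun i => 1 + t * y i) * T) * bessel a T X)
    (C := Real.exp (besselRate a X / (1 / 2))) (r := t * conjBound (sqrtDiag y)) (s := 1 / 2)
    (fun k => (((Continuous.measurable (by fun_prop)).mul
      (measurable_bessel ha X)).const_mul _).aestronglyMeasurable)
    (by have := h t ht0 ht; linarith)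
    (fun k T hT => by
      have h2 := (posSemidef_conj hT.posSemidef (sqrtDiag y)).trace_nonneg
      have h3 := trace_conj_le (sqrtDiag y) hT.posSemidef
      have h4 : (sqrtDiag y * T * (sqrtDiag y)ᵀ).trace ^ k ≤
          (conjBound (sqrtDiag y) * T.trace) ^ k := pow_le_pow_left₀ h2 h3 k
      have h5 : |(-1 : ℝ) ^ k| = 1 := by rw [abs_pow, abs_neg, abs_one, one_pow]
      have h6 := abs_bessel_le ha hT.posSemidef X (ε := 1 / 2) (by norm_num)
      rw [abs_mul, abs_mul, abs_mul, abs_div, h5, abs_of_nonneg (pow_nonneg h2 k),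
        abs_of_pos (pow_pos ht0 k), Nat.abs_cast]
      calc 1 / (Nat.factorial k : ℝ) * t ^ k *
            ((sqrtDiag y * T * (sqrtDiag y)ᵀ).trace ^ k * |bessel a T X|)
          ≤ 1 / (Nat.factorial k : ℝ) * t ^ k * ((conjBound (sqrtDiag y) * T.trace) ^ k *
            (Real.exp (besselRate a X / (1 / 2)) * Real.exp (1 / 2 * T.trace))) := by
            refine mul_le_mul_of_nonneg_left ?_ (by positivity)
            exact mul_le_mul h4 h6 (abs_nonneg _) ((pow_nonneg h2 k).trans h4)
        _ = _ := by
            rw [mul_assoc t, mul_pow t]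
            ring)
    (fun T _ => by
      have h2 := (NormedSpace.expSeries_div_hasSum_exp
        (-t * (sqrtDiag y * T * (sqrtDiag y)ᵀ).trace)).mul_right (bessel a T X)
      rw [← Real.exp_eq_exp_ℝ, exp_trace_sqrtDiag hy] at h2
      refine h2.congr_fun fun k => ?_
      rw [mul_pow, neg_pow]
      ring)
  refine h1.congr_fun fun k => ?_
  rw [integral_const_mul, integral_trace_pow_mul_bessel ha, sqrtDiag_mul_transpose hy]
  ring

/-- The homogeneous parts of `etr (-Y)` times the Bessel function at `(-X, Y)`. -/
noncomputable def dampedCoeff {m : ℕ} (a : ℝ) (X : Mat m) (q : ℕ) (Y : Mat m) : ℝ :=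
  ∑ ij ∈ Finset.HasAntidiagonal.antidiagonal q,
    (-Y.trace) ^ ij.1 / (Nat.factorial ij.1 : ℝ) *
      (besselCoeff a ij.2 X Y / (Nat.factorial ij.2 : ℝ))

theorem hasSum_dampedCoeff {m : ℕ} {a : ℝ} (ha : ((m : ℝ) - 1) / 2 < a) (X Y : Mat m) :
    HasSum (fun q => dampedCoeff a X q Y) (etr (-Y) * bessel a (-X) Y) := by
  have h1 := NormedSpace.expSeries_div_hasSum_exp (-Y.trace)
  rw [← Real.exp_eq_exp_ℝ] at h1
  have h2 := hasSum_bessel_neg ha X Y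
  have h3 := summable_norm_sum_mul_antidiagonal_of_summable_norm h1.summable.norm h2.summable.norm
  have h4 := tsum_mul_tsum_eq_tsum_sum_antidiagonal_of_summable_norm h1.summable.norm
    h2.summable.norm
  rw [h1.tsum_eq, h2.tsum_eq] at h4
  rw [etr, trace_neg, h4]
  exact h3.of_norm.hasSum

theorem dampedCoeff_smul {m : ℕ} (a : ℝ) (X : Mat m) (q : ℕ) (Y : Mat m) (t : ℝ) :
    dampedCoeff a X q (t • Y) = t ^ q * dampedCoeff a X q Y := by
  unfold dampedCoeff
  rw [Finset.mul_sum]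
  refine Finset.sum_congr rfl fun ij hij => ?_
  rw [← Finset.HasAntidiagonal.mem_antidiagonal.mp hij, besselCoeff_smul, trace_smul, smul_eq_mul,
    pow_add, ← mul_neg, mul_pow]
  ring

theorem sum_antidiagonal_pow_div_factorial (x y : ℝ) (q : ℕ) :
    ∑ ij ∈ Finset.HasAntidiagonal.antidiagonal q,
      x ^ ij.1 / (Nat.factorial ij.1 : ℝ) * (y ^ ij.2 / (Nat.factorial ij.2 : ℝ)) =
      (x + y) ^ q / (Nat.factorial q : ℝ) := by
  rw [(Commute.all x y).add_pow', Finset.sum_div]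
  refine Finset.sum_congr rfl fun ij hij => ?_
  have h := Finset.HasAntidiagonal.mem_antidiagonal.mp hij
  have h1 : (q.choose ij.1 : ℝ) = (Nat.factorial q : ℝ) /
      ((Nat.factorial ij.1 : ℝ) * (Nat.factorial ij.2 : ℝ)) := by
    rw [← h, Nat.cast_add_choose]
  rw [nsmul_eq_mul, h1]
  have hq : (Nat.factorial q : ℝ) ≠ 0 := by positivity
  field_simp

theorem abs_dampedCoeff_le {m : ℕ} {a : ℝ} (ha : ((m : ℝ) - 1) / 2 < a) (X : Mat m) (q : ℕ)
    {Y : Mat m} (hY : Y.PosSemidef) :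
    |dampedCoeff a X q Y| ≤ ((1 + besselRate a X) * Y.trace) ^ q / (Nat.factorial q : ℝ) := by
  have h0 := hY.trace_nonneg
  have hr := besselRate_nonneg ha X
  rw [add_mul, one_mul, ← sum_antidiagonal_pow_div_factorial]
  refine (Finset.abs_sum_le_sum_abs _ _).trans (Finset.sum_le_sum fun ij _ => ?_)
  have h1 := abs_besselCoeff_le_trace ha ij.2 hY X
  rw [besselCoeff_comm] at h1
  rw [abs_mul, abs_div, abs_div, abs_pow, abs_neg, abs_of_nonneg h0, Nat.abs_cast, Nat.abs_cast]
  refine mul_le_mul_of_nonneg_left ?_ (by positivity)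
  refine div_le_div_of_nonneg_right (h1.trans ?_) (by positivity) |>.trans le_rfl
  refine div_le_self (by positivity) ?_
  exact_mod_cast Nat.factorial_pos _

theorem isSphericalSum_dampedCoeff {m : ℕ} (a : ℝ) (X : Mat m) (q : ℕ) :
    IsSphericalSum q (dampedCoeff a X q) := by
  unfold dampedCoeff
  refine IsSphericalSum.sum _ fun ij hij => ?_
  have h1 : IsSphericalSum ij.2 fun Y => besselCoeff a ij.2 X Y := by
    unfold besselCoeff
    refine IsSphericalSum.sum _ fun κ hκ => ?_
    obtain ⟨h2, h3⟩ := mem_partitions.mp hκ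
    have h4 := (isSphericalSum_spherical h2).const_mul
      (zonalOne κ * spherical κ X / shiftedFactorial a κ)
    rw [h3] at h4
    refine cast (congrArg _ ?_) h4
    ext Y
    ring
  have h2 := (h1.trace_pow_mul ij.1).const_mul
    ((-1) ^ ij.1 / ((Nat.factorial ij.1 : ℝ) * (Nat.factorial ij.2 : ℝ)))
  rw [Finset.HasAntidiagonal.mem_antidiagonal.mp hij] at h2
  refine cast (congrArg _ ?_) h2
  ext Y
  rw [neg_pow (Matrix.trace Y)]
  field_simp

theorem continuous_dampedCoeff {m : ℕ} (a : ℝ) (X : Mat m) (q : ℕ) :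
    Continuous (dampedCoeff a X q) := by
  refine continuous_finsetSum _ fun ij _ => ?_
  refine Continuous.mul (by fun_prop) (Continuous.div_const ?_ _)
  exact (continuous_besselCoeff a ij.2 X).congr fun Y => besselCoeff_comm a ij.2 Y X

/-- In the Wishart average of etr(-tDT) times the Bessel function along tD^(1/2) T D^(1/2), the
exponential is absorbed by the change of variables with Z = 1 + tD. The Bessel argument becomes a
congruence A T Aᵀ with A Aᵀ = tD(1+tD)⁻¹, to which `integral_bessel_conj` applies. -/
theorem hasSum_integral_dampedCoeff {m : ℕ} {a : ℝ} (ha : ((m : ℝ) - 1) / 2 < a) {X : Mat m}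
    (hX : X.IsSymm) {y : Fin m → ℝ} (hy : ∀ i, 0 < y i) : ∃ ε > 0, ∀ t, 0 < t → t < ε →
    HasSum (fun q => (∫ T, dampedCoeff a X q (sqrtDiag y * T * (sqrtDiag y)ᵀ)
      ∂(wishart a (1 : Mat m))) * t ^ q)
      ((∏ i, (1 + t * y i)) ^ (-a) *
        etrAverage X (diagonal fun i => t * y i * (1 + t * y i)⁻¹)) := by
  obtain ⟨ε, hε, h⟩ := exists_pos_mul_lt ((1 + besselRate a X) * conjBound (sqrtDiag y)) one_pos
  refine ⟨ε, hε, fun t ht0 ht => ?_⟩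
  have hr := besselRate_nonneg ha X
  have hz : ∀ i, 0 < 1 + t * y i := fun i => by have := mul_pos ht0 (hy i); linarith
  have h1 := hasSum_integral_wishart ha
    (F := fun q T => dampedCoeff a X q (t • (sqrtDiag y * T * (sqrtDiag y)ᵀ)))
    (f := fun T => etr ((1 - diagonal fun i => 1 + t * y i) * T) *
      bessel a (t • (sqrtDiag y * T * (sqrtDiag y)ᵀ)) (-X))
    (C := 1) (r := t * ((1 + besselRate a X) * conjBound (sqrtDiag y)))
    (fun q => ((continuous_dampedCoeff a X q).comp (by fun_prop)).aestronglyMeasurable)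
    (h t ht0 ht)
    (fun q T hT => by
      have h2 := posSemidef_conj hT.posSemidef (sqrtDiag y)
      have h3 := trace_conj_le (sqrtDiag y) hT.posSemidef
      have h4 : (t • (sqrtDiag y * T * (sqrtDiag y)ᵀ)).PosSemidef := h2.smul ht0.le
      refine (abs_dampedCoeff_le ha X q h4).trans ?_
      have h5 := h4.trace_nonneg
      rw [one_mul]
      refine div_le_div_of_nonneg_right (pow_le_pow_left₀ (by positivity) ?_ q) (by positivity)
      rw [trace_smul, smul_eq_mul]
      calc (1 + besselRate a X) * (t * (sqrtDiag y * T * (sqrtDiag y)ᵀ).trace)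
          ≤ (1 + besselRate a X) * (t * (conjBound (sqrtDiag y) * T.trace)) := by
            gcongr
            exact h3
        _ = _ := by ring)
    (fun T _ => by
      have h2 := hasSum_dampedCoeff ha X (t • (sqrtDiag y * T * (sqrtDiag y)ᵀ))
      rwa [etr, trace_neg, trace_smul, smul_eq_mul, ← neg_mul, exp_trace_sqrtDiag hy,
        bessel_comm] at h2)
  have h2 : ∫ T, etr ((1 - diagonal fun i => 1 + t * y i) * T) *
      bessel a (t • (sqrtDiag y * T * (sqrtDiag y)ᵀ)) (-X) ∂(wishart a (1 : Mat m)) =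
      (∏ i, (1 + t * y i)) ^ (-a) *
        etrAverage X (diagonal fun i => t * y i * (1 + t * y i)⁻¹) := by
    rw [integral_wishart_diagonal ha hz
      (fun T => bessel a (t • (sqrtDiag y * T * (sqrtDiag y)ᵀ)) (-X))]
    congr 1
    set Z : Mat m := diagonal fun i => (√(1 + t * y i))⁻¹ with hZ
    -- A collects the three congruences: scaling by t, the root of D, and the root of (1+tD)⁻¹ from
    -- the change of variables.
    set A : Mat m := √t • (sqrtDiag y * Z) with hA
    have h3 : ∀ T : Mat m, t • (sqrtDiag y * (Z * T * Zᵀ) * (sqrtDiag y)ᵀ) = A * T * Aᵀ := by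
      intro T
      rw [hA, transpose_smul, transpose_mul, Matrix.smul_mul, Matrix.smul_mul, Matrix.mul_smul,
        smul_smul,
        Real.mul_self_sqrt ht0.le]
      simp only [Matrix.mul_assoc]
    simp_rw [h3]
    rw [integral_bessel_conj ha hX.neg (v := fun i => t * y i * (1 + t * y i)⁻¹), neg_neg]
    · intro i
      exact mul_pos (mul_pos ht0 (hy i)) (inv_pos.mpr (hz i))
    · rw [hA, transpose_smul, transpose_mul, Matrix.smul_mul, Matrix.mul_smul, smul_smul,
        Real.mul_self_sqrt ht0.le, Matrix.mul_assoc, ← Matrix.mul_assoc Z, diagonal_sq_mul hz,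
        sqrtDiag, diagonal_transpose, diagonal_mul_diagonal, diagonal_mul_diagonal,
        ← diagonal_smul]
      congr 1
      ext i
      simp only [Pi.smul_apply, smul_eq_mul]
      have h4 := Real.mul_self_sqrt (hy i).le
      linear_combination (t * (1 + t * y i)⁻¹) * h4
  rw [h2] at h1
  refine h1.congr_fun fun q => ?_
  simp_rw [dampedCoeff_smul]
  rw [integral_const_mul, mul_comm]

/-- Since (1+tD)⁻¹ = 1 - tD(1+tD)⁻¹, the two preceding generating functions differ only by the
factor etr(-X) of `etrAverage_neg`. Their power series in t agree on an interval, hence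
coefficientwise. -/
theorem integral_dampedCoeff_eq {m : ℕ} {a : ℝ} (ha : ((m : ℝ) - 1) / 2 < a) {X : Mat m}
    (hX : X.IsSymm) {y : Fin m → ℝ} (hy : ∀ i, 0 < y i) (q : ℕ) :
    (-1) ^ q / (Nat.factorial q : ℝ) * ∑ κ ∈ partitions m q,
      zonalOne κ * spherical κ (diagonal y) * besselMoment a X κ =
    etr (-X) * ∫ T, dampedCoeff a X q (sqrtDiag y * T * (sqrtDiag y)ᵀ)
      ∂(wishart a (1 : Mat m)) := by
  obtain ⟨ε₁, hε₁, h₁⟩ := hasSum_besselMoment ha hX hy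
  obtain ⟨ε₂, hε₂, h₂⟩ := hasSum_integral_dampedCoeff ha hX hy
  refine hasSum_unique_coeff (a := fun q => (-1) ^ q / (Nat.factorial q : ℝ) *
    ∑ κ ∈ partitions m q, zonalOne κ * spherical κ (diagonal y) * besselMoment a X κ)
    (b := fun q => etr (-X) * ∫ T, dampedCoeff a X q (sqrtDiag y * T * (sqrtDiag y)ᵀ)
      ∂(wishart a (1 : Mat m))) (lt_min hε₁ hε₂)
    (fun t ht0 ht => h₁ t ht0 (ht.trans_le (min_le_left _ _))) (fun t ht0 ht => ?_) q
  have h3 := (h₂ t ht0 (ht.trans_le (min_le_right _ _))).mul_left (etr (-X))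
  simp_rw [← mul_assoc] at h3
  have hz : ∀ i, 0 < 1 + t * y i := fun i => by have := mul_pos ht0 (hy i); linarith
  have h4 : (diagonal fun i => (1 + t * y i)⁻¹ : Mat m) =
      1 - diagonal fun i => t * y i * (1 + t * y i)⁻¹ := by
    rw [← diagonal_one, diagonal_sub]
    congr 1
    ext i
    have := (hz i).ne'
    field_simp
    ring
  rw [h4, etrAverage_neg, ← mul_assoc, mul_comm (_ ^ (-a))]
  exact h3

/-- This undoes the Wishart averaging in the previous identity. The damped part is a combination of
spherical polynomials, averaging multiplies each coefficient by [a]_κ > 0, and linear independence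
in y allows division by it term by term. -/
theorem dampedCoeff_eq_moments {m : ℕ} {a : ℝ} (ha : ((m : ℝ) - 1) / 2 < a) {X Y : Mat m}
    (hX : X.IsSymm) (hY : Y.IsSymm) (q : ℕ) :
    (-1) ^ q / (Nat.factorial q : ℝ) * ∑ κ ∈ partitions m q,
      zonalOne κ * spherical κ Y / shiftedFactorial a κ * besselMoment a X κ =
    etr (-X) * dampedCoeff a X q Y := by
  obtain ⟨c, hc⟩ := isSphericalSum_dampedCoeff a X q
  have h1 := spherical_linearIndependent m q (fun κ =>
    (-1) ^ q / (Nat.factorial q : ℝ) * (zonalOne κ * besselMoment a X κ) -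
      etr (-X) * (c κ * shiftedFactorial a κ)) (fun y hy => by
    have h2 := integral_dampedCoeff_eq ha hX hy q
    have h3 : ∀ᵐ T ∂(wishart a (1 : Mat m)), dampedCoeff a X q (sqrtDiag y * T * (sqrtDiag y)ᵀ) =
        ∑ κ ∈ partitions m q, c κ * spherical κ (sqrtDiag y * T * (sqrtDiag y)ᵀ) := by
      filter_upwards [ae_posDef_wishart a] with T hT
      exact hc _ (IsSymm.conj (PosDef.isSymm hT) _)
    rw [integral_congr_ae h3, integral_finsetSum _ (fun κ hκ =>
      (integrable_spherical_conj_wishart ha (mem_partitions.mp hκ).1 _).const_mul _),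
      Finset.mul_sum, Finset.mul_sum, ← sub_eq_zero, ← Finset.sum_sub_distrib] at h2
    rw [← h2]
    refine Finset.sum_congr rfl fun κ hκ => ?_
    rw [integral_const_mul, integral_spherical_conj_wishart ha (mem_partitions.mp hκ).1,
      sqrtDiag_mul_transpose hy]
    ring)
  rw [hc Y hY, Finset.mul_sum, Finset.mul_sum]
  refine Finset.sum_congr rfl fun κ hκ => ?_
  have h2 := sub_eq_zero.mp (h1 κ hκ)
  have hp := (shiftedFactorial_pos ha κ).ne'
  have h3 : etr (-X) * c κ = (-1) ^ q / (Nat.factorial q : ℝ) * (zonalOne κ * besselMoment a X κ) /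
      shiftedFactorial a κ := by
    rw [h2]
    field_simp
  rw [← mul_assoc (etr (-X)), h3]
  ring

/-- Integrating the series of B(T,Y) termwise against B(T,X) gives the moments of B(·,X) in each
degree. By `dampedCoeff_eq_moments` the term of degree q is etr(-X) times the part of degree q of
etr(-Y) B(-X,Y), and these parts sum to the claim. -/
theorem integral_bessel_mul_bessel {m : ℕ} {a : ℝ} (ha : ((m : ℝ) - 1) / 2 < a) {X Y : Mat m}
    (hX : X.IsSymm) (hY : Y.IsSymm) :
    ∫ T, bessel a T X * bessel a T Y ∂(wishart a (1 : Mat m)) =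
      etr (-X - Y) * bessel a (-X) Y := by
  have hb : ∀ T : Mat m, T.PosDef → |bessel a T X| ≤
      Real.exp (besselRate a X / (1 / 2)) * Real.exp (1 / 2 * T.trace) := fun T hT =>
    abs_bessel_le ha hT.posSemidef X (by norm_num)
  have hm := measurable_bessel ha X
  -- The rates 1/4 and 1/2 of the two factors add up to less than one, as the domination requires.
  have h1 := hasSum_integral_wishart_exp ha
    (F := fun q T => (-1) ^ q / (Nat.factorial q : ℝ) * besselCoeff a q T Y * bessel a T X)
    (f := fun T => bessel a T X * bessel a T Y)
    (C := Real.exp (besselRate a Y / (1 / 4)) * Real.exp (besselRate a X / (1 / 2)))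
    (r := 1 / 4) (s := 1 / 2)
    (fun q => ((measurable_const.mul (continuous_besselCoeff a q Y).measurable).mul
      hm).aestronglyMeasurable) (by norm_num)
    (fun q T hT => by
      have h2 := abs_besselTerm_le ha q hT.posSemidef Y (ε := 1 / 4) (by norm_num)
      have h3 := besselRate_nonneg ha Y
      have h4 := hT.posSemidef.trace_nonneg
      have h5 := Real.pow_div_factorial_le_exp (besselRate a Y / (1 / 4)) (by positivity) q
      rw [abs_mul]
      calc _ ≤ (Real.exp (besselRate a Y / (1 / 4)) *
            ((1 / 4 * T.trace) ^ q / (Nat.factorial q : ℝ))) *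
            (Real.exp (besselRate a X / (1 / 2)) * Real.exp (1 / 2 * T.trace)) := by
            refine mul_le_mul (h2.trans ?_) (hb T hT) (abs_nonneg _) (by positivity)
            gcongr
        _ = _ := by ring)
    (fun T _ => by
      rw [mul_comm]
      exact (hasSum_bessel ha T Y).mul_right _)
  have h2 := (hasSum_dampedCoeff ha X Y).mul_left (etr (-X))
  have h3 : etr (-X) * (etr (-Y) * bessel a (-X) Y) = etr (-X - Y) * bessel a (-X) Y := by
    rw [← mul_assoc, etr, etr, etr, ← Real.exp_add, ← trace_add, sub_eq_add_neg]
  rw [h3] at h2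
  refine h1.unique (h2.congr_fun fun q => ?_)
  rw [← dampedCoeff_eq_moments ha hX hY]
  have h4 : ∀ T : Mat m, (-1) ^ q / (Nat.factorial q : ℝ) * besselCoeff a q T Y * bessel a T X =
      ∑ κ ∈ partitions m q, (-1) ^ q / (Nat.factorial q : ℝ) *
        (zonalOne κ * spherical κ Y / shiftedFactorial a κ) *
        (spherical κ (1 * T * 1ᵀ) * bessel a T X) := by
    intro T
    unfold besselCoeff
    rw [Finset.mul_sum, Finset.sum_mul]
    refine Finset.sum_congr rfl fun κ _ => ?_
    rw [transpose_one, Matrix.one_mul, Matrix.mul_one]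
    ring
  simp_rw [h4]
  rw [integral_finsetSum _ (fun κ hκ => (integrable_spherical_conj_mul ha
    (mem_partitions.mp hκ).1 1 hm (by norm_num) hb).const_mul _), Finset.mul_sum]
  refine Finset.sum_congr rfl fun κ _ => ?_
  rw [integral_const_mul, besselMoment]
  simp only [transpose_one, Matrix.one_mul, Matrix.mul_one]
  ring

/-! ### The test statistic -/

theorem etr_pos {m : ℕ} (X : Mat m) : 0 < etr X := Real.exp_pos _

theorem continuous_etr {m : ℕ} : Continuous (etr : Mat m → ℝ) :=
  Real.continuous_exp.comp (by fun_prop)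

theorem one_sub_diagonal_const {m : ℕ} (c : ℝ) (T : Mat m) :
    (1 - diagonal fun _ => 1 + c) * T = -(c • T) := by
  have h : (1 : Mat m) - diagonal (fun _ => 1 + c) = (-c) • (1 : Mat m) := by
    rw [← diagonal_one, diagonal_sub, ← diagonal_smul]
    congr 1
    ext i
    simp
  rw [h, Matrix.smul_mul, Matrix.one_mul, neg_smul]

theorem integral_etr_neg_smul {m : ℕ} {a : ℝ} (ha : ((m : ℝ) - 1) / 2 < a) {c : ℝ} (hc : 0 < c) :
    ∫ T, etr (-(c • T)) ∂(wishart a (1 : Mat m)) = (1 + c) ^ (-((m : ℝ) * a)) := by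
  have := isProbabilityMeasure_wishart (m := m) ha
  have hz : ∀ _ : Fin m, 0 < 1 + c := fun _ => by linarith
  have h := integral_wishart_diagonal ha hz (fun _ => 1)
  simp only [mul_one, integral_const, probReal_univ, smul_eq_mul, one_sub_diagonal_const,
    Finset.prod_const, Finset.card_fin] at h
  rw [h, ← Real.rpow_natCast, ← Real.rpow_mul (by linarith)]
  congr 1
  ring

/-- At a scalar Z the averaged exponential has a constant integrand, so the Laplace transform
becomes elementary. -/
theorem integral_etr_neg_smul_mul_bessel {m : ℕ} {a : ℝ} (ha : ((m : ℝ) - 1) / 2 < a) {X : Mat m}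
    (hX : X.IsSymm) {c : ℝ} (hc : 0 < c) :
    ∫ T, etr (-(c • T)) * bessel a T X ∂(wishart a (1 : Mat m)) =
      (1 + c) ^ (-((m : ℝ) * a)) * etr (-((1 + c)⁻¹ • X)) := by
  have hz : ∀ _ : Fin m, 0 < 1 + c := fun _ => by linarith
  have h := integral_etr_mul_bessel ha hX hz
  simp only [one_sub_diagonal_const, Finset.prod_const, Finset.card_fin] at h
  have h1 : (diagonal fun _ => (1 + c)⁻¹ : Mat m) = (1 + c)⁻¹ • 1 := by
    rw [← diagonal_one, ← diagonal_smul]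
    congr 1
    ext i
    simp
  rw [h, h1, etrAverage_smul_one, smul_neg, ← Real.rpow_natCast, ← Real.rpow_mul (by linarith)]
  congr 2
  ring

theorem multiGamma_mul_besselA {m : ℕ} {a : ℝ} (ha : ((m : ℝ) - 1) / 2 < a) (X Y : Mat m) :
    multiGamma m a * besselA (order m a) X Y = bessel a X Y := by
  unfold besselA bessel
  have h : order m a + ((m : ℝ) + 1) / 2 = a := sub_add_cancel _ _
  simp_rw [besselTerm_eq]
  rw [h, ← mul_assoc, mul_inv_cancel₀ (multiGamma_pos ha).ne', one_mul]

theorem empiricalHankel_eq {m n : ℕ} {a : ℝ} (ha : ((m : ℝ) - 1) / 2 < a) (Y : Fin n → Mat m)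
    (T : Mat m) : empiricalHankel (order m a) Y T = (n : ℝ)⁻¹ * ∑ j, bessel a T (Y j) := by
  unfold empiricalHankel
  have h : order m a + ((m : ℝ) + 1) / 2 = a := sub_add_cancel _ _
  rw [h, mul_left_comm, Finset.mul_sum]
  simp_rw [multiGamma_mul_besselA ha]

/-- The sign acts on the homogeneous part of degree k as (-1)^k, and this degree is the same in both
arguments. -/
theorem bessel_neg_comm {m : ℕ} (a : ℝ) (X Y : Mat m) : bessel a (-X) Y = bessel a (-Y) X := by
  unfold bessel
  simp_rw [besselCoeff_neg, besselCoeff_comm a _ X Y]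

theorem kernelH_eq {m : ℕ} {a : ℝ} (ha : ((m : ℝ) - 1) / 2 < a) (X Y : Mat m) :
    kernelH a X Y = etr (-X - Y) * bessel a (-X) Y - (a / (a + 1)) ^ ((m : ℝ) * a) *
      (etr (-((a / (a + 1)) • X)) + etr (-((a / (a + 1)) • Y))) +
      (2 / a + 1) ^ (-((m : ℝ) * a)) := by
  unfold kernelH
  rw [mul_right_comm, multiGamma_mul_besselA ha, mul_comm (bessel a (-X) Y)]

theorem kernelH_comm {m : ℕ} {a : ℝ} (ha : ((m : ℝ) - 1) / 2 < a) (X Y : Mat m) :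
    kernelH a X Y = kernelH a Y X := by
  have h : -Y - X = -X - Y := by abel
  rw [kernelH_eq ha, kernelH_eq ha, bessel_neg_comm, add_comm (etr _), h]

theorem posDef_sampleMean {m n : ℕ} (hn : 1 ≤ n) {X : Fin n → Mat m} (hX : ∀ j, (X j).PosDef) :
    (sampleMean X).PosDef := by
  have : Nonempty (Fin n) := ⟨⟨0, hn⟩⟩
  have hn' : (0 : ℝ) < n := by exact_mod_cast hn
  unfold sampleMean
  refine PosDef.smul ?_ (inv_pos.mpr hn')
  exact posDef_sum Finset.univ_nonempty fun j _ => hX j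

open scoped MatrixOrder in
theorem isSymm_isUnit_invSqrt {m : ℕ} {M : Mat m} (hM : M.PosDef) :
    (invSqrt M).IsSymm ∧ IsUnit (invSqrt M).det := by
  have h1 : CFC.sqrt M * CFC.sqrt M = M := CFC.sqrt_mul_sqrt_self M hM.posSemidef.nonneg
  have h2 : (CFC.sqrt M).PosSemidef := (CFC.sqrt_nonneg M).posSemidef
  have h3 : (CFC.sqrt M).IsSymm := by
    have := h2.isHermitian
    rwa [IsHermitian, conjTranspose_eq_transpose_of_trivial] at this
  have h4 : IsUnit (CFC.sqrt M).det := by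
    refine isUnit_iff_ne_zero.mpr fun h0 => hM.det_pos.ne' ?_
    rw [← h1, det_mul, h0, zero_mul]
  unfold invSqrt
  refine ⟨?_, ?_⟩
  · unfold IsSymm
    rw [transpose_nonsing_inv, h3]
  · rw [det_nonsing_inv]
    exact h4.ringInverse

theorem posDef_scaled {m n : ℕ} (hn : 1 ≤ n) {X : Fin n → Mat m} (hX : ∀ j, (X j).PosDef)
    (j : Fin n) : (scaled X j).PosDef := by
  obtain ⟨h1, h2⟩ := isSymm_isUnit_invSqrt (posDef_sampleMean hn hX)
  have h3 := posDef_conj (hX j) h2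
  rwa [h1] at h3

theorem integrable_bessel_mul_bessel {m : ℕ} {a : ℝ} (ha : ((m : ℝ) - 1) / 2 < a) (X Y : Mat m) :
    Integrable (fun T => bessel a T X * bessel a T Y) (wishart a (1 : Mat m)) := by
  refine integrable_wishart_of_le ha
    ((measurable_bessel ha X).mul (measurable_bessel ha Y)).aestronglyMeasurable
    (C := Real.exp (besselRate a X / (1 / 4)) * Real.exp (besselRate a Y / (1 / 4)))
    (s := 1 / 2) (by norm_num) fun T hT => ?_
  have h1 := abs_bessel_le ha hT.posSemidef X (ε := 1 / 4) (by norm_num)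
  have h2 := abs_bessel_le ha hT.posSemidef Y (ε := 1 / 4) (by norm_num)
  rw [abs_mul]
  refine (mul_le_mul h1 h2 (abs_nonneg _) (by positivity)).trans (le_of_eq ?_)
  have h3 : Real.exp (1 / 2 * T.trace) = Real.exp (1 / 4 * T.trace) * Real.exp (1 / 4 * T.trace) := by
    rw [← Real.exp_add]
    congr 1
    ring
  rw [h3]
  ring

theorem etr_neg_smul_le_one {m : ℕ} {c : ℝ} (hc : 0 ≤ c) {T : Mat m} (hT : T.PosSemidef) :
    |etr (-(c • T))| ≤ 1 := by
  rw [abs_of_pos (etr_pos _), etr, Real.exp_le_one_iff, trace_neg, trace_smul, smul_eq_mul,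
    neg_nonpos]
  exact mul_nonneg hc hT.trace_nonneg

theorem integrable_etr_mul_bessel {m : ℕ} {a : ℝ} (ha : ((m : ℝ) - 1) / 2 < a) {c : ℝ} (hc : 0 ≤ c)
    (X : Mat m) : Integrable (fun T => etr (-(c • T)) * bessel a T X) (wishart a (1 : Mat m)) := by
  have hm : Measurable fun T : Mat m => etr (-(c • T)) :=
    (continuous_etr.comp (by fun_prop)).measurable
  refine integrable_wishart_of_le ha (hm.mul (measurable_bessel ha X)).aestronglyMeasurable
    (C := Real.exp (besselRate a X / (1 / 2))) (s := 1 / 2) (by norm_num) fun T hT => ?_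
  have h1 := abs_bessel_le ha hT.posSemidef X (ε := 1 / 2) (by norm_num)
  rw [abs_mul]
  exact (mul_le_of_le_one_left (abs_nonneg _) (etr_neg_smul_le_one hc hT.posSemidef)).trans h1

theorem integrable_etr_neg_smul {m : ℕ} {a : ℝ} (ha : ((m : ℝ) - 1) / 2 < a) {c : ℝ} (hc : 0 ≤ c) :
    Integrable (fun T : Mat m => etr (-(c • T))) (wishart a (1 : Mat m)) := by
  have hm : Measurable fun T : Mat m => etr (-(c • T)) :=
    (continuous_etr.comp (by fun_prop)).measurable
  refine integrable_wishart_of_le ha hm.aestronglyMeasurable (C := 1) (s := 0) one_pos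
    fun T hT => ?_
  rw [zero_mul, Real.exp_zero, mul_one]
  exact etr_neg_smul_le_one hc hT.posSemidef

theorem etr_neg_smul_sq {m : ℕ} (c : ℝ) (T : Mat m) :
    etr (-(c • T)) ^ 2 = etr (-((2 * c) • T)) := by
  rw [etr, etr, ← Real.exp_nat_mul]
  congr 1
  rw [trace_neg, trace_neg, trace_smul, trace_smul, smul_eq_mul, smul_eq_mul]
  push_cast
  ring

/-- The terms that involve one observation or none are spread evenly over the pairs, so that each
summand integrates to the kernel. -/
theorem statIntegrand_eq {m n : ℕ} {a : ℝ} (ha : ((m : ℝ) - 1) / 2 < a) (hn : 1 ≤ n)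
    (X : Fin n → Mat m) (T : Mat m) :
    statIntegrand a X T = ((n : ℝ)⁻¹) ^ 2 * ∑ i, ∑ j,
      (bessel a T (scaled X i) * bessel a T (scaled X j) -
        (etr (-(a⁻¹ • T)) * bessel a T (scaled X i) + etr (-(a⁻¹ • T)) * bessel a T (scaled X j)) +
        etr (-((2 * a⁻¹) • T))) := by
  have hn' : (n : ℝ) ≠ 0 := by
    have : (0 : ℝ) < n := by exact_mod_cast hn
    exact this.ne'
  unfold statIntegrand
  rw [empiricalHankel_eq ha, ← etr_neg_smul_sq]
  simp only [Finset.sum_add_distrib, Finset.sum_sub_distrib, ← Finset.mul_sum, ← Finset.sum_mul,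
    Finset.sum_const, Finset.card_fin, nsmul_eq_mul]
  field_simp
  ring

theorem integrable_statIntegrand {m n : ℕ} {a : ℝ} (ha : ((m : ℝ) - 1) / 2 < a) (ha0 : 0 < a)
    (hn : 1 ≤ n) (X : Fin n → Mat m) :
    Integrable (statIntegrand a X) (wishart a (1 : Mat m)) := by
  simp_rw [funext fun T => statIntegrand_eq ha hn X T]
  refine Integrable.const_mul (integrable_finsetSum _ fun i _ => integrable_finsetSum _ fun j _ => ?_) _
  have h0 : 0 ≤ a⁻¹ := by positivity
  exact ((integrable_bessel_mul_bessel ha _ _).sub ((integrable_etr_mul_bessel ha h0 _).add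
    (integrable_etr_mul_bessel ha h0 _))).add (integrable_etr_neg_smul ha (by positivity))

theorem integral_kernel {m : ℕ} {a : ℝ} (ha : ((m : ℝ) - 1) / 2 < a) (ha0 : 0 < a) {X Y : Mat m}
    (hX : X.IsSymm) (hY : Y.IsSymm) :
    ∫ T, (bessel a T X * bessel a T Y -
      (etr (-(a⁻¹ • T)) * bessel a T X + etr (-(a⁻¹ • T)) * bessel a T Y) +
        etr (-((2 * a⁻¹) • T))) ∂(wishart a (1 : Mat m)) = kernelH a X Y := by
  have h0 : 0 < a⁻¹ := by positivity
  have hI1 := integrable_bessel_mul_bessel ha X Y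
  have hI2 := integrable_etr_mul_bessel ha h0.le X
  have hI3 := integrable_etr_mul_bessel ha h0.le Y
  have hI4 := integrable_etr_neg_smul (m := m) ha (c := 2 * a⁻¹) (by positivity)
  have hI23 : Integrable (fun T => etr (-(a⁻¹ • T)) * bessel a T X +
      etr (-(a⁻¹ • T)) * bessel a T Y) (wishart a (1 : Mat m)) := hI2.add hI3
  have hI123 : Integrable (fun T => bessel a T X * bessel a T Y - (etr (-(a⁻¹ • T)) *
      bessel a T X + etr (-(a⁻¹ • T)) * bessel a T Y)) (wishart a (1 : Mat m)) := hI1.sub hI23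
  rw [integral_add hI123 hI4, integral_sub hI1 hI23,
    integral_add hI2 hI3, integral_bessel_mul_bessel ha hX hY,
    integral_etr_neg_smul_mul_bessel ha hX h0, integral_etr_neg_smul_mul_bessel ha hY h0,
    integral_etr_neg_smul ha (by positivity), kernelH_eq ha]
  have h1 : (1 + a⁻¹)⁻¹ = a / (a + 1) := by field_simp
  have h2 : (1 + a⁻¹) ^ (-((m : ℝ) * a)) = (a / (a + 1)) ^ ((m : ℝ) * a) := by
    rw [Real.rpow_neg (by positivity), ← Real.inv_rpow (by positivity), h1]
  have h3 : 1 + 2 * a⁻¹ = 2 / a + 1 := by rw [div_eq_mul_inv, add_comm]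
  rw [h1, h2, h3, mul_add]

theorem testStatistic_eq {m n : ℕ} {a : ℝ} (ha : ((m : ℝ) - 1) / 2 < a) (ha0 : 0 < a)
    (hn : 1 ≤ n) {X : Fin n → Mat m} (hX : ∀ j, (X j).PosDef) :
    testStatistic a X = (n : ℝ)⁻¹ * ∑ i, ∑ j, kernelH a (scaled X i) (scaled X j) := by
  have hn' : (n : ℝ) ≠ 0 := by
    have : (0 : ℝ) < n := by exact_mod_cast hn
    exact this.ne'
  have h0 : 0 ≤ a⁻¹ := by positivity
  have hI : ∀ Y Z : Mat m, Integrable (fun T => bessel a T Y * bessel a T Z -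
      (etr (-(a⁻¹ • T)) * bessel a T Y + etr (-(a⁻¹ • T)) * bessel a T Z) +
        etr (-((2 * a⁻¹) • T))) (wishart a (1 : Mat m)) := fun Y Z =>
    ((integrable_bessel_mul_bessel ha _ _).sub ((integrable_etr_mul_bessel ha h0 _).add
      (integrable_etr_mul_bessel ha h0 _))).add (integrable_etr_neg_smul ha (by positivity))
  unfold testStatistic
  simp_rw [statIntegrand_eq ha hn]
  rw [integral_const_mul, integral_finsetSum _ fun i _ => integrable_finsetSum _ fun j _ => hI _ _]
  simp_rw [fun i => integral_finsetSum Finset.univ fun j _ => hI (scaled X i) (scaled X j),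
    fun i j => integral_kernel ha ha0 (PosDef.isSymm (posDef_scaled hn hX i))
      (PosDef.isSymm (posDef_scaled hn hX j))]
  field_simp

end WishartGOF

theorem proposition3p1 (m n : ℕ) (hm : 1 ≤ m) (hn : 1 ≤ n) (α : ℝ)
    (hα : (2 * (m : ℝ) - 1) / 2 < α) :
    (∀ X Y : WishartGOF.Mat m, X.IsSymm → Y.IsSymm →
      Summable (WishartGOF.besselTerm (WishartGOF.order m α) X Y)) ∧
    (∀ X Y : WishartGOF.Mat m, X.PosDef → Y.PosDef →
      WishartGOF.kernelH α X Y = WishartGOF.kernelH α Y X) ∧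
    ∀ X : Fin n → WishartGOF.Mat m, (∀ j, (X j).PosDef) →
      MeasureTheory.Integrable (WishartGOF.statIntegrand α X)
        (WishartGOF.wishart α (1 : WishartGOF.Mat m)) ∧
      WishartGOF.testStatistic α X =
        (n : ℝ)⁻¹ * ∑ i, ∑ j,
          WishartGOF.kernelH α (WishartGOF.scaled X i) (WishartGOF.scaled X j) := by
  have hm' : (1 : ℝ) ≤ m := by exact_mod_cast hm
  have ha : ((m : ℝ) - 1) / 2 < α := by linarith
  have ha0 : 0 < α := by linarith
  refine ⟨fun X Y _ _ => ?_, fun X Y _ _ => WishartGOF.kernelH_comm ha X Y, fun X hX =>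
    ⟨WishartGOF.integrable_statIntegrand ha ha0 hn X, WishartGOF.testStatistic_eq ha ha0 hn hX⟩⟩
  exact (WishartGOF.summable_bessel ha X Y).congr fun k => (WishartGOF.besselTerm_eq α X Y k).symm
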